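/- **Setting.** Let $P$ satisfy $P\in C^1(0,\infty)$, $P'>0$, and $\lim_{s\to0+}s^{1-\gamma_0}P'(s)=K>0$ for some $\gamma_0\in(\tfrac65,2)$. Let $\Phi'(\rho)=\int_0^\rho \frac{P'(t)}{t}\,dt$, and let $F_+:\mathbf R\to[0,\infty)$ be the inverse of $\Phi':(0,\infty)\to(0,s_{\max})$, $s_{\max}=\int_0^\infty \frac{P'(t)}{t}dt$, extended by zero. For $\mu>0$ let $y_\mu$ be the solution on $[0,\infty)$ of $$y''+\tfrac2r y'=-4\pi F_+(y),\qquad y(0)=\Phi'(\mu),\quad y'(0)=0 .$$ If $y_\mu$ vanishes at some finite $R_\mu>0$, then $\rho_\mu(r)=F_+(y_\mu(r))$ for $r<R_\mu$, $\rho_\mu(r)=0$ for $r\ge R_\mu$, is the density of a compactly supported non-rotating star with center density $\mu$ and support radius $R_\mu$; $M(\mu)=\int_{\mathbf R^3}\rho_\mu(|x|)\,dx$ is its mass, and $V_\mu$ is its gravitational potential, i.e. the radial solution of $\Delta V_\mu=4\pi\rho_\mu$ with $V_\mu\to0$ at infinity. Let $\mu_{\max}\in(0,\infty]$ be the supremum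 of the $\mu>0$ such that a compactly supported star exists for every center density $\mu'\in(0,\mu]$. For $\mu\in(0,\mu_{\max})$ let $D_\mu^0$ be the restriction of $D_\mu=-\Delta-4\pi F_+'(V_\mu(R_\mu)-V_\mu)$ to radial functions in $\dot H^1(\mathbf R^3)=\{u\in L^6(\mathbf R^3): \nabla u\in L^2(\mathbf R^3)\}$, with quadratic form $$\langle D_\mu u,u\rangle=\int_{\mathbf R^3}|\nabla u|^2dx-4\pi\int_{\mathbf R^3}F_+'(V_\mu(R_\mu)-V_\mu)\,u^2dx ,$$ and let $n^-(D_\mu^0)$ be its Morse index, the maximal dimension of a subspace of radial functions in $\dot H^1(\mathbf R^3)$ on which this form is negative definite. Finally let $$i_\mu=\begin{cases}1&\text{if }M'(\mu)\frac{d}{d\mu}\big(\frac{M(\mu)}{R_\mu}\big)>0\text{ or }M'(\mu)=0,\\ 0&\text{if }M'(\mu)\frac{d}{d\mu}\big(\frac{M(\mu)}{R_\mu}\big)<0\text{ or }\frac{d}{d\mu}\big(\frac{M(\mu)}{R_\mu}\big)=0,\end{cases}$$ where $M'(\mu)$ and $\frac{d}{d\mu}\big(\frac{M(\mu)}{R_\mu}\big)$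 never vanish simultaneously. **Proposition 3.1.** Let $\mu_*\in(0,\mu_{\max})$ be a critical point of $\mu\mapsto M(\mu)/R_\mu$. Then $n^-(D_{\mu_*}^0)<\infty$, and for all $\mu$ sufficiently near $\mu_*$ the functions $M(\mu)$ and $M(\mu)/R_\mu$ are differentiable at $\mu$ and $$n^-(D_\mu^0)=n^-(D_{\mu_*}^0)+i_\mu .$$ Consequently the jump of $n^-(D_\mu^0)$ at $\mu_*$ equals the jump of $i_\mu$ at $\mu_*$: for every integer $d$, $n^-(D_\mu^0)$ is constant on each side of $\mu_*$ near $\mu_*$ with (right value) $-$ (left value) $=d$ if and only if the same holds for $i_\mu$. -/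

import Mathlib

open Set Filter Topology MeasureTheory

noncomputable section

namespace GaseousStar

/-- Physical space `ℝ³` with its Euclidean norm. -/
abbrev Space : Type := EuclideanSpace ℝ (Fin 3)

/-- The assumptions on the pressure law: `P ∈ C¹(0,∞)`, `P' > 0` and
`s ^ (1 - γ₀) P'(s) → K > 0` as `s → 0+`, with `6/5 < γ₀ < 2`. -/
structure IsPressureLaw (P : ℝ → ℝ) (γ₀ K : ℝ) : Prop where
  contDiffOn : ContDiffOn ℝ 1 P (Ioi 0)
  deriv_pos : ∀ s, 0 < s → 0 < deriv P s
  lower : 6 / 5 < γ₀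
  upper : γ₀ < 2
  const_pos : 0 < K
  tendsto_zero : Tendsto (fun s : ℝ => s ^ (1 - γ₀) * deriv P s) (𝓝[>] 0) (𝓝 K)

/-- The derivative `Φ'` of the enthalpy, where `Φ'(0) = 0` and `Φ''(ρ) = P'(ρ) / ρ`. -/
def enthalpyDeriv (P : ℝ → ℝ) (ρ : ℝ) : ℝ :=
  ∫ t in (0 : ℝ)..ρ, deriv P t / t

open Classical in
/-- `F₊`: the inverse of `Φ' : (0,∞) → (0, s_max)`, extended by zero. -/
def Fplus (P : ℝ → ℝ) (s : ℝ) : ℝ :=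
  if h : ∃ ρ : ℝ, 0 < ρ ∧ enthalpyDeriv P ρ = s then h.choose else 0

/-- `y` solves `y'' + (2/r) y' = -4π F₊(y)`, `y(0) = Φ'(μ)`, `y'(0) = 0` on `[0,∞)`, in the
first order form `y'(r) = -(4π/r²) ∫₀ʳ s² F₊(y(s)) ds`, and vanishes at the radius `R > 0`. -/
structure IsStarProfile (P : ℝ → ℝ) (μ : ℝ) (y : ℝ → ℝ) (R : ℝ) : Prop where
  init : y 0 = enthalpyDeriv P μ
  cont : ContinuousWithinAt y (Ici 0) 0
  ode : ∀ r, 0 < r →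
    HasDerivAt y (-(4 * Real.pi / r ^ 2) * ∫ s in (0 : ℝ)..r, s ^ 2 * Fplus P (y s)) r
  radius_pos : 0 < R
  vanish : y R = 0

/-- There is a compactly supported non-rotating star with center density `μ`. -/
def HasStar (P : ℝ → ℝ) (μ : ℝ) : Prop :=
  ∃ (y : ℝ → ℝ) (R : ℝ), IsStarProfile P μ y R

/-- `μ_max = sup {μ | there is a compactly supported star for every μ' ∈ (0, μ]}`, possibly `∞`. -/
def muMax (P : ℝ → ℝ) : EReal :=
  sSup ((fun μ : ℝ => (μ : EReal)) '' {μ : ℝ | 0 < μ ∧ ∀ μ' ∈ Ioc 0 μ, HasStar P μ'})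

open Classical in
/-- The profile `y_μ` (only its values on `[0,∞)` matter). -/
def profile (P : ℝ → ℝ) (μ : ℝ) : ℝ → ℝ :=
  if h : HasStar P μ then h.choose else 0

open Classical in
/-- The support radius `R_μ`, i.e. the zero of `y_μ`. -/
def radius (P : ℝ → ℝ) (μ : ℝ) : ℝ :=
  if h : HasStar P μ then h.choose_spec.choose else 0

/-- The density `ρ_μ` as a function of `r = |x|`: `F(y_μ(r))` for `r < R_μ`, and `0` outside. -/
def density (P : ℝ → ℝ) (μ : ℝ) (r : ℝ) : ℝ :=
  if r < radius P μ then Fplus P (profile P μ r) else 0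

/-- The total mass `M(μ) = ∫_{ℝ³} ρ_μ(|x|) dx`. -/
def mass (P : ℝ → ℝ) (μ : ℝ) : ℝ :=
  ∫ x : Space, density P μ ‖x‖

/-- The gravitational potential `V_μ` as a function of `r = |x|`: the radial solution of
`ΔV = V'' + (2/r) V' = 4π ρ_μ` with `V(r) → 0` as `r → ∞`, that is
`V_μ(r) = -∫_r^∞ (4π/s²) ∫₀ˢ t² ρ_μ(t) dt ds`. -/
def potential (P : ℝ → ℝ) (μ : ℝ) (r : ℝ) : ℝ :=
  -∫ s in Ioi r, (4 * Real.pi / s ^ 2) * ∫ t in (0 : ℝ)..s, t ^ 2 * density P μ t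

/-- The mass-radius ratio `M(μ) / R_μ`. -/
def massRadiusRatio (P : ℝ → ℝ) (μ : ℝ) : ℝ :=
  mass P μ / radius P μ

open Classical in
/-- The index `i_μ`: it is `1` if `M'(μ) (M/R)'(μ) > 0` or `M'(μ) = 0`, and `0` otherwise, i.e. if
`M'(μ) (M/R)'(μ) < 0` or `(M/R)'(μ) = 0` (with `M'(μ) ≠ 0`; `M'` and `(M/R)'` have no common
zero). -/
def turningIndex (P : ℝ → ℝ) (μ : ℝ) : ℕ :=
  if 0 < deriv (mass P) μ * deriv (massRadiusRatio P) μ ∨ deriv (mass P) μ = 0 then 1 else 0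

/-- `G` is the weak gradient of `u` on `ℝ³`: `∫ u ∂_v φ = -∫ φ ⟨G, v⟩` for all test functions
`φ ∈ C_c^∞(ℝ³)` and all directions `v`. -/
def HasWeakGradient (u : Space → ℝ) (G : Space → Space) : Prop :=
  ∀ φ : Space → ℝ, ContDiff ℝ (⊤ : ℕ∞) φ → HasCompactSupport φ → ∀ v : Space,
    ∫ x, u x * fderiv ℝ φ x v = -∫ x, φ x * inner ℝ (G x) v

/-- `u` is (almost everywhere) a function of `|x|`. -/
def IsRadial (u : Space → ℝ) : Prop :=
  ∃ f : ℝ → ℝ, Measurable f ∧ ∀ᵐ x : Space, u x = f ‖x‖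

/-- The ambient space for pairs `(u, ∇u)` with `u ∈ L⁶(ℝ³)` and `∇u ∈ L²(ℝ³; ℝ³)`. -/
abbrev FunctionGradientPairs : Type :=
  Lp ℝ 6 (volume : Measure Space) × Lp Space 2 (volume : Measure Space)

/-- The space of radial functions in `Ḣ¹(ℝ³) = {u ∈ L⁶(ℝ³) | ∇u ∈ L²(ℝ³; ℝ³)}`, where a function
`u` is represented by the pair `(u, ∇u)`. -/
def radialHomSobolev : Set FunctionGradientPairs :=
  {p | HasWeakGradient p.1 p.2 ∧ IsRadial p.1}

/-- The quadratic form of `D_μ = -Δ - 4π F₊'(V_μ(R_μ) - V_μ)`: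
`⟨D_μ u, u⟩ = ∫ |∇u|² dx - 4π ∫ F₊'(V_μ(R_μ) - V_μ) u² dx`, for a pair `p = (u, ∇u)`. -/
def formD (P : ℝ → ℝ) (μ : ℝ) (p : FunctionGradientPairs) : ℝ :=
  (∫ x, ‖p.2 x‖ ^ 2) -
    4 * Real.pi * ∫ x : Space,
      deriv (Fplus P) (potential P μ (radius P μ) - potential P μ ‖x‖) * (p.1 x) ^ 2

/-- The Morse index `n⁻(D_μ⁰)`, where `D_μ⁰` is `D_μ` restricted to radial functions: the
supremum of the dimensions of the subspaces of the radial part of `Ḣ¹(ℝ³)` on which the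
quadratic form of `D_μ` is negative definite. -/
def morseIndex (P : ℝ → ℝ) (μ : ℝ) : ℕ∞ :=
  ⨆ (W : Submodule ℝ FunctionGradientPairs) (_ : FiniteDimensional ℝ W)
    (_ : ∀ p ∈ W, p ∈ radialHomSobolev ∧ (p ≠ 0 → formD P μ p < 0)),
    (Module.finrank ℝ W : ℕ∞)

/-- `f` is eventually constant on each side of `x`, and the right value minus the left value is
the jump `d`. -/
def HasJumpAt (f : ℝ → ℤ) (x : ℝ) (d : ℤ) : Prop :=
  ∃ a b : ℤ, (∀ᶠ t in 𝓝[<] x, f t = a) ∧ (∀ᶠ t in 𝓝[>] x, f t = b) ∧ b - a = d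

end GaseousStar

end

/-!
The Morse index is computed by oscillation theory, and the zeros that it counts are followed through
the derivative of the stellar profile in the center density.

Since `V_μ(R_μ) - V_μ = y_μ`, also outside the star, the form of `D_μ` is
`∫ |∇u|² - ∫ q(|x|) u²` with the continuous, nonnegative, compactly supported potential
`q = 4π F₊'(y_μ)` (`formD_eq`). Here `γ₀ < 2` makes `F₊` continuously differentiable across zero.
A radial function `f` of the homogeneous Sobolev space has an absolutely continuous representative,
and `U = r f` turns the form into `4π (∫ U'² - q U²)` up to boundary terms. The comparison function
is the regular solution of `u'' = -q u`, `u(0) = 0`, `u'(0) = 1`.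

On a mesh `t₀ < … < t_m` so fine that `u` has at most one zero in each gap, and reaching beyond the
star, the Morse index is the number of sign changes of `u` at consecutive nodes, plus one if `u`,
which is affine beyond `t_m`, has a zero there (`radialIndex_eq`). For the upper bound
(`radialIndex_le`) one linear condition is imposed per sign change; on what remains the form is
nonnegative gap by gap, by completing squares with the Riccati quotient of a solution. For the lower
bound (`le_radialIndex`) `u` is cut off linearly after suitable nodes, which produces independent
functions on whose span the form is negative. The count is phrased through sign changes at nodes,
not through zeros, because the signs of `u` at finitely many nodes are stable under perturbation of
the potential.

The function `u / r`, with `u = u_μ`, solves the linearized stellar equation, so that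
`d/dμ y_μ(r) = Φ''(μ) u_μ(r) / r` (`hasDerivAt_profile`). Outside the star `y_μ = M / r - M / R`;
hence if `u_μ(r) = A r + B` there, then `M' = Φ''(μ) B` and `(M/R)' = -Φ''(μ) A`
(`hasDerivAt_mass`, `hasDerivAt_massRadiusRatio`). At a critical point `μ_*` of `M/R` the slope `A`
vanishes and `B ≠ 0`: `u_{μ_*}` is a nonzero constant outside the star. As `u_μ` depends
continuously on `μ` (`tendsto_regularSolution`), the sign changes at the nodes are the same for all
`μ` near `μ_*`, and only the zero beyond the last node can be gained. It is present exactly when `A`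
and `B` have opposite signs, i.e. when `i_μ = 1` (`turningIndex_eq`). This gives
`eventually_morseIndex_eq`, and the statement about jumps is a formal consequence.
-/

namespace GaseousStar

/-! ### A Grönwall estimate for the singular radial operator -/

/-- Grönwall's inequality for `w'(r) = -r⁻² ∫₀ʳ s² Δ(s) ds` with `|Δ| ≤ κ (|w| + ε)`. The factor
`r⁻²` is harmless because `r⁻² ∫₀ʳ s² ds ≤ r`. -/
lemma abs_le_of_radial_deriv {w Δ : ℝ → ℝ} {T κ ε δ : ℝ} (hκ : 0 ≤ κ) (hε : 0 ≤ ε)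
    (hT : 0 ≤ T) (hc : ContinuousOn w (Icc 0 T)) (h0 : |w 0| ≤ δ)
    (hw : ∀ r ∈ Ioc 0 T, HasDerivAt w (-(1 / r ^ 2) * ∫ s in (0 : ℝ)..r, s ^ 2 * Δ s) r)
    (hΔ : ∀ s ∈ Ioc 0 T, |Δ s| ≤ κ * (|w s| + ε)) {r : ℝ} (hr : r ∈ Icc 0 T) :
    |w r| ≤ 2 * Real.exp ((2 * κ * T + 1) * T) * (δ + κ * T ^ 2 * ε) := by
  -- maximize `|w| e^{-lr}`; for this rate `l` the perturbation halves the maximum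
  set l := 2 * κ * T + 1 with hl
  have hl0 : 0 < l := by positivity
  have hne : (Icc 0 T).Nonempty := ⟨0, by simp [hT]⟩
  have hcont : ContinuousOn (fun r => |w r| * Real.exp (-(l * r))) (Icc 0 T) := by fun_prop
  obtain ⟨r0, hr0, hmax⟩ := isCompact_Icc.exists_isMaxOn hne hcont
  set M := |w r0| * Real.exp (-(l * r0)) with hM
  have hM0 : 0 ≤ M := by positivity
  have hwM : ∀ s ∈ Icc 0 T, |w s| ≤ M * Real.exp (l * s) := by
    intro s hs
    have := hmax hs
    simp only [mem_ofPred_eq] at this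
    calc |w s| = |w s| * Real.exp (-(l * s)) * Real.exp (l * s) := by
          rw [mul_assoc, ← Real.exp_add]; simp
      _ ≤ _ := by gcongr
  have hder : ∀ r ∈ Ioc 0 T, |(-(1 / r ^ 2) * ∫ s in (0 : ℝ)..r, s ^ 2 * Δ s)| ≤
      κ * T * M * Real.exp (l * r) + κ * T * ε := by
    intro r hr
    have h1 : ‖∫ s in (0 : ℝ)..r, s ^ 2 * Δ s‖ ≤ (r ^ 2 * (κ * (M * Real.exp (l * r) + ε))) *
        |r - 0| := by
      apply intervalIntegral.norm_integral_le_of_norm_le_const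
      intro s hs
      rw [uIoc_of_le hr.1.le] at hs
      have hsT : s ∈ Ioc 0 T := ⟨hs.1, hs.2.trans hr.2⟩
      rw [norm_mul, Real.norm_eq_abs, Real.norm_eq_abs, abs_of_nonneg (by positivity)]
      have h2 := hΔ s hsT
      have h3 := hwM s ⟨hs.1.le, hsT.2⟩
      have h4 : M * Real.exp (l * s) ≤ M * Real.exp (l * r) := by
        gcongr; exact hs.2
      have h5 : s ^ 2 ≤ r ^ 2 := by
        have := hs.1; have := hs.2; gcongr
      calc s ^ 2 * |Δ s| ≤ r ^ 2 * (κ * (|w s| + ε)) := by gcongr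
        _ ≤ _ := by gcongr; linarith
    have hr0 := hr.1
    rw [abs_mul, abs_neg, abs_of_nonneg (by positivity : (0 : ℝ) ≤ 1 / r ^ 2)]
    rw [Real.norm_eq_abs, sub_zero, abs_of_pos hr.1] at h1
    calc 1 / r ^ 2 * |∫ s in (0 : ℝ)..r, s ^ 2 * Δ s|
        ≤ 1 / r ^ 2 * ((r ^ 2 * (κ * (M * Real.exp (l * r) + ε))) * r) := by gcongr
      _ = κ * r * (M * Real.exp (l * r) + ε) := by field_simp
      _ ≤ κ * T * (M * Real.exp (l * r) + ε) := by gcongr; exact hr.2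
      _ = _ := by ring
  have hB : ∀ x : ℝ, HasDerivAt (fun x => κ * T * M * (Real.exp (l * x) / l) + κ * T * ε * x)
      (κ * T * M * Real.exp (l * x) + κ * T * ε) x := by
    intro x
    have h1 : HasDerivAt (fun x => Real.exp (l * x)) (Real.exp (l * x) * l) x := by
      simpa using (((hasDerivAt_id x).const_mul l).exp)
    refine (((h1.div_const l).const_mul (κ * T * M)).add
      ((hasDerivAt_id x).const_mul (κ * T * ε))).congr_deriv ?_
    field_simp
  have hBc : Continuous (fun x => κ * T * M * (Real.exp (l * x) / l) + κ * T * ε * x) := by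
    fun_prop
  have key : ∀ σ : ℝ, |σ| = 1 → MonotoneOn
      (fun x => κ * T * M * (Real.exp (l * x) / l) + κ * T * ε * x + σ * w x) (Icc 0 T) := by
    intro σ hσ
    apply monotoneOn_of_deriv_nonneg (convex_Icc 0 T)
    · exact hBc.continuousOn.add (continuousOn_const.mul hc)
    · intro x hx
      rw [interior_Icc] at hx
      exact ((hB x).add
        ((hw x ⟨hx.1, hx.2.le⟩).const_mul σ)).differentiableAt.differentiableWithinAt
    · intro x hx
      rw [interior_Icc] at hx
      have := ((hB x).add ((hw x ⟨hx.1, hx.2.le⟩).const_mul σ)).deriv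
      change 0 ≤ deriv ((fun x => κ * T * M * (Real.exp (l * x) / l) + κ * T * ε * x) +
        fun x => σ * w x) x
      rw [this]
      have h1 := hder x ⟨hx.1, hx.2.le⟩
      have h2 := neg_abs_le (σ * (-(1 / x ^ 2) * ∫ s in (0 : ℝ)..x, s ^ 2 * Δ s))
      rw [abs_mul, hσ, one_mul] at h2
      linarith
  have hzero : (0 : ℝ) ∈ Icc 0 T := ⟨le_rfl, hT⟩
  have e0 : |w r0| ≤ δ + κ * T * M * (Real.exp (l * r0) / l) + κ * T * ε * r0 := by
    have h1 := key 1 (by simp) hzero hr0 hr0.1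
    have h2 := key (-1) (by simp) hzero hr0 hr0.1
    have h3 := abs_le.1 h0
    have h4 : 0 ≤ κ * T * M * (Real.exp (l * 0) / l) := by positivity
    simp only at h1 h2
    rw [abs_le]
    constructor <;> linarith
  have e1 : |w r0| = M * Real.exp (l * r0) := by
    rw [hM, mul_assoc, ← Real.exp_add]; simp
  have e2 : κ * T * M * (Real.exp (l * r0) / l) ≤ M * Real.exp (l * r0) / 2 := by
    have : κ * T / l ≤ 1 / 2 := by
      rw [div_le_div_iff₀ hl0 (by norm_num)]; linarith
    calc κ * T * M * (Real.exp (l * r0) / l) = (κ * T / l) * (M * Real.exp (l * r0)) := by ring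
      _ ≤ 1 / 2 * (M * Real.exp (l * r0)) := by gcongr
      _ = _ := by ring
  have e3 : κ * T * ε * r0 ≤ κ * T ^ 2 * ε := by
    calc κ * T * ε * r0 ≤ κ * T * ε * T := by gcongr; exact hr0.2
      _ = _ := by ring
  have e4 : M ≤ 2 * (δ + κ * T ^ 2 * ε) := by
    have h1 : M * 1 ≤ M * Real.exp (l * r0) := by
      gcongr; exact Real.one_le_exp (mul_nonneg hl0.le hr0.1)
    linarith
  calc |w r| ≤ M * Real.exp (l * r) := hwM r hr
    _ ≤ (2 * (δ + κ * T ^ 2 * ε)) * Real.exp (l * T) := by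
        gcongr
        · exact hM0.trans e4
        · exact hr.2
    _ = _ := by ring

/-! ### The linearized equation on the half-line -/

/-- `u'' = -q u` on `[0, ∞)` with `u(0) = 0`, `u'(0) = 1`, where `p = u'`. Then `u(r) / r` is the
radial solution of `-Δψ = qψ` on `ℝ³` which is regular at the origin and `ψ(0) = 1`. -/
structure IsRegularSolution (q u p : ℝ → ℝ) : Prop where
  u_zero : u 0 = 0
  p_zero : p 0 = 1
  hasDerivAt_u : ∀ r, 0 ≤ r → HasDerivAt u (p r) r
  hasDerivAt_p : ∀ r, 0 ≤ r → HasDerivAt p (-(q r * u r)) r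

lemma abs_integral_sub_mul_le {h : ℝ → ℝ} {K l τ : ℝ} (hl : 0 < l) (hK : 0 ≤ K) (hτ : 0 ≤ τ)
    (hh : ∀ s ∈ Icc 0 τ, |h s| ≤ K * Real.exp (l * s)) :
    |∫ s in (0 : ℝ)..τ, (τ - s) * h s| ≤ K * Real.exp (l * τ) / l ^ 2 := by
  have hder : ∀ s : ℝ, HasDerivAt (fun s => ((τ - s) / l + 1 / l ^ 2) * Real.exp (l * s))
      ((τ - s) * Real.exp (l * s)) s := by
    intro s
    have h1 : HasDerivAt (fun x => Real.exp (l * x)) (Real.exp (l * s) * l) s := by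
      simpa using (((hasDerivAt_id s).const_mul l).exp)
    have h2 : HasDerivAt (fun s => (τ - s) / l + 1 / l ^ 2) (-1 / l) s := by
      simpa using ((((hasDerivAt_id s).const_sub τ).div_const l).add_const (1 / l ^ 2))
    refine (h2.mul h1).congr_deriv ?_
    field_simp
    ring
  have hint : ∫ s in (0 : ℝ)..τ, (τ - s) * Real.exp (l * s) =
      Real.exp (l * τ) / l ^ 2 - (τ / l + 1 / l ^ 2) := by
    rw [intervalIntegral.integral_eq_sub_of_hasDerivAt (fun s _ => hder s)
      (Continuous.intervalIntegrable (by fun_prop) _ _)]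
    simp
    ring
  have h1 : ‖∫ s in (0 : ℝ)..τ, (τ - s) * h s‖ ≤
      ∫ s in (0 : ℝ)..τ, K * ((τ - s) * Real.exp (l * s)) := by
    apply intervalIntegral.norm_integral_le_of_norm_le hτ
    · refine Eventually.of_forall fun s hs => ?_
      have := hh s ⟨hs.1.le, hs.2⟩
      rw [norm_mul, Real.norm_eq_abs, Real.norm_eq_abs, abs_of_nonneg (by linarith [hs.2])]
      have h3 : 0 ≤ τ - s := by linarith [hs.2]
      nlinarith
    · exact Continuous.intervalIntegrable (by fun_prop) _ _
  rw [intervalIntegral.integral_const_mul, hint] at h1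
  calc _ ≤ _ := h1
    _ ≤ K * (Real.exp (l * τ) / l ^ 2) := by
      gcongr
      have : 0 ≤ τ / l + 1 / l ^ 2 := by positivity
      linarith
    _ = _ := by ring

/-- The Picard operator for `u'' = -q u`, `u(0) = 0`, `u'(0) = 1`, acting on `z(t) = e^{-lt} u(t)`
for `t ≥ 0` (and constant for `t ≤ 0`). -/
noncomputable def picard (q : ℝ → ℝ) (l : ℝ) (z : ℝ → ℝ) (t : ℝ) : ℝ :=
  Real.exp (-(l * max t 0)) * (max t 0 -
    ∫ s in (0 : ℝ)..(max t 0), (max t 0 - s) * (q s * Real.exp (l * s) * z s))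

lemma integral_sub_mul_eq {h : ℝ → ℝ} (hh : Continuous h) (t : ℝ) :
    ∫ s in (0 : ℝ)..t, (t - s) * h s =
      t * (∫ s in (0 : ℝ)..t, h s) - ∫ s in (0 : ℝ)..t, s * h s := by
  rw [← intervalIntegral.integral_const_mul, ← intervalIntegral.integral_sub]
  · congr 1; ext s; ring
  · exact Continuous.intervalIntegrable (by fun_prop) _ _
  · exact Continuous.intervalIntegrable (by fun_prop) _ _

lemma continuous_integral_sub_mul {h : ℝ → ℝ} (hh : Continuous h) :
    Continuous fun t => ∫ s in (0 : ℝ)..t, (t - s) * h s := by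
  simp_rw [integral_sub_mul_eq hh]
  have h1 : Continuous fun t => ∫ s in (0 : ℝ)..t, h s :=
    intervalIntegral.continuous_primitive (fun a b => hh.intervalIntegrable a b) 0
  have h2 : Continuous fun t => ∫ s in (0 : ℝ)..t, s * h s :=
    intervalIntegral.continuous_primitive
      (fun a b => (continuous_id.mul hh).intervalIntegrable a b) 0
  fun_prop

/-- Existence on the whole half-line: in the exponentially weighted norm the Picard operator is a
contraction with constant `C / l² ≤ 1 / 2`. -/
lemma exists_isRegularSolution {q : ℝ → ℝ} {C : ℝ} (hq : Continuous q)
    (hC : ∀ r, |q r| ≤ C) : ∃ u p, IsRegularSolution q u p := by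
  have hC0 : 0 ≤ C := (abs_nonneg _).trans (hC 0)
  set l := C + 1 with hl
  have hl0 : 0 < l := by positivity
  have hC2 : C / l ^ 2 ≤ 1 / 2 := by
    rw [div_le_div_iff₀ (by positivity) (by norm_num)]; nlinarith
  have hcont : ∀ z : BoundedContinuousFunction ℝ ℝ, Continuous (picard q l z) := by
    intro z
    have h1 : Continuous fun s => q s * Real.exp (l * s) * z s := by fun_prop
    have h2 := (continuous_integral_sub_mul h1).comp (continuous_id.max continuous_const :
      Continuous fun t : ℝ => max t 0)
    unfold picard
    exact Continuous.mul (by fun_prop) (Continuous.sub (by fun_prop) h2)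
  have hexp : ∀ τ : ℝ, Real.exp (-(l * τ)) * Real.exp (l * τ) = 1 := fun τ => by
    rw [← Real.exp_add]; simp
  have hbound : ∀ (z : ℝ → ℝ) (K : ℝ), (∀ s, |z s| ≤ K) → ∀ τ, 0 ≤ τ →
      |Real.exp (-(l * τ)) * ∫ s in (0 : ℝ)..τ, (τ - s) * (q s * Real.exp (l * s) * z s)| ≤
        1 / 2 * K := by
    intro z K hz τ hτ
    have hK : 0 ≤ K := (abs_nonneg _).trans (hz 0)
    have := abs_integral_sub_mul_le (h := fun s => q s * Real.exp (l * s) * z s) (K := C * K)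
      hl0 (by positivity) hτ (fun s _ => by
        rw [abs_mul, abs_mul, abs_of_pos (Real.exp_pos _)]
        calc |q s| * Real.exp (l * s) * |z s| ≤ C * Real.exp (l * s) * K := by
              gcongr; exacts [hC s, hz s]
          _ = _ := by ring)
    rw [abs_mul, abs_of_pos (Real.exp_pos _)]
    calc _ ≤ Real.exp (-(l * τ)) * (C * K * Real.exp (l * τ) / l ^ 2) := by gcongr
      _ = C / l ^ 2 * K * (Real.exp (-(l * τ)) * Real.exp (l * τ)) := by ring
      _ = C / l ^ 2 * K := by rw [hexp, mul_one]
      _ ≤ _ := by gcongr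
  have hbd : ∀ z : BoundedContinuousFunction ℝ ℝ, ∀ t,
      ‖picard q l z t‖ ≤ 1 / l + 1 / 2 * ‖z‖ := by
    intro z t
    set τ := max t 0 with hτ
    have hτ0 : 0 ≤ τ := le_max_right _ _
    have h1 := hbound z ‖z‖ (fun s => z.norm_coe_le_norm s) τ hτ0
    have h2 : Real.exp (-(l * τ)) * τ ≤ 1 / l := by
      have h3 : l * τ ≤ Real.exp (l * τ) := by linarith [Real.add_one_le_exp (l * τ)]
      rw [le_div_iff₀ hl0]
      calc Real.exp (-(l * τ)) * τ * l = Real.exp (-(l * τ)) * (l * τ) := by ring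
        _ ≤ Real.exp (-(l * τ)) * Real.exp (l * τ) := by gcongr
        _ = 1 := hexp τ
    have h3 : 0 ≤ Real.exp (-(l * τ)) * τ := by positivity
    unfold picard
    rw [← hτ, mul_sub, Real.norm_eq_abs]
    rw [abs_le] at h1 ⊢
    constructor <;> linarith
  let Φ : BoundedContinuousFunction ℝ ℝ → BoundedContinuousFunction ℝ ℝ := fun z =>
    BoundedContinuousFunction.ofNormedAddCommGroup (picard q l z) (hcont z) _ (hbd z)
  have hcontr : ContractingWith (1 / 2 : NNReal) Φ := by
    refine ⟨by rw [← NNReal.coe_lt_coe]; norm_num, LipschitzWith.of_dist_le_mul fun z z' => ?_⟩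
    have hd : 0 ≤ dist z z' := dist_nonneg
    rw [BoundedContinuousFunction.dist_le (by positivity)]
    intro t
    set τ := max t 0 with hτ
    have hτ0 : 0 ≤ τ := le_max_right _ _
    have h1 := hbound (fun s => z' s - z s) (dist z z')
      (fun s => by
        rw [← Real.dist_eq, dist_comm]
        exact BoundedContinuousFunction.dist_coe_le_dist s) τ hτ0
    have h2 : Φ z t - Φ z' t = Real.exp (-(l * τ)) *
        ∫ s in (0 : ℝ)..τ, (τ - s) * (q s * Real.exp (l * s) * (z' s - z s)) := by
      change picard q l z t - picard q l z' t = _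
      unfold picard
      rw [← hτ, ← mul_sub, sub_sub_sub_cancel_left, ← intervalIntegral.integral_sub]
      · congr 2; ext s; ring
      · exact Continuous.intervalIntegrable (by fun_prop) _ _
      · exact Continuous.intervalIntegrable (by fun_prop) _ _
    rw [Real.dist_eq, h2]
    simpa using h1
  set z := ContractingWith.fixedPoint Φ hcontr
  have hz : Φ z = z := hcontr.fixedPoint_isFixedPt
  set h : ℝ → ℝ := fun s => q s * Real.exp (l * s) * z s with hh
  have hhc : Continuous h := by fun_prop
  have hi : ∀ r, HasDerivAt (fun t => ∫ s in (0 : ℝ)..t, h s) (h r) r := fun r =>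
    intervalIntegral.integral_hasDerivAt_right (hhc.intervalIntegrable _ _)
      (hhc.stronglyMeasurableAtFilter _ _) hhc.continuousAt
  have hshc : Continuous fun s => s * h s := by fun_prop
  have hi' : ∀ r, HasDerivAt (fun t => ∫ s in (0 : ℝ)..t, s * h s) (r * h r) r := fun r =>
    intervalIntegral.integral_hasDerivAt_right (hshc.intervalIntegrable _ _)
      (hshc.stronglyMeasurableAtFilter _ _) hshc.continuousAt
  refine ⟨fun t => t - ∫ s in (0 : ℝ)..t, (t - s) * h s, fun t => 1 - ∫ s in (0 : ℝ)..t, h s,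
    by simp, by simp, fun r _ => ?_, fun r hr => ?_⟩
  · simp_rw [integral_sub_mul_eq hhc]
    refine ((hasDerivAt_id r).sub (((hasDerivAt_id r).mul (hi r)).sub (hi' r))).congr_deriv ?_
    simp
  · refine ((hi r).const_sub 1).congr_deriv ?_
    have h1 : z r = picard q l z r := (DFunLike.congr_fun hz r).symm
    have h2 : r - ∫ s in (0 : ℝ)..r, (r - s) * h s = Real.exp (l * r) * z r := by
      rw [h1, picard, max_eq_left hr, ← mul_assoc, mul_comm (Real.exp (l * r)), hexp, one_mul]
    rw [h2, hh]; ring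

namespace IsRegularSolution
variable {q u p : ℝ → ℝ} (h : IsRegularSolution q u p)
include h

lemma continuousOn_u : ContinuousOn u (Ici 0) := fun r hr =>
  (h.hasDerivAt_u r hr).continuousAt.continuousWithinAt

lemma continuousOn_p : ContinuousOn p (Ici 0) := fun r hr =>
  (h.hasDerivAt_p r hr).continuousAt.continuousWithinAt

/-- A regular solution has only simple zeros: `(u² + p²) e^{(1 + C) r}` is nondecreasing. -/
lemma sq_add_sq_pos {C : ℝ} (hC : ∀ r, |q r| ≤ C) {r : ℝ} (hr : 0 ≤ r) :
    0 < u r ^ 2 + p r ^ 2 := by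
  have hC0 : 0 ≤ C := (abs_nonneg _).trans (hC 0)
  have hder : ∀ x, 0 ≤ x → HasDerivAt
      (fun x => (u x ^ 2 + p x ^ 2) * Real.exp ((1 + C) * x))
      ((2 * u x * p x + 2 * p x * (-(q x * u x))) * Real.exp ((1 + C) * x) +
        (u x ^ 2 + p x ^ 2) * (Real.exp ((1 + C) * x) * (1 + C))) x := by
    intro x hx
    have h1 : HasDerivAt (fun x => Real.exp ((1 + C) * x))
        (Real.exp ((1 + C) * x) * (1 + C)) x := by
      simpa using (((hasDerivAt_id x).const_mul (1 + C)).exp)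
    have h2 : HasDerivAt (fun x => u x ^ 2 + p x ^ 2)
        (2 * u x * p x + 2 * p x * (-(q x * u x))) x := by
      refine (((h.hasDerivAt_u x hx).pow 2).add ((h.hasDerivAt_p x hx).pow 2)).congr_deriv ?_
      simp
    exact h2.mul h1
  have hmono : MonotoneOn (fun x => (u x ^ 2 + p x ^ 2) * Real.exp ((1 + C) * x)) (Ici 0) := by
    apply monotoneOn_of_deriv_nonneg (convex_Ici 0)
    · exact fun x hx => (hder x hx).continuousAt.continuousWithinAt
    · intro x hx
      rw [interior_Ici] at hx
      exact (hder x (le_of_lt hx)).differentiableAt.differentiableWithinAt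
    · intro x hx
      rw [interior_Ici] at hx
      rw [(hder x (le_of_lt hx)).deriv]
      have h1 : (2 * u x * p x + 2 * p x * (-(q x * u x))) * Real.exp ((1 + C) * x) +
        (u x ^ 2 + p x ^ 2) * (Real.exp ((1 + C) * x) * (1 + C)) =
        (2 * (1 - q x) * (u x * p x) + (1 + C) * (u x ^ 2 + p x ^ 2)) *
          Real.exp ((1 + C) * x) := by ring
      rw [h1]
      apply mul_nonneg _ (Real.exp_pos _).le
      have h2 : |2 * (1 - q x) * (u x * p x)| ≤ (1 + C) * (u x ^ 2 + p x ^ 2) := by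
        rw [mul_comm 2, mul_assoc, abs_mul]
        have h3 : |1 - q x| ≤ 1 + C := by
          have := abs_le.1 (hC x)
          rw [abs_le]; constructor <;> linarith
        have h4 : |2 * (u x * p x)| ≤ u x ^ 2 + p x ^ 2 := by
          rw [abs_le]
          constructor <;> nlinarith [sq_nonneg (u x + p x), sq_nonneg (u x - p x)]
        gcongr
      linarith [neg_abs_le (2 * (1 - q x) * (u x * p x))]
  have := hmono self_mem_Ici (mem_Ici.2 hr) hr
  simp only [h.u_zero, h.p_zero] at this
  norm_num at this
  by_contra hcon
  push Not at hcon
  have h2 : (u r ^ 2 + p r ^ 2) * Real.exp ((1 + C) * r) ≤ 0 :=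
    mul_nonpos_of_nonpos_of_nonneg hcon (Real.exp_pos _).le
  linarith

end IsRegularSolution

/-! ### Sign changes on short intervals -/

/-- On an interval which is short compared with the size of `q`, a solution of `u'' = -q u` cannot
be negative between two points where it is nonnegative: compare it with the positive strict
supersolution `χ(r) = 1 - C (r - a)²` by looking at the Wronskian. -/
lemma nonneg_of_short {q u p : ℝ → ℝ} {a b C : ℝ} (hq0 : ∀ r, 0 ≤ q r) (hqC : ∀ r, q r ≤ C)
    (hab : C * (b - a) ^ 2 ≤ 1 / 4) (hu : ∀ r ∈ Icc a b, HasDerivAt u (p r) r)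
    (hp : ∀ r ∈ Icc a b, HasDerivAt p (-(q r * u r)) r) {x y z : ℝ} (hax : a ≤ x) (hxy : x < y)
    (hyz : y < z) (hzb : z ≤ b) (hux : 0 ≤ u x) (huz : 0 ≤ u z) : 0 ≤ u y := by
  by_contra hneg
  push Not at hneg
  have hC : 0 ≤ C := (hq0 0).trans (hqC 0)
  set χ : ℝ → ℝ := fun r => 1 - C * (r - a) ^ 2 with hχ
  have hχpos : ∀ r ∈ Icc a b, 0 < χ r := by
    intro r hr
    have : C * (r - a) ^ 2 ≤ C * (b - a) ^ 2 := by
      have h1 : 0 ≤ r - a := by linarith [hr.1]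
      have h2 : r ≤ b := hr.2
      gcongr
    simp only [hχ]; linarith
  have hχd : ∀ r, HasDerivAt χ (-(2 * C * (r - a))) r := by
    intro r
    have h1 : HasDerivAt (fun r : ℝ => r - a) 1 r := (hasDerivAt_id r).sub_const a
    refine (((h1.pow 2).const_mul C).const_sub 1).congr_deriv ?_
    simp; ring
  have hucont : ContinuousOn u (Icc a b) := fun r hr => (hu r hr).continuousAt.continuousWithinAt
  -- `c₁` is the last point before `y`, and `c₂` the first point after `y`, where `u ≥ 0`.
  obtain ⟨c₁, ⟨hc₁, hc₁u⟩, hc₁max⟩ : ∃ c, IsGreatest {r | r ∈ Icc x y ∧ 0 ≤ u r} c := by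
    apply IsCompact.exists_isGreatest
    · have := (hucont.mono (Icc_subset_Icc hax (hyz.le.trans hzb))).preimage_isClosed_of_isClosed
        isClosed_Icc (isClosed_Ici (a := (0 : ℝ)))
      exact isCompact_Icc.of_isClosed_subset this (fun r hr => hr.1)
    · exact ⟨x, ⟨le_rfl, hxy.le⟩, hux⟩
  obtain ⟨c₂, ⟨hc₂, hc₂u⟩, hc₂min⟩ : ∃ c, IsLeast {r | r ∈ Icc y z ∧ 0 ≤ u r} c := by
    apply IsCompact.exists_isLeast
    · have := (hucont.mono (Icc_subset_Icc (hax.trans hxy.le) hzb)).preimage_isClosed_of_isClosed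
        isClosed_Icc (isClosed_Ici (a := (0 : ℝ)))
      exact isCompact_Icc.of_isClosed_subset this (fun r hr => hr.1)
    · exact ⟨z, ⟨hyz.le, le_rfl⟩, huz⟩
  have h1y : c₁ < y := lt_of_le_of_ne hc₁.2 (fun h => by rw [h] at hc₁u; linarith)
  have h2y : y < c₂ := lt_of_le_of_ne hc₂.1 (fun h => by rw [← h] at hc₂u; linarith)
  have hsub : Icc c₁ c₂ ⊆ Icc a b :=
    Icc_subset_Icc (hax.trans hc₁.1) (hc₂.2.trans hzb)
  have huneg : ∀ r ∈ Ioo c₁ c₂, u r ≤ 0 := by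
    intro r hr
    by_contra hcon
    push Not at hcon
    rcases le_total r y with h | h
    · exact absurd (hc₁max ⟨⟨hc₁.1.trans hr.1.le, h⟩, hcon.le⟩) (not_le.2 hr.1)
    · exact absurd (hc₂min ⟨⟨h, hr.2.le.trans hc₂.2⟩, hcon.le⟩) (not_le.2 hr.2)
  set w : ℝ → ℝ := fun r => p r * χ r - u r * (-(2 * C * (r - a))) with hw
  have hquot : ∀ r ∈ Icc a b, HasDerivAt (fun r => u r / χ r) (w r / χ r ^ 2) r := fun r hr =>
    (hu r hr).div (hχd r) (hχpos r hr).ne'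
  have hwd : ∀ r ∈ Icc a b, HasDerivAt w (-(u r * (q r * χ r - 2 * C))) r := by
    intro r hr
    have h1 : HasDerivAt (fun r : ℝ => -(2 * C * (r - a))) (-(2 * C)) r := by
      refine (((hasDerivAt_id r).sub_const a).const_mul (2 * C)).neg.congr_deriv ?_
      simp
    refine (((hp r hr).mul (hχd r)).sub ((hu r hr).mul h1)).congr_deriv ?_
    ring
  have hcontq : ContinuousOn (fun r => u r / χ r) (Icc c₁ c₂) := fun r hr =>
    (hquot r (hsub hr)).continuousAt.continuousWithinAt
  have hy : y ∈ Icc a b := hsub ⟨h1y.le, h2y.le⟩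
  have hqy : u y / χ y < 0 := div_neg_of_neg_of_pos hneg (hχpos y hy)
  have hq1 : 0 ≤ u c₁ / χ c₁ := div_nonneg hc₁u (hχpos _ (hsub ⟨le_rfl, (h1y.trans h2y).le⟩)).le
  have hq2 : 0 ≤ u c₂ / χ c₂ := div_nonneg hc₂u (hχpos _ (hsub ⟨(h1y.trans h2y).le, le_rfl⟩)).le
  obtain ⟨ξ₁, hξ₁, e₁⟩ := exists_hasDerivAt_eq_slope _ _ h1y
    (hcontq.mono (Icc_subset_Icc le_rfl h2y.le))
    (fun r hr => hquot r (hsub ⟨hr.1.le, hr.2.le.trans h2y.le⟩))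
  obtain ⟨ξ₂, hξ₂, e₂⟩ := exists_hasDerivAt_eq_slope _ _ h2y
    (hcontq.mono (Icc_subset_Icc h1y.le le_rfl))
    (fun r hr => hquot r (hsub ⟨h1y.le.trans hr.1.le, hr.2.le⟩))
  have n1 : w ξ₁ / χ ξ₁ ^ 2 < 0 := by
    rw [e₁]; exact div_neg_of_neg_of_pos (by linarith) (by linarith)
  have n2 : 0 < w ξ₂ / χ ξ₂ ^ 2 := by
    rw [e₂]; exact div_pos (by linarith) (by linarith)
  have n1' : w ξ₁ < 0 := by
    by_contra hcon
    push Not at hcon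
    exact absurd n1 (not_lt.2 (div_nonneg hcon (sq_nonneg _)))
  have n2' : 0 < w ξ₂ := by
    by_contra hcon
    push Not at hcon
    exact absurd n2 (not_lt.2 (div_nonpos_of_nonpos_of_nonneg hcon (sq_nonneg _)))
  have hanti : AntitoneOn w (Icc c₁ c₂) := by
    apply antitoneOn_of_deriv_nonpos (convex_Icc _ _)
    · exact fun r hr => (hwd r (hsub hr)).continuousAt.continuousWithinAt
    · intro r hr
      rw [interior_Icc] at hr
      exact (hwd r (hsub ⟨hr.1.le, hr.2.le⟩)).differentiableAt.differentiableWithinAt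
    · intro r hr
      rw [interior_Icc] at hr
      have hr' := hsub ⟨hr.1.le, hr.2.le⟩
      rw [(hwd r hr').deriv]
      have h1 := huneg r hr
      have h2 : q r * χ r ≤ C * 1 := by
        have h3 := hχpos r hr'
        have h4 : χ r ≤ 1 := by
          simp only [hχ]
          have : 0 ≤ C * (r - a) ^ 2 := by positivity
          linarith
        exact mul_le_mul (hqC r) h4 h3.le hC
      nlinarith
  have := hanti ⟨hξ₁.1.le, hξ₁.2.le.trans h2y.le⟩ ⟨h1y.le.trans hξ₂.1.le, hξ₂.2.le⟩
    (hξ₁.2.trans hξ₂.1).le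
  linarith

namespace IsRegularSolution
variable {q u p : ℝ → ℝ} (h : IsRegularSolution q u p)
include h

lemma pos_of_short {C t : ℝ} (hq0 : ∀ r, 0 ≤ q r) (hqC : ∀ r, q r ≤ C) (ht : C * t ^ 2 ≤ 1 / 4)
    {r : ℝ} (hr : r ∈ Ioc 0 t) : 0 < u r := by
  by_contra hcon
  push Not at hcon
  have hslope : ∀ᶠ s in 𝓝[>] (0 : ℝ), 0 < u s := by
    have h1 := (h.hasDerivAt_u 0 le_rfl).tendsto_slope_zero_right
    rw [h.p_zero] at h1
    filter_upwards [h1.eventually (lt_mem_nhds (show (0 : ℝ) < 1 by norm_num)), self_mem_nhdsWithin]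
      with s hs hs0
    rw [zero_add, h.u_zero, sub_zero, smul_eq_mul] at hs
    exact pos_of_mul_pos_right hs (inv_nonneg.2 (le_of_lt hs0))
  obtain ⟨s, hs, hs0⟩ := (hslope.and (Ioo_mem_nhdsGT hr.1)).exists
  have := nonneg_of_short (u := fun r => -u r) (p := fun r => -p r) (a := 0) (b := t) hq0 hqC
    (by simpa using ht) (fun r hr => (h.hasDerivAt_u r hr.1).neg)
    (fun r hr => ((h.hasDerivAt_p r hr.1).neg).congr_deriv (by ring)) le_rfl hs0.1 hs0.2 hr.2
    (by simp [h.u_zero]) (by linarith)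
  linarith

lemma ne_zero_of_short {C a b : ℝ} (hq0 : ∀ r, 0 ≤ q r) (hqC : ∀ r, q r ≤ C) (ha : 0 ≤ a)
    (hab : C * (b - a) ^ 2 ≤ 1 / 4) (hsign : 0 < u a * u b) {r : ℝ} (hr : r ∈ Icc a b) :
    u r ≠ 0 := by
  intro hur
  -- Up to replacing `u` by `-u`, both boundary values are positive.
  obtain ⟨σ, hσ, hσa, hσb⟩ : ∃ σ : ℝ, σ ≠ 0 ∧ 0 < σ * u a ∧ 0 < σ * u b := by
    rcases pos_and_pos_or_neg_and_neg_of_mul_pos hsign with h | h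
    · exact ⟨1, one_ne_zero, by linarith [h.1], by linarith [h.2]⟩
    · exact ⟨-1, by norm_num, by linarith [h.1], by linarith [h.2]⟩
  have hra : a < r := lt_of_le_of_ne hr.1 (fun e => by rw [e, hur] at hσa; simp at hσa)
  have hrb : r < b := lt_of_le_of_ne hr.2 (fun e => by rw [← e, hur] at hσb; simp at hσb)
  have hnn : ∀ y ∈ Ioo a b, 0 ≤ σ * u y := fun y hy =>
    nonneg_of_short (u := fun r => σ * u r) (p := fun r => σ * p r) (a := a) (b := b) hq0 hqC
      hab (fun r hr => (h.hasDerivAt_u r (ha.trans hr.1)).const_mul σ)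
      (fun r hr => ((h.hasDerivAt_p r (ha.trans hr.1)).const_mul σ).congr_deriv (by ring))
      le_rfl hy.1 hy.2 le_rfl hσa.le hσb.le
  have hmin : IsLocalMin (fun y => σ * u y) r := by
    filter_upwards [Ioo_mem_nhds hra hrb] with y hy
    simpa [hur] using hnn y hy
  have hp0 := hmin.hasDerivAt_eq_zero ((h.hasDerivAt_u r (ha.trans hr.1)).const_mul σ)
  have hp : p r = 0 := by simpa [hσ] using hp0
  have := h.sq_add_sq_pos (C := C) (fun r => by rw [abs_of_nonneg (hq0 r)]; exact hqC r)
    (ha.trans hr.1)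
  simp [hur, hp] at this

end IsRegularSolution

/-! ### Absolutely continuous radial profiles and the Riccati inequality -/

/-- `f` is a locally absolutely continuous function on `(0, ∞)` with derivative `g` and
`∫₀^∞ r² g² dr < ∞`. -/
structure IsRadialProfile (f g : ℝ → ℝ) : Prop where
  intervalIntegrable : ∀ a b, 0 < a → 0 < b → IntervalIntegrable g volume a b
  integral_eq : ∀ a b, 0 < a → 0 < b → f b - f a = ∫ r in a..b, g r
  integrableOn : IntegrableOn (fun r => r ^ 2 * g r ^ 2) (Ioi 0)

lemma AbsolutelyContinuousOnInterval.congr_uIcc {f g : ℝ → ℝ} {a b : ℝ}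
    (hf : AbsolutelyContinuousOnInterval f a b) (h : EqOn f g (uIcc a b)) :
    AbsolutelyContinuousOnInterval g a b := by
  rw [absolutelyContinuousOnInterval_iff] at hf ⊢
  intro ε hε
  obtain ⟨δ, hδ, H⟩ := hf ε hε
  refine ⟨δ, hδ, fun E hE hlt => ?_⟩
  have := H E hE hlt
  rwa [Finset.sum_congr rfl fun i hi => by rw [h (hE.1 i hi).1, h (hE.1 i hi).2]] at this

lemma absolutelyContinuousOnInterval_of_hasDerivAt {k k' : ℝ → ℝ} {a b : ℝ}
    (hk : ∀ r ∈ uIcc a b, HasDerivAt k (k' r) r) (hk' : ContinuousOn k' (uIcc a b)) :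
    AbsolutelyContinuousOnInterval k a b := by
  obtain ⟨K, hK⟩ := isCompact_uIcc.exists_bound_of_continuousOn hk'
  have : LipschitzOnWith K.toNNReal k (uIcc a b) := by
    apply (convex_uIcc a b).lipschitzOnWith_of_nnnorm_hasDerivWithin_le
      (fun r hr => (hk r hr).hasDerivWithinAt)
    intro r hr
    rw [← NNReal.coe_le_coe, coe_nnnorm]
    exact (hK r hr).trans (Real.le_coe_toNNReal K)
  exact this.absolutelyContinuousOnInterval

/-- The fundamental theorem of calculus for absolutely continuous functions, as an inequality. -/
lemma sub_le_integral_of_ae_deriv_le {H φ : ℝ → ℝ} {a b : ℝ} (hab : a ≤ b)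
    (hH : AbsolutelyContinuousOnInterval H a b) (hφ : IntervalIntegrable φ volume a b)
    (h : ∀ᵐ r, r ∈ Icc a b → deriv H r ≤ φ r) : H b - H a ≤ ∫ r in a..b, φ r := by
  rw [← hH.integral_deriv_eq_sub]
  apply intervalIntegral.integral_mono_ae_restrict hab hH.intervalIntegrable_deriv hφ
  exact (ae_restrict_iff' measurableSet_Icc).2 h

namespace IsRadialProfile
variable {f g : ℝ → ℝ} (hf : IsRadialProfile f g)
include hf

lemma absolutelyContinuousOnInterval {a b : ℝ} (ha : 0 < a) (hb : 0 < b) :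
    AbsolutelyContinuousOnInterval f a b := by
  have h1 := (hf.intervalIntegrable a b ha hb).absolutelyContinuousOnInterval_intervalIntegral
    (c := a) (by simp)
  have h2 : AbsolutelyContinuousOnInterval (fun _ : ℝ => f a) a b :=
    (LipschitzWith.const (f a)).lipschitzOnWith.absolutelyContinuousOnInterval
  refine AbsolutelyContinuousOnInterval.congr_uIcc (h1.add h2) fun x hx => ?_
  have hx0 : 0 < x := (lt_min ha hb).trans_le hx.1
  simp [← hf.integral_eq a x ha hx0]

lemma ae_hasDerivAt {a b : ℝ} (ha : 0 < a) (hb : 0 < b) :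
    ∀ᵐ r, r ∈ uIcc a b → HasDerivAt f (g r) r := by
  filter_upwards [(hf.intervalIntegrable a b ha hb).ae_hasDerivAt_integral] with r hr hr'
  have h1 := (hr hr' a (by simp)).add_const (f a)
  have hr0 : 0 < r := (lt_min ha hb).trans_le hr'.1
  refine h1.congr_of_eventuallyEq ?_
  filter_upwards [lt_mem_nhds hr0] with x hx
  rw [← hf.integral_eq a x ha hx]; ring

lemma continuousOn : ContinuousOn f (Ioi 0) := by
  intro x hx
  have hx : 0 < x := hx
  have h1 := (hf.absolutelyContinuousOnInterval (a := x / 2) (b := 2 * x) (by positivity)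
    (by positivity)).continuousOn
  refine (h1.continuousAt ?_).continuousWithinAt
  rw [uIcc_of_le (by linarith)]
  exact Icc_mem_nhds (by linarith) (by linarith)

lemma intervalIntegrable_form {q : ℝ → ℝ} (hq : Continuous q) {a b : ℝ} (ha : 0 < a)
    (hb : 0 < b) :
    IntervalIntegrable (fun r => r ^ 2 * g r ^ 2 - r ^ 2 * q r * f r ^ 2) volume a b := by
  have hsub : uIcc a b ⊆ Ioi 0 := fun x hx => (lt_min ha hb).trans_le hx.1
  apply IntervalIntegrable.sub
  · rw [intervalIntegrable_iff]
    exact hf.integrableOn.mono_set (uIoc_subset_uIcc.trans hsub)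
  · apply ContinuousOn.intervalIntegrable
    have := hf.continuousOn.mono hsub
    fun_prop

/-- Riccati inequality: if `k' ≤ -q - k²` then, with `U = r f`,
`r² f'² - r² q f² = U'² - q U² - (U²/r)' ≥ (k U² - U²/r)'`, by completing the square
`(U' - k U)²`. -/
lemma riccati_le {q k k' : ℝ → ℝ} (hq : Continuous q) {a b : ℝ} (ha : 0 < a) (hab : a ≤ b)
    (hk : ∀ r ∈ Icc a b, HasDerivAt k (k' r) r) (hk'c : ContinuousOn k' (Icc a b))
    (hk' : ∀ r ∈ Icc a b, k' r ≤ -q r - k r ^ 2) :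
    (k b * b ^ 2 - b) * f b ^ 2 - (k a * a ^ 2 - a) * f a ^ 2 ≤
      ∫ r in a..b, (r ^ 2 * g r ^ 2 - r ^ 2 * q r * f r ^ 2) := by
  have hb := ha.trans_le hab
  have hu : uIcc a b = Icc a b := uIcc_of_le hab
  have hAf := hf.absolutelyContinuousOnInterval ha hb
  have hAk := absolutelyContinuousOnInterval_of_hasDerivAt (hu ▸ hk) (hu ▸ hk'c)
  have hA2 : AbsolutelyContinuousOnInterval (fun r : ℝ => r ^ 2) a b :=
    absolutelyContinuousOnInterval_of_hasDerivAt (fun r _ => hasDerivAt_pow 2 r) (by fun_prop)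
  have hA1 : AbsolutelyContinuousOnInterval (fun r : ℝ => r) a b :=
    absolutelyContinuousOnInterval_of_hasDerivAt (fun r _ => hasDerivAt_id r) (by fun_prop)
  have hH : AbsolutelyContinuousOnInterval (fun r => (k r * r ^ 2 - r) * (f r * f r)) a b :=
    ((hAk.mul hA2).sub hA1).mul (hAf.mul hAf)
  have := sub_le_integral_of_ae_deriv_le hab hH (hf.intervalIntegrable_form hq ha hb) (by
    filter_upwards [hf.ae_hasDerivAt ha hb] with r hr hrab
    have hfr := hr (hu ▸ hrab)
    have hd : HasDerivAt (fun r => (k r * r ^ 2 - r) * (f r * f r))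
        ((k' r * r ^ 2 + k r * (2 * r) - 1) * (f r * f r) +
          (k r * r ^ 2 - r) * (g r * f r + f r * g r)) r := by
      refine ((((hk r hrab).mul (hasDerivAt_pow 2 r)).sub (hasDerivAt_id r)).mul
        (hfr.mul hfr)).congr_deriv ?_
      simp
    rw [hd.deriv]
    have h1 := hk' r hrab
    have h2 : 0 ≤ (r * f r) ^ 2 * (-q r - k r ^ 2 - k' r) := by
      apply mul_nonneg (sq_nonneg _); linarith
    nlinarith [sq_nonneg (r * g r - k r * r * f r + f r)])
  simpa only [pow_two] using this

/-- The Riccati inequality with `k = u' / u`. -/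
lemma solution_le {q u p : ℝ → ℝ} (hq : Continuous q) (hreg : IsRegularSolution q u p) {a b : ℝ}
    (ha : 0 < a) (hab : a ≤ b) (hne : ∀ r ∈ Icc a b, u r ≠ 0) :
    (p b / u b * b ^ 2 - b) * f b ^ 2 - (p a / u a * a ^ 2 - a) * f a ^ 2 ≤
      ∫ r in a..b, (r ^ 2 * g r ^ 2 - r ^ 2 * q r * f r ^ 2) := by
  have hsub : Icc a b ⊆ Ici 0 := fun r hr => ha.le.trans hr.1
  have hcu := hreg.continuousOn_u.mono hsub
  have hcp := hreg.continuousOn_p.mono hsub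
  refine hf.riccati_le (k := fun r => p r / u r)
    (k' := fun r => (-(q r * u r) * u r - p r * p r) / u r ^ 2) hq ha hab ?_ ?_ ?_
  · intro r hr
    exact (hreg.hasDerivAt_p r (hsub hr)).div (hreg.hasDerivAt_u r (hsub hr)) (hne r hr)
  · exact ContinuousOn.div (by fun_prop) (by fun_prop) (fun r hr => pow_ne_zero 2 (hne r hr))
  · intro r hr
    have := hne r hr
    apply le_of_eq
    field_simp

/-- On a short interval the same inequality holds across a zero of `u` for those `f` for which
`r f` is, at the endpoints, proportional to `u`: subtract from `U = r f` the multiple `β u` with the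
same boundary values, and use `k = -2C (r - a)` for the difference, which vanishes at both ends. -/
lemma short_le {q u p : ℝ → ℝ} {C : ℝ} (hq : Continuous q) (hqC : ∀ r, q r ≤ C)
    (hreg : IsRegularSolution q u p) {a b : ℝ} (ha : 0 < a) (hab : a ≤ b)
    (hC : C * (b - a) ^ 2 ≤ 1 / 4) (hC0 : 0 ≤ C) (hua : u a ≠ 0) (hub : u b ≠ 0)
    (heq : a * f a * u b = b * f b * u a) :
    (p b / u b * b ^ 2 - b) * f b ^ 2 - (p a / u a * a ^ 2 - a) * f a ^ 2 ≤
      ∫ r in a..b, (r ^ 2 * g r ^ 2 - r ^ 2 * q r * f r ^ 2) := by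
  have hb := ha.trans_le hab
  have hsub : Icc a b ⊆ Ici 0 := fun r hr => ha.le.trans hr.1
  have hcu := hreg.continuousOn_u.mono hsub
  have hcp := hreg.continuousOn_p.mono hsub
  have hu : uIcc a b = Icc a b := uIcc_of_le hab
  have hAf := hf.absolutelyContinuousOnInterval ha hb
  have hAu := absolutelyContinuousOnInterval_of_hasDerivAt (a := a) (b := b)
    (fun r hr => hreg.hasDerivAt_u r (hsub (hu ▸ hr))) (hu ▸ hcp)
  have hAp := absolutelyContinuousOnInterval_of_hasDerivAt (a := a) (b := b)
    (fun r hr => hreg.hasDerivAt_p r (hsub (hu ▸ hr))) (by rw [hu]; fun_prop)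
  have hA1 : AbsolutelyContinuousOnInterval (fun r : ℝ => r) a b :=
    absolutelyContinuousOnInterval_of_hasDerivAt (fun r _ => hasDerivAt_id r) (by fun_prop)
  have hAs : AbsolutelyContinuousOnInterval (fun r : ℝ => -2 * C * (r - a)) a b :=
    absolutelyContinuousOnInterval_of_hasDerivAt
      (fun r _ => ((hasDerivAt_id r).sub_const a).const_mul (-2 * C)) (by fun_prop)
  set β := b * f b / u b with hβ
  have hWb : b * f b - β * u b = 0 := by rw [hβ]; field_simp; ring
  have hWa : a * f a - β * u a = 0 := by
    rw [hβ]; field_simp; linarith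
  have hAW : AbsolutelyContinuousOnInterval (fun r => r * f r - β * u r) a b :=
    (hA1.mul hAf).sub (hAu.const_mul β)
  have hH : AbsolutelyContinuousOnInterval (fun r =>
      (-2 * C * (r - a)) * ((r * f r - β * u r) * (r * f r - β * u r)) +
        (2 * β) * (p r * (r * f r - β * u r)) + (β ^ 2) * (u r * p r) - r * (f r * f r)) a b :=
    ((((hAs.mul (hAW.mul hAW)).add ((hAp.mul hAW).const_mul (2 * β))).add
      ((hAu.mul hAp).const_mul (β ^ 2))).sub (hA1.mul (hAf.mul hAf)))
  have := sub_le_integral_of_ae_deriv_le hab hH (hf.intervalIntegrable_form hq ha hb) (by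
    filter_upwards [hf.ae_hasDerivAt ha hb] with r hr hrab
    have hfr := hr (hu ▸ hrab)
    have hur := hreg.hasDerivAt_u r (hsub hrab)
    have hpr := hreg.hasDerivAt_p r (hsub hrab)
    have hs : HasDerivAt (fun r : ℝ => -2 * C * (r - a)) (-2 * C) r := by
      simpa using ((hasDerivAt_id r).sub_const a).const_mul (-2 * C)
    have hW : HasDerivAt (fun r => r * f r - β * u r) (f r + r * g r - β * p r) r := by
      refine (((hasDerivAt_id r).mul hfr).sub (hur.const_mul β)).congr_deriv ?_
      simp
    have hd := ((((hs.mul (hW.mul hW)).add ((hpr.mul hW).const_mul (2 * β))).add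
      ((hur.mul hpr).const_mul (β ^ 2))).sub ((hasDerivAt_id r).mul (hfr.mul hfr)))
    refine (hd.deriv).trans_le ?_
    simp only [id, Pi.mul_apply]
    set W := r * f r - β * u r with hWdef
    set W' := f r + r * g r - β * p r with hW'def
    have h1 : 0 ≤ W ^ 2 * (2 * C - q r - (-2 * C * (r - a)) ^ 2) := by
      apply mul_nonneg (sq_nonneg _)
      have h2 : C * (r - a) ^ 2 ≤ C * (b - a) ^ 2 := by
        have h1 : 0 ≤ r - a := by linarith [hrab.1]
        have h2 : r ≤ b := hrab.2
        gcongr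
      have h3 := hqC r
      have h4 : (-2 * C * (r - a)) ^ 2 = 4 * C * (C * (r - a) ^ 2) := by ring
      rw [h4]
      nlinarith
    have h2 : 0 ≤ (W' - (-2 * C * (r - a)) * W) ^ 2 := sq_nonneg _
    have h3 : r * g r = W' + β * p r - f r := by rw [hW'def]; ring
    have h4 : r * f r = W + β * u r := by rw [hWdef]; ring
    have h5 : r ^ 2 * g r ^ 2 - r ^ 2 * q r * f r ^ 2 =
        (W' + β * p r - f r) ^ 2 - q r * (W + β * u r) ^ 2 := by rw [← h3, ← h4]; ring
    rw [h5]
    have h6 : r * (g r * f r + f r * g r) = 2 * f r * (W' + β * p r - f r) := by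
      rw [← h3]; ring
    nlinarith)
  simp only [hWa, hWb] at this
  have e1 : p b / u b * b ^ 2 * f b ^ 2 = β ^ 2 * (u b * p b) := by rw [hβ]; field_simp
  have e2 : p a / u a * a ^ 2 * f a ^ 2 = β ^ 2 * (u a * p a) := by
    have : a * f a = β * u a := by linarith
    calc p a / u a * a ^ 2 * f a ^ 2 = p a / u a * (a * f a) ^ 2 := by ring
      _ = _ := by rw [this]; field_simp
  linarith

end IsRadialProfile

/-! ### The lower bound for the one-dimensional form -/

/-- Nodes `0 < t₀ < t₁ < …` whose gaps, including the gap `(0, t₀)`, are short for potentials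
bounded by `C`. -/
structure IsMesh (C : ℝ) (t : ℕ → ℝ) : Prop where
  pos : 0 < t 0
  strictMono : StrictMono t
  first : C * t 0 ^ 2 ≤ 1 / 4
  short : ∀ i, C * (t (i + 1) - t i) ^ 2 ≤ 1 / 4

lemma IsMesh.pos' {C : ℝ} {t : ℕ → ℝ} (ht : IsMesh C t) (i : ℕ) : 0 < t i :=
  ht.pos.trans_le (ht.strictMono.monotone (Nat.zero_le i))

open Classical in
/-- The gaps `(t i, t (i + 1))`, `i < m`, in which `u` changes sign, where the last gap is
`(t m, ∞)`: there `u(r) = u(t m) + p(t m) (r - t m)` changes sign if and only if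
`u(t m) p(t m) < 0`. -/
noncomputable def signChanges (u p : ℝ → ℝ) (t : ℕ → ℝ) (m : ℕ) : Finset ℕ :=
  (Finset.range (m + 1)).filter fun i =>
    if i = m then u (t m) * p (t m) < 0 else u (t i) * u (t (i + 1)) < 0

lemma mem_signChanges_of_lt {u p : ℝ → ℝ} {t : ℕ → ℝ} {m i : ℕ} (hi : i < m) :
    i ∈ signChanges u p t m ↔ u (t i) * u (t (i + 1)) < 0 := by
  simp [signChanges, hi.ne, hi.trans (Nat.lt_succ_self m)]

lemma last_mem_signChanges {u p : ℝ → ℝ} {t : ℕ → ℝ} {m : ℕ} :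
    m ∈ signChanges u p t m ↔ u (t m) * p (t m) < 0 := by
  simp [signChanges]

/-- The linear condition on `f` at a gap: `r f` is proportional to `u` at the endpoints of the gap
(at the last gap, `f` vanishes at its left endpoint). -/
noncomputable def gapFunctional (u : ℝ → ℝ) (t : ℕ → ℝ) (m i : ℕ) (f : ℝ → ℝ) : ℝ :=
  if i = m then f (t m) else t i * f (t i) * u (t (i + 1)) - t (i + 1) * f (t (i + 1)) * u (t i)

/-- `r u' ≤ u` near the origin, since `(u - r u')' = r q u ≥ 0` where `u > 0`. -/
lemma IsRegularSolution.mul_le_of_short {q u p : ℝ → ℝ} (h : IsRegularSolution q u p) {C t : ℝ}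
    (hq0 : ∀ r, 0 ≤ q r) (hqC : ∀ r, q r ≤ C) (ht : C * t ^ 2 ≤ 1 / 4) {r : ℝ}
    (hr : r ∈ Ioc 0 t) : r * p r ≤ u r := by
  have hd : ∀ x ∈ Icc 0 r, HasDerivAt (fun x => u x - x * p x) (x * (q x * u x)) x := by
    intro x hx
    refine ((h.hasDerivAt_u x hx.1).sub
      ((hasDerivAt_id x).mul (h.hasDerivAt_p x hx.1))).congr_deriv ?_
    simp
  have hm : MonotoneOn (fun x => u x - x * p x) (Icc 0 r) := by
    apply monotoneOn_of_deriv_nonneg (convex_Icc _ _)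
    · exact fun x hx => (hd x hx).continuousAt.continuousWithinAt
    · intro x hx
      rw [interior_Icc] at hx
      exact (hd x ⟨hx.1.le, hx.2.le⟩).differentiableAt.differentiableWithinAt
    · intro x hx
      rw [interior_Icc] at hx
      rw [(hd x ⟨hx.1.le, hx.2.le⟩).deriv]
      have := h.pos_of_short hq0 hqC ht ⟨hx.1, hx.2.le.trans hr.2⟩
      have := hq0 x
      have := hx.1
      positivity
  have := hm ⟨le_rfl, hr.1.le⟩ ⟨hr.1.le, le_rfl⟩ hr.1.le
  simp [h.u_zero] at this
  exact this

namespace IsRadialProfile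
variable {f g : ℝ → ℝ} (hf : IsRadialProfile f g)
include hf

/-- Summing the Riccati inequalities over the gaps. -/
lemma sum_le {q u p : ℝ → ℝ} {C : ℝ} {t : ℕ → ℝ} {m : ℕ} (hq : Continuous q)
    (hq0 : ∀ r, 0 ≤ q r) (hqC : ∀ r, q r ≤ C) (hreg : IsRegularSolution q u p)
    (ht : IsMesh C t) (hne : ∀ i ≤ m, u (t i) ≠ 0)
    (hgap : ∀ i ∈ signChanges u p t m, gapFunctional u t m i f = 0) {k : ℕ} (hk : k ≤ m) :
    (p (t k) / u (t k) * t k ^ 2 - t k) * f (t k) ^ 2 -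
      (p (t 0) / u (t 0) * t 0 ^ 2 - t 0) * f (t 0) ^ 2 ≤
      ∫ r in t 0..t k, (r ^ 2 * g r ^ 2 - r ^ 2 * q r * f r ^ 2) := by
  have hC0 : 0 ≤ C := (hq0 0).trans (hqC 0)
  induction k with
  | zero => simp
  | succ k ih =>
    have h1 := ih (by omega)
    have hlt : t k ≤ t (k + 1) := (ht.strictMono (Nat.lt_succ_self k)).le
    have h2 : (p (t (k + 1)) / u (t (k + 1)) * t (k + 1) ^ 2 - t (k + 1)) * f (t (k + 1)) ^ 2 -
        (p (t k) / u (t k) * t k ^ 2 - t k) * f (t k) ^ 2 ≤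
        ∫ r in t k..t (k + 1), (r ^ 2 * g r ^ 2 - r ^ 2 * q r * f r ^ 2) := by
      by_cases hs : u (t k) * u (t (k + 1)) < 0
      · have h3 := hgap k ((mem_signChanges_of_lt (by omega)).2 hs)
        rw [gapFunctional, if_neg (by omega), sub_eq_zero] at h3
        exact hf.short_le hq hqC hreg (ht.pos' k) hlt (ht.short k) hC0 (hne k (by omega))
          (hne _ hk) h3
      · have hpos : 0 < u (t k) * u (t (k + 1)) :=
          lt_of_le_of_ne (not_lt.1 hs) (mul_ne_zero (hne k (by omega)) (hne _ hk)).symm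
        exact hf.solution_le hq hreg (ht.pos' k) hlt fun r hr =>
          hreg.ne_zero_of_short hq0 hqC (ht.pos' k).le (ht.short k) hpos hr
    rw [← intervalIntegral.integral_add_adjacent_intervals
      (hf.intervalIntegrable_form hq (ht.pos' 0) (ht.pos' k))
      (hf.intervalIntegrable_form hq (ht.pos' k) (ht.pos' (k + 1)))]
    linarith

/-- The form on `(ε, X)` is bounded below by a boundary term at `X`; the boundary term at `ε` has
the good sign. -/
lemma neg_mul_sq_le {q u p : ℝ → ℝ} {C : ℝ} {t : ℕ → ℝ} {m : ℕ} (hq : Continuous q)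
    (hq0 : ∀ r, 0 ≤ q r) (hqC : ∀ r, q r ≤ C) (hqT : ∀ r, t m ≤ r → q r = 0)
    (hreg : IsRegularSolution q u p)
    (ht : IsMesh C t) (hne : ∀ i ≤ m, u (t i) ≠ 0)
    (hgap : ∀ i ∈ signChanges u p t m, gapFunctional u t m i f = 0) {ε X : ℝ}
    (hε : ε ∈ Ioc 0 (t 0)) (hX : t m ≤ X) :
    -(X * f X ^ 2) ≤ ∫ r in ε..X, (r ^ 2 * g r ^ 2 - r ^ 2 * q r * f r ^ 2) := by
  have hX0 : 0 < X := (ht.pos' m).trans_le hX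
  have h1 := hf.solution_le hq hreg hε.1 hε.2 fun r hr =>
    (hreg.pos_of_short hq0 hqC ht.first ⟨hε.1.trans_le hr.1, hr.2⟩).ne'
  have h2 := hf.sum_le hq hq0 hqC hreg ht hne hgap le_rfl
  have h3 := hf.riccati_le (k := fun _ => 0) (k' := fun _ => 0) hq (ht.pos' m) hX
    (fun r _ => hasDerivAt_const r 0) continuousOn_const (fun r hr => by simp [hqT r hr.1])
  rw [← intervalIntegral.integral_add_adjacent_intervals
      (hf.intervalIntegrable_form hq hε.1 (ht.pos' 0))
      (hf.intervalIntegrable_form hq (ht.pos' 0) hX0),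
    ← intervalIntegral.integral_add_adjacent_intervals
      (hf.intervalIntegrable_form hq (ht.pos' 0) (ht.pos' m))
      (hf.intervalIntegrable_form hq (ht.pos' m) hX0)]
  have h4 : (p ε / u ε * ε ^ 2 - ε) * f ε ^ 2 ≤ 0 := by
    apply mul_nonpos_of_nonpos_of_nonneg _ (sq_nonneg _)
    have h5 := hreg.pos_of_short hq0 hqC ht.first hε
    have h6 := hreg.mul_le_of_short hq0 hqC ht.first hε
    have h7 : p ε / u ε * ε ^ 2 = ε * (ε * p ε / u ε) := by ring
    have h8 : ε * p ε / u ε ≤ 1 := by rw [div_le_one h5]; exact h6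
    have := hε.1
    rw [h7]; nlinarith
  have h5 : 0 ≤ p (t m) / u (t m) * t m ^ 2 * f (t m) ^ 2 := by
    by_cases hs : u (t m) * p (t m) < 0
    · have := hgap m (last_mem_signChanges.2 hs)
      rw [gapFunctional, if_pos rfl] at this
      simp [this]
    · have : 0 ≤ p (t m) / u (t m) := by
        have h6 : p (t m) / u (t m) = (u (t m) * p (t m)) / u (t m) ^ 2 := by
          have := hne m le_rfl
          field_simp
        rw [h6]
        exact div_nonneg (not_lt.1 hs) (sq_nonneg _)
      positivity
  linarith

/-- Nonnegativity of the form under one linear condition per sign change. The boundary terms at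
infinity disappear because `∫₀^∞ r² f⁶ dr < ∞`. -/
lemma form_nonneg {q u p : ℝ → ℝ} {C : ℝ} {t : ℕ → ℝ} {m : ℕ} (hq : Continuous q)
    (hq0 : ∀ r, 0 ≤ q r) (hqC : ∀ r, q r ≤ C) (hqT : ∀ r, t m ≤ r → q r = 0)
    (hreg : IsRegularSolution q u p)
    (ht : IsMesh C t) (hne : ∀ i ≤ m, u (t i) ≠ 0)
    (hgap : ∀ i ∈ signChanges u p t m, gapFunctional u t m i f = 0)
    (hf6 : IntegrableOn (fun r => r ^ 2 * f r ^ 6) (Ioi 0))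
    (hint : IntegrableOn (fun r => r ^ 2 * g r ^ 2 - r ^ 2 * q r * f r ^ 2) (Ioi 0)) :
    0 ≤ ∫ r in Ioi 0, (r ^ 2 * g r ^ 2 - r ^ 2 * q r * f r ^ 2) := by
  by_contra hcon
  push Not at hcon
  set φ := fun r => r ^ 2 * g r ^ 2 - r ^ 2 * q r * f r ^ 2 with hφ
  set J := ∫ r in Ioi 0, φ r
  have hlow : ∀ X, t m ≤ X → -(X * f X ^ 2) ≤ ∫ r in (0 : ℝ)..X, φ r := by
    intro X hX
    have hX0 : 0 < X := (ht.pos' m).trans_le hX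
    have hio : IntegrableOn φ (uIcc 0 X) := by
      rw [uIcc_of_le hX0.le, integrableOn_Icc_iff_integrableOn_Ioc]
      exact hint.mono_set Ioc_subset_Ioi_self
    have hc := (intervalIntegral.continuousOn_primitive_interval_left hio) 0 (by simp)
    rw [uIcc_of_le hX0.le] at hc
    have hc' : Tendsto (fun x => ∫ r in x..X, φ r) (𝓝[>] 0) (𝓝 (∫ r in (0 : ℝ)..X, φ r)) := by
      refine (hc.tendsto).mono_left ?_
      rw [← nhdsWithin_Ioo_eq_nhdsGT hX0]
      exact nhdsWithin_mono _ Ioo_subset_Icc_self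
    refine ge_of_tendsto hc' ?_
    filter_upwards [Ioo_mem_nhdsGT ht.pos] with ε hε
    exact hf.neg_mul_sq_le hq hq0 hqC hqT hreg ht hne hgap ⟨hε.1, hε.2.le⟩ hX
  have hlim : Tendsto (fun X => ∫ r in (0 : ℝ)..X, φ r) atTop (𝓝 J) :=
    intervalIntegral_tendsto_integral_Ioi 0 hint tendsto_id
  have hev : ∀ᶠ X in atTop, -J / 2 ≤ X * f X ^ 2 := by
    filter_upwards [hlim.eventually (gt_mem_nhds (show J < J / 2 by linarith)),
      eventually_ge_atTop (t m)] with X h1 h2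
    linarith [hlow X h2]
  obtain ⟨X₀, hX₀⟩ := eventually_atTop.1 hev
  set δ := -J / 2 with hδ
  have hδ0 : 0 < δ := by rw [hδ]; linarith
  set X₁ := max X₀ 1
  have hX₁ : 0 < X₁ := lt_max_of_lt_right one_pos
  apply not_integrableOn_Ioi_inv (a := X₁)
  have h1 : IntegrableOn (fun r => (δ ^ 3)⁻¹ * (r ^ 2 * f r ^ 6)) (Ioi X₁) :=
    (hf6.mono_set (Ioi_subset_Ioi hX₁.le)).const_mul _
  refine Integrable.mono' h1 (by fun_prop) ?_
  refine (ae_restrict_iff' measurableSet_Ioi).2 (Eventually.of_forall fun r hr => ?_)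
  have hr' : X₁ < r := hr
  have hr0 : 0 < r := hX₁.trans hr'
  have h2 : δ ≤ r * f r ^ 2 := hX₀ r ((le_max_left _ _).trans hr'.le)
  have h3 : δ ^ 3 ≤ (r * f r ^ 2) ^ 3 := by gcongr
  rw [Real.norm_eq_abs, abs_of_pos (inv_pos.2 hr0)]
  calc r⁻¹ = (δ ^ 3)⁻¹ * (δ ^ 3 * r⁻¹) := by field_simp
    _ ≤ (δ ^ 3)⁻¹ * ((r * f r ^ 2) ^ 3 * r⁻¹) := by gcongr
    _ = _ := by field_simp

end IsRadialProfile

/-! ### Integration of radial functions on `ℝ³` -/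

lemma integral_norm (h : ℝ → ℝ) :
    ∫ x : Space, h ‖x‖ = 4 * Real.pi * ∫ r in Ioi (0 : ℝ), r ^ 2 * h r := by
  have h1 := integral_fun_norm_addHaar (volume : Measure Space) h
  have h2 : (volume : Measure Space).real (Metric.ball 0 1) = Real.pi * 4 / 3 := by
    have hpi := Real.pi_pos
    rw [measureReal_def, EuclideanSpace.volume_ball_fin_three, ENNReal.ofReal_one, one_pow, one_mul,
      ENNReal.toReal_ofReal (by positivity)]
  rw [h1, h2]
  simp only [finrank_euclideanSpace, Fintype.card_fin, smul_eq_mul, nsmul_eq_mul]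
  push_cast
  ring

lemma integrable_norm_iff {h : ℝ → ℝ} :
    Integrable (fun x : Space => h ‖x‖) ↔ IntegrableOn (fun r => r ^ 2 * h r) (Ioi 0) := by
  have := integrable_fun_norm_addHaar (volume : Measure Space) (f := h)
  simpa [finrank_euclideanSpace] using this

lemma ae_norm_of_ae {P : ℝ → Prop} (hP : ∀ᵐ r, 0 < r → P r) : ∀ᵐ x : Space, P ‖x‖ := by
  set S := toMeasurable volume {r | ¬(0 < r → P r)} with hS
  have hSm : MeasurableSet S := measurableSet_toMeasurable _ _
  have hS0 : volume S = 0 := by rw [hS, measure_toMeasurable]; exact hP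
  set h : ℝ → ℝ := S.indicator 1 with hh
  have hae : ∀ᵐ r ∂volume.restrict (Ioi (0 : ℝ)), r ^ 2 * h r = 0 := by
    apply ae_restrict_of_ae
    have : ∀ᵐ r, r ∉ S := by rw [ae_iff]; simpa using hS0
    filter_upwards [this] with r hr
    simp [hh, hr]
  have hi : Integrable (fun x : Space => h ‖x‖) := by
    rw [integrable_norm_iff]
    exact (integrable_zero _ _ _).congr (hae.mono fun r hr => by simpa using hr.symm)
  have hz : ∫ x : Space, h ‖x‖ = 0 := by
    rw [integral_norm, integral_congr_ae hae]; simp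
  have hnn : 0 ≤ fun x : Space => h ‖x‖ := fun x => indicator_nonneg (fun _ _ => zero_le_one) _
  have h0 := (integral_eq_zero_iff_of_nonneg hnn hi).1 hz
  have hx0 : ∀ᵐ x : Space, x ≠ 0 := by simp [ae_iff]
  filter_upwards [h0, hx0] with x hx hx0
  by_contra hcon
  have hmem : ‖x‖ ∈ S := subset_toMeasurable _ _ (by
    simp only [mem_ofPred_eq, Classical.not_imp]
    exact ⟨norm_pos_iff.2 hx0, hcon⟩)
  simp [hh, hmem] at hx

lemma hasCompactSupport_comp_norm {η : ℝ → ℝ} (hη : HasCompactSupport η) :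
    HasCompactSupport fun x : Space => η ‖x‖ := by
  obtain ⟨R, hR⟩ := hη.isCompact.isBounded.subset_closedBall 0
  refine HasCompactSupport.of_support_subset_isCompact (isCompact_closedBall (0 : Space) R) ?_
  intro x hx
  have := hR (subset_tsupport _ (show ‖x‖ ∈ Function.support η from hx))
  simpa using this

/-! ### Radial test functions -/

lemma exists_support_subset_Icc {η : ℝ → ℝ} (hη : HasCompactSupport η)
    (hs : tsupport η ⊆ Ioi 0) : ∃ a b, 0 < a ∧ a < b ∧ ∀ r, r ∉ Icc a b → η r = 0 := by
  rcases (tsupport η).eq_empty_or_nonempty with he | hne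
  · refine ⟨1, 2, one_pos, one_lt_two, fun r _ => ?_⟩
    rw [tsupport_eq_empty_iff] at he; simp [he]
  · obtain ⟨a, ha, hamin⟩ := hη.isCompact.exists_isLeast hne
    obtain ⟨b, hb, hbmax⟩ := hη.isCompact.exists_isGreatest hne
    refine ⟨a, b + 1, hs ha, by linarith [hamin hb], fun r hr => ?_⟩
    by_contra hcon
    have hr' := subset_tsupport η hcon
    exact hr ⟨hamin hr', by linarith [hbmax hr']⟩

lemma contDiff_comp_norm {ζ : ℝ → ℝ} (hζ : ContDiff ℝ (⊤ : ℕ∞) ζ) {a : ℝ} (ha : 0 < a)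
    (hz : ∀ r < a, ζ r = 0) : ContDiff ℝ (⊤ : ℕ∞) fun x : Space => ζ ‖x‖ := by
  rw [contDiff_iff_contDiffAt]
  intro x
  by_cases hx : x = 0
  · have : (fun x : Space => ζ ‖x‖) =ᶠ[𝓝 x] fun _ => 0 := by
      filter_upwards [Metric.ball_mem_nhds x ha] with y hy
      apply hz
      simpa [hx] using hy
    exact contDiffAt_const.congr_of_eventuallyEq this
  · exact hζ.contDiffAt.comp x (contDiffAt_norm ℝ hx)

lemma hasFDerivAt_norm_of_ne_zero {x : Space} (hx : x ≠ 0) :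
    HasFDerivAt (fun x : Space => ‖x‖) (‖x‖⁻¹ • innerSL ℝ x) x := by
  have := (hasStrictFDerivAt_norm_sq x).hasFDerivAt.sqrt (by simpa using hx)
  simp only [Real.sqrt_sq (norm_nonneg _)] at this
  refine this.congr_fderiv ?_
  ext v
  simp
  field_simp

lemma fderiv_radial_mul_inner {ζ : ℝ → ℝ} (hζ : Differentiable ℝ ζ) {x : Space} (hx : x ≠ 0)
    (v : Space) :
    fderiv ℝ (fun x : Space => ζ ‖x‖ * inner ℝ x v) x v =
      deriv ζ ‖x‖ * (inner ℝ x v) ^ 2 / ‖x‖ + ζ ‖x‖ * ‖v‖ ^ 2 := by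
  have h1 := hasFDerivAt_norm_of_ne_zero hx
  have h2 : HasFDerivAt (fun x : Space => ζ ‖x‖) (deriv ζ ‖x‖ • (‖x‖⁻¹ • innerSL ℝ x)) x :=
    (hζ ‖x‖).hasDerivAt.comp_hasFDerivAt x h1
  have h3 : HasFDerivAt (fun x : Space => inner ℝ x v) (innerSL ℝ v) x := by
    have := (innerSL ℝ v).hasFDerivAt (x := x)
    refine this.congr_of_eventuallyEq (Eventually.of_forall fun y => ?_)
    simp [real_inner_comm]
  have h4 := (h2.mul h3).fderiv
  have h5 : fderiv ℝ (fun x : Space => ζ ‖x‖ * inner ℝ x v) x =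
    fderiv ℝ ((fun x : Space => ζ ‖x‖) * fun x => inner ℝ x v) x := rfl
  rw [h5, h4]
  simp
  ring

lemma sum_inner_sq (x : Space) (b : OrthonormalBasis (Fin 3) ℝ Space) :
    ∑ i, (inner ℝ x (b i)) ^ 2 = ‖x‖ ^ 2 := by
  rw [← b.sum_sq_norm_inner_left x]
  simp

/-- Testing the weak gradient with the fields `ζ(|x|) x`. -/
lemma integral_radial_test {u : Space → ℝ} {G : Space → Space} (hu : LocallyIntegrable u)
    (hG : LocallyIntegrable G) (h : HasWeakGradient u G) {ζ : ℝ → ℝ}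
    (hζ : ContDiff ℝ (⊤ : ℕ∞) ζ) (hζc : HasCompactSupport ζ) {a : ℝ} (ha : 0 < a)
    (hz : ∀ r < a, ζ r = 0) :
    ∫ x, u x * (deriv ζ ‖x‖ * ‖x‖ + 3 * ζ ‖x‖) = -∫ x, ζ ‖x‖ * inner ℝ (G x) x := by
  set b := EuclideanSpace.basisFun (Fin 3) ℝ with hb
  have hζd : Differentiable ℝ ζ := hζ.differentiable (by simp)
  have hsm : ∀ v : Space, ContDiff ℝ (⊤ : ℕ∞) fun x : Space => ζ ‖x‖ * inner ℝ x v := fun v =>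
    (contDiff_comp_norm hζ ha hz).mul (contDiff_id.inner ℝ contDiff_const)
  have hcs : ∀ v : Space, HasCompactSupport fun x : Space => ζ ‖x‖ * inner ℝ x v := fun v =>
    (hasCompactSupport_comp_norm hζc).mul_right
  have hdc : ∀ v : Space, Continuous fun x => fderiv ℝ (fun x : Space => ζ ‖x‖ * inner ℝ x v) x v :=
    fun v => ((hsm v).continuous_fderiv (by simp)).clm_apply continuous_const
  have hds : ∀ v : Space,
      HasCompactSupport fun x => fderiv ℝ (fun x : Space => ζ ‖x‖ * inner ℝ x v) x v :=
    fun v => (hcs v).fderiv_apply ℝ v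
  have hx0 : ∀ᵐ x : Space, x ≠ 0 := by simp [ae_iff]
  have e1 : ∫ x, u x * (deriv ζ ‖x‖ * ‖x‖ + 3 * ζ ‖x‖) =
      ∫ x, ∑ i, u x * fderiv ℝ (fun x : Space => ζ ‖x‖ * inner ℝ x (b i)) x (b i) := by
    apply integral_congr_ae
    filter_upwards [hx0] with x hx
    have hn : ‖x‖ ≠ 0 := norm_ne_zero_iff.2 hx
    simp_rw [fderiv_radial_mul_inner hζd hx, b.norm_eq_one]
    rw [← Finset.mul_sum, Finset.sum_add_distrib, ← Finset.sum_div, ← Finset.mul_sum,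
      sum_inner_sq]
    simp
    left
    field_simp
  have e2 : ∫ x, ζ ‖x‖ * inner ℝ (G x) x =
      ∫ x, ∑ i, (ζ ‖x‖ * inner ℝ x (b i)) * inner ℝ (G x) (b i) := by
    congr 1
    ext x
    rw [← b.sum_inner_mul_inner (G x) x, Finset.mul_sum]
    refine Finset.sum_congr rfl fun i _ => ?_
    rw [real_inner_comm (b i) x]; ring
  rw [e1, e2, integral_finsetSum, integral_finsetSum, ← Finset.sum_neg_distrib]
  · exact Finset.sum_congr rfl fun i _ => h _ (hsm _) (hcs _) _
  · intro i _
    have hGi : LocallyIntegrable (fun x => inner ℝ (G x) (b i)) := by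
      intro x
      obtain ⟨s, hs, hsi⟩ := hG x
      exact ⟨s, hs, hsi.inner_const (b i)⟩
    exact hGi.integrable_smul_left_of_hasCompactSupport (hsm (b i)).continuous (hcs (b i))
  · intro i _
    have := hu.integrable_smul_left_of_hasCompactSupport (hdc (b i)) (hds (b i))
    simpa [mul_comm] using this

/-! ### Weak derivatives on `(0, ∞)` -/

/-- A primitive of a test function on `(0, ∞)` with zero integral is a test function. -/
lemma exists_test_primitive {θ : ℝ → ℝ} (hθ : ContDiff ℝ (⊤ : ℕ∞) θ) {a b : ℝ}
    (hs : ∀ r, r ∉ Icc a b → θ r = 0) (hint : ∫ r, θ r = 0) :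
    ∃ η : ℝ → ℝ, ContDiff ℝ (⊤ : ℕ∞) η ∧ (∀ r, r ∉ Icc a b → η r = 0) ∧
      ∀ r, HasDerivAt η (θ r) r := by
  have hd : ∀ r, HasDerivAt (fun r => ∫ s in a..r, θ s) (θ r) r := fun r =>
    intervalIntegral.integral_hasDerivAt_right (hθ.continuous.intervalIntegrable _ _)
      (hθ.continuous.stronglyMeasurableAtFilter _ _) hθ.continuous.continuousAt
  refine ⟨fun r => ∫ s in a..r, θ s, ?_, ?_, hd⟩
  · rw [contDiff_infty_iff_deriv]
    refine ⟨fun r => (hd r).differentiableAt, ?_⟩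
    rwa [show deriv (fun r => ∫ s in a..r, θ s) = θ from funext fun r => (hd r).deriv]
  · intro r hr
    by_cases h : r < a
    · simp only
      rw [intervalIntegral.integral_congr_ae (g := fun _ => 0)]
      · simp
      · filter_upwards [show ∀ᵐ x : ℝ, x ≠ a by simp [ae_iff]] with x hxa hx
        rw [uIoc_of_ge h.le] at hx
        exact hs x (fun h' => hxa (le_antisymm hx.2 h'.1))
    · push Not at h
      have hbr : b < r := by
        by_contra hcon; exact hr ⟨h, not_lt.1 hcon⟩
      change ∫ s in a..r, θ s = 0
      rw [← hint, intervalIntegral.integral_of_le h, setIntegral_eq_integral_of_ae_compl_eq_zero]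
      filter_upwards [show ∀ᵐ x : ℝ, x ≠ a by simp [ae_iff]] with x hxa hx
      apply hs
      intro h'
      exact hx ⟨lt_of_le_of_ne h'.1 (Ne.symm hxa), h'.2.trans hbr.le⟩

/-- The lemma of du Bois-Reymond on `(0, ∞)`: a function with a locally integrable weak derivative
`g` is, up to a constant, a primitive of `g`. -/
lemma exists_primitive_of_weak_deriv {f g : ℝ → ℝ} (hf : LocallyIntegrableOn f (Ioi 0))
    (hg : ∀ a b, 0 < a → 0 < b → IntervalIntegrable g volume a b)
    (hw : ∀ η : ℝ → ℝ, ContDiff ℝ (⊤ : ℕ∞) η → HasCompactSupport η → tsupport η ⊆ Ioi 0 →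
      ∫ r in Ioi 0, f r * deriv η r = -∫ r in Ioi 0, g r * η r) :
    ∃ c, ∀ᵐ r, 0 < r → f r = c + ∫ s in (1 : ℝ)..r, g s := by
  set A : ℝ → ℝ := fun r => ∫ s in (1 : ℝ)..r, g s with hA
  have hAac : ∀ a b, 0 < a → 0 < b → AbsolutelyContinuousOnInterval A a b := by
    intro a b ha hb
    have h1 : IntervalIntegrable g volume (min (min a b) 1) (max (max a b) 1) :=
      hg _ _ (by positivity) (lt_max_of_lt_right one_pos)
    have hm : min (min a b) 1 ≤ max (max a b) 1 := (min_le_right _ _).trans (le_max_right _ _)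
    have h2 := h1.absolutelyContinuousOnInterval_intervalIntegral (c := 1)
      (by rw [uIcc_of_le hm]; exact ⟨min_le_right _ _, le_max_right _ _⟩)
    refine h2.mono ?_
    rw [uIcc_of_le hm]
    exact Icc_subset_Icc (min_le_left _ _) (le_max_left _ _)
  have hAc : ContinuousOn A (Ioi 0) := by
    intro x hx
    have hx : 0 < x := hx
    have h1 := (hAac (x / 2) (2 * x) (by positivity) (by positivity)).continuousOn
    refine (h1.continuousAt ?_).continuousWithinAt
    rw [uIcc_of_le (by linarith)]
    exact Icc_mem_nhds (by linarith) (by linarith)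
  have hAli : LocallyIntegrableOn A (Ioi 0) := hAc.locallyIntegrableOn measurableSet_Ioi
  -- integrals against functions supported in `[a, b]`
  have hset : ∀ {F : ℝ → ℝ} {a b : ℝ}, 0 < a → a < b → (∀ r, r ∉ Icc a b → F r = 0) →
      ∫ r in Ioi 0, F r = ∫ r in a..b, F r := by
    intro F a b ha hab hF
    rw [intervalIntegral.integral_of_le hab.le, ← integral_Icc_eq_integral_Ioc]
    refine (setIntegral_eq_of_subset_of_forall_sdiff_eq_zero measurableSet_Ioi
      (fun r hr => ha.trans_le hr.1) (fun r hr => hF r hr.2))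
  have hWd : ∀ η : ℝ → ℝ, ContDiff ℝ (⊤ : ℕ∞) η → ∀ a b, 0 < a → a < b →
      (∀ r, r ∉ Icc a b → η r = 0) → ∫ r in Ioi 0, (f r - A r) * deriv η r = 0 := by
    intro η hη a b ha hab hs
    have hb := ha.trans hab
    -- enlarge the interval so that `η` vanishes at its endpoints
    have ha' : 0 < a / 2 := by positivity
    have hab' : a / 2 < b + 1 := by linarith
    have hs' : ∀ r, r ∉ Icc (a / 2) (b + 1) → η r = 0 := fun r hr =>
      hs r (fun h => hr ⟨by linarith [h.1], by linarith [h.2]⟩)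
    have hea : η (a / 2) = 0 := hs _ (fun h => by linarith [h.1])
    have heb : η (b + 1) = 0 := hs _ (fun h => by linarith [h.2])
    have hts : tsupport η ⊆ Icc a b :=
      closure_minimal (fun r hr => by by_contra h; exact hr (hs r h)) isClosed_Icc
    have hcs : HasCompactSupport η := isCompact_Icc.of_isClosed_subset (isClosed_tsupport _) hts
    have hdz : ∀ r, r ∉ Icc (a / 2) (b + 1) → deriv η r = 0 := by
      intro r hr
      by_contra hcon
      have := hts (support_deriv_subset (f := η) hcon)
      exact hr ⟨by linarith [this.1], by linarith [this.2]⟩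
    have hdc : Continuous (deriv η) := hη.continuous_deriv (by simp)
    have h1 := hw η hη hcs (fun r hr => ha.trans_le (hts hr).1)
    have hηac : AbsolutelyContinuousOnInterval η (a / 2) (b + 1) :=
      absolutelyContinuousOnInterval_of_hasDerivAt
        (fun r _ => (hη.differentiable (by simp) r).hasDerivAt) hdc.continuousOn
    have h2 := (hAac _ _ ha' (by linarith : 0 < b + 1)).integral_mul_deriv_eq_deriv_mul hηac
    rw [hea, heb] at h2
    simp only [mul_zero, sub_zero, zero_sub] at h2
    have h3 : ∫ x in (a / 2)..(b + 1), deriv A x * η x = ∫ x in (a / 2)..(b + 1), g x * η x := by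
      apply intervalIntegral.integral_congr_ae
      have h4 : IntervalIntegrable g volume (min (a / 2) 1) (max (b + 1) 1) :=
        hg _ _ (by positivity) (by positivity)
      have hm : min (a / 2) 1 ≤ max (b + 1) 1 := (min_le_right _ _).trans (le_max_right _ _)
      filter_upwards [h4.ae_hasDerivAt_integral] with x hx hxm
      rw [uIoc_of_le hab'.le] at hxm
      rw [uIcc_of_le hm] at hx
      rw [(hx ⟨(min_le_left _ _).trans hxm.1.le, hxm.2.trans (le_max_left _ _)⟩ 1
        ⟨min_le_right _ _, le_max_right _ _⟩).deriv]
    rw [h3] at h2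
    rw [hset (F := fun r => f r * deriv η r) ha' hab' (fun r hr => by simp [hdz r hr]),
      hset (F := fun r => g r * η r) ha' hab' (fun r hr => by simp [hs' r hr])] at h1
    rw [hset ha' hab' (fun r hr => by simp [hdz r hr])]
    have hsub : uIcc (a / 2) (b + 1) ⊆ Ioi 0 := by
      rw [uIcc_of_le hab'.le]; exact fun r hr => ha'.trans_le hr.1
    have i1 : IntervalIntegrable f volume (a / 2) (b + 1) :=
      (hf.integrableOn_compact_subset hsub isCompact_uIcc).intervalIntegrable
    have i2 : IntervalIntegrable A volume (a / 2) (b + 1) :=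
      (hAli.integrableOn_compact_subset hsub isCompact_uIcc).intervalIntegrable
    simp_rw [sub_mul]
    rw [intervalIntegral.integral_sub (i1.mul_continuousOn hdc.continuousOn)
      (i2.mul_continuousOn hdc.continuousOn), h1, h2]
    ring
  -- a normalised bump function
  obtain ⟨η₀, hη₀, hη₀s, hη₀i⟩ : ∃ η₀ : ℝ → ℝ, ContDiff ℝ (⊤ : ℕ∞) η₀ ∧
      (∀ r, r ∉ Icc (1 : ℝ) 3 → η₀ r = 0) ∧ ∫ r, η₀ r = 1 := by
    let φ : ContDiffBump (2 : ℝ) := ⟨1 / 2, 1, by norm_num, by norm_num⟩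
    refine ⟨φ.normed volume, φ.contDiff_normed, fun r hr => ?_, φ.integral_normed⟩
    by_contra hcon
    have h1 : r ∈ Function.support (φ.normed volume) := hcon
    rw [φ.support_normed_eq, Real.ball_eq_Ioo] at h1
    have h2 : φ.rOut = 1 := rfl
    rw [h2] at h1
    exact hr ⟨by linarith [h1.1], by linarith [h1.2]⟩
  set c := ∫ r in Ioi 0, (f r - A r) * η₀ r with hc
  refine ⟨c, ?_⟩
  have hli : LocallyIntegrableOn (fun r => f r - A r - c) (Ioi 0) :=
    (hf.sub hAli).sub (locallyIntegrableOn_const c)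
  have hcont : ∀ {F : ℝ → ℝ} {a b : ℝ}, 0 < a → a < b → Continuous F →
      (∀ r, r ∉ Icc a b → F r = 0) → IntegrableOn (fun r => (f r - A r) * F r) (Ioi 0) := by
    intro F a b ha hab hF hs
    have h1 : IntegrableOn (fun r => f r - A r) (Icc a b) :=
      (hf.sub hAli).integrableOn_compact_subset (fun r hr => ha.trans_le hr.1) isCompact_Icc
    have h2 := h1.mul_continuousOn hF.continuousOn isCompact_Icc
    exact (h2.of_forall_sdiff_eq_zero measurableSet_Ioi (fun r hr => by simp [hs r hr.2]))
  have h0 := isOpen_Ioi.ae_eq_zero_of_integral_contDiff_smul_eq_zero hli (fun θ hθ hθc hθs => by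
    obtain ⟨a, b, ha, hab, hs⟩ := exists_support_subset_Icc hθc hθs
    have hi0 : ∀ {F : ℝ → ℝ} {a b : ℝ}, Continuous F → (∀ r, r ∉ Icc a b → F r = 0) →
        Integrable F := fun {F a b} hF hs =>
      hF.integrable_of_hasCompactSupport
        (HasCompactSupport.of_support_subset_isCompact isCompact_Icc
          (K := Icc a b) (fun r hr => by by_contra h; exact hr (hs r h)))
    set I := ∫ r, θ r with hI
    set a' := min a 1
    set b' := max b 3
    have ha' : 0 < a' := lt_min ha one_pos
    have hab' : a' < b' := (min_le_left a 1).trans_lt (hab.trans_le (le_max_left b 3))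
    have hs1 : ∀ r, r ∉ Icc a' b' → θ r = 0 := fun r hr =>
      hs r (fun h => hr ⟨(min_le_left _ _).trans h.1, h.2.trans (le_max_left _ _)⟩)
    have hs2 : ∀ r, r ∉ Icc a' b' → η₀ r = 0 := fun r hr =>
      hη₀s r (fun h => hr ⟨(min_le_right _ _).trans h.1, h.2.trans (le_max_right _ _)⟩)
    obtain ⟨η, hη, hηs, hηd⟩ := exists_test_primitive (θ := fun r => θ r - I * η₀ r)
      (hθ.sub (contDiff_const.mul hη₀))
      (fun r hr => by simp [hs1 r hr, hs2 r hr]) (by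
        rw [integral_sub (hi0 hθ.continuous hs) ((hi0 hη₀.continuous hη₀s).const_mul I),
          integral_const_mul, hη₀i]; simp [hI])
    have h1 := hWd η hη a' b' ha' hab' hηs
    rw [show deriv η = fun r => θ r - I * η₀ r from funext fun r => (hηd r).deriv] at h1
    have i1 := hcont ha hab hθ.continuous hs
    have i2 := hcont one_pos (by norm_num) hη₀.continuous hη₀s
    have h2 : ∫ r in Ioi 0, (f r - A r) * θ r = I * c := by
      have h3 : ∫ r in Ioi 0, (f r - A r) * (θ r - I * η₀ r) =
          (∫ r in Ioi 0, (f r - A r) * θ r) - I * ∫ r in Ioi 0, (f r - A r) * η₀ r := by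
        rw [← integral_const_mul, ← integral_sub i1 (i2.const_mul I)]
        congr 1; ext r; ring
      rw [h3] at h1
      linarith
    have h4 : ∫ r, θ r • (f r - A r - c) = ∫ r in Ioi 0, θ r • (f r - A r - c) := by
      rw [setIntegral_eq_integral_of_forall_compl_eq_zero]
      intro r hr
      rw [hs r (fun h => hr (ha.trans_le h.1))]; simp
    have h5 : ∫ r in Ioi 0, θ r = I := by
      rw [setIntegral_eq_integral_of_forall_compl_eq_zero]
      intro r hr
      rw [hs r (fun h => hr (ha.trans_le h.1))]
    rw [h4]
    have h6 : ∀ r, θ r • (f r - A r - c) = (f r - A r) * θ r - c * θ r := by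
      intro r; simp; ring
    simp_rw [h6]
    rw [integral_sub i1 (((hi0 hθ.continuous hs).integrableOn).const_mul c), h2,
      integral_const_mul, h5]
    ring)
  filter_upwards [h0] with r hr hr0
  have := hr hr0
  linarith

/-! ### Absolutely continuous representatives in the radial space -/

lemma exists_adjoint_apply {E F : Type*} [NormedAddCommGroup E] [InnerProductSpace ℝ E]
    [CompleteSpace E] [NormedAddCommGroup F] [InnerProductSpace ℝ F] [CompleteSpace F]
    (Φ : E →ₗᵢ[ℝ] F) (y : F) : ∃ g : E, ‖g‖ ≤ ‖y‖ ∧ ∀ x, inner ℝ x g = inner ℝ (Φ x) y := by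
  refine ⟨ContinuousLinearMap.adjoint Φ.toContinuousLinearMap y, ?_, fun x => ?_⟩
  · refine (ContinuousLinearMap.le_opNorm _ _).trans ?_
    rw [LinearIsometryEquiv.norm_map]
    exact mul_le_of_le_one_left (norm_nonneg _) Φ.norm_toContinuousLinearMap_le
  · rw [ContinuousLinearMap.adjoint_inner_right]; rfl

/-- The radial derivative: the adjoint in `L²` of composition with the norm sends the radial
component of `G` to its spherical mean `g`, which has at most the same norm. -/
lemma exists_radial_average (G : Lp Space 2 (volume : Measure Space)) :
    ∃ g : ℝ → ℝ, Measurable g ∧ IntegrableOn (fun r => r ^ 2 * g r ^ 2) (Ioi 0) ∧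
      4 * Real.pi * ∫ r in Ioi 0, r ^ 2 * g r ^ 2 ≤ ∫ x, ‖G x‖ ^ 2 ∧
      ∀ η : ℝ → ℝ, Continuous η → HasCompactSupport η →
        ∫ x : Space, g ‖x‖ * η ‖x‖ = ∫ x : Space, η ‖x‖ * inner ℝ (G x) (‖x‖⁻¹ • x) := by
  set ν : Measure ℝ := (volume : Measure Space).map norm with hν
  have hmp : MeasurePreserving (norm : Space → ℝ) volume ν := measurable_norm.measurePreserving _
  have hGm : MemLp G 2 (volume : Measure Space) := Lp.memLp G
  have hle : ∀ x : Space, ‖inner ℝ (G x) (‖x‖⁻¹ • x)‖ ≤ ‖G x‖ := by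
    intro x
    refine (norm_inner_le_norm _ _).trans ?_
    have : ‖‖x‖⁻¹ • x‖ ≤ 1 := by
      rw [norm_smul, norm_inv, norm_norm]
      exact inv_mul_le_one
    exact mul_le_of_le_one_right (norm_nonneg _) this
  have hHm : MemLp (fun x : Space => inner ℝ (G x) (‖x‖⁻¹ • x)) 2 volume := by
    refine hGm.of_le ?_ (Eventually.of_forall hle)
    exact (hGm.aestronglyMeasurable).inner (by
      exact (Measurable.aestronglyMeasurable (by fun_prop)))
  set H := hHm.toLp with hH
  obtain ⟨g, hgn, hg⟩ := exists_adjoint_apply (Lp.compMeasurePreservingₗᵢ ℝ norm hmp) H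
  have hgsm : StronglyMeasurable g := Lp.stronglyMeasurable g
  have hgm : MemLp g 2 ν := Lp.memLp g
  have hcomp : MemLp (fun x : Space => g ‖x‖) 2 volume := hgm.comp_measurePreserving hmp
  have hsq : Integrable (fun x : Space => g ‖x‖ ^ 2) := hcomp.integrable_sq
  have hmap : ∀ F : ℝ → ℝ, Measurable F → ∫ a, F a ∂ν = ∫ x : Space, F ‖x‖ := fun F hF =>
    integral_map measurable_norm.aemeasurable hF.aestronglyMeasurable
  have hnormg : ∫ x : Space, g ‖x‖ ^ 2 = ‖g‖ ^ 2 := by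
    rw [← real_inner_self_eq_norm_sq, L2.inner_def,
      hmap (fun a => inner ℝ (g a) (g a)) (hgsm.measurable.inner hgsm.measurable)]
    simp [pow_two]
  have hnormH : ‖H‖ ^ 2 ≤ ∫ x, ‖G x‖ ^ 2 := by
    rw [← real_inner_self_eq_norm_sq, L2.inner_def]
    apply integral_mono_ae
    · exact L2.integrable_inner _ _
    · exact hGm.integrable_norm_pow (by norm_num)
    · filter_upwards [hHm.coeFn_toLp] with x hx
      rw [hH, hx]
      rw [real_inner_self_eq_norm_sq]
      have := hle x
      gcongr
  refine ⟨g, hgsm.measurable, integrable_norm_iff.1 hsq, ?_, fun η hη hηc => ?_⟩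
  · rw [← integral_norm (fun r => g r ^ 2), hnormg]
    exact le_trans (by gcongr) hnormH
  · have hη2 : MemLp (fun x : Space => η ‖x‖) 2 volume :=
      (hη.comp continuous_norm).memLp_of_hasCompactSupport (hasCompactSupport_comp_norm hηc)
    have hην : MemLp η 2 ν :=
      (memLp_map_measure_iff hη.aestronglyMeasurable measurable_norm.aemeasurable).2 hη2
    have h1 := hg (hην.toLp η)
    have h2 : Lp.compMeasurePreservingₗᵢ ℝ norm hmp (hην.toLp η) =
        hη2.toLp (fun x : Space => η ‖x‖) := rfl
    rw [h2, L2.inner_def, L2.inner_def] at h1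
    have h3 : ∫ a, inner ℝ (hην.toLp η a) (g a) ∂ν = ∫ x : Space, g ‖x‖ * η ‖x‖ := by
      have h4 : ∫ a, inner ℝ (hην.toLp η a) (g a) ∂ν = ∫ a, g a * η a ∂ν := by
        apply integral_congr_ae
        filter_upwards [hην.coeFn_toLp] with a ha
        rw [ha]; simp
      rw [h4, hmap (fun a => g a * η a) (hgsm.measurable.mul hη.measurable)]
    have h5 : ∫ a, inner ℝ (hη2.toLp (fun x : Space => η ‖x‖) a) (H a) =
        ∫ x : Space, η ‖x‖ * inner ℝ (G x) (‖x‖⁻¹ • x) := by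
      apply integral_congr_ae
      filter_upwards [hη2.coeFn_toLp, hHm.coeFn_toLp] with a ha ha'
      rw [ha, hH, ha']; simp [mul_comm]
    rw [← h3, h1, h5]

lemma integrableOn_Icc_of_pow {f : ℝ → ℝ} (hf : Measurable f) {n : ℕ} (hn : n ≠ 0) (hne : Even n)
    (hi : IntegrableOn (fun r => r ^ 2 * f r ^ n) (Ioi 0)) {a b : ℝ} (ha : 0 < a) :
    IntegrableOn f (Icc a b) := by
  have h1 : IntegrableOn (fun r => 1 + (a ^ 2)⁻¹ * (r ^ 2 * f r ^ n)) (Icc a b) :=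
    (integrableOn_const (by simp) (by simp)).add
      ((hi.mono_set fun r hr => ha.trans_le hr.1).const_mul _)
  refine Integrable.mono' h1 hf.aestronglyMeasurable ?_
  refine (ae_restrict_iff' measurableSet_Icc).2 (Eventually.of_forall fun r hr => ?_)
  have h2 : |f r| ≤ 1 + f r ^ n := by
    rw [← hne.pow_abs]
    rcases le_total |f r| 1 with h | h
    · have : 0 ≤ |f r| ^ n := by positivity
      linarith
    · have := le_self_pow₀ h hn
      linarith
  have h3 : 0 ≤ f r ^ n := hne.pow_nonneg _
  have h4 : 1 ≤ (a ^ 2)⁻¹ * r ^ 2 := by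
    rw [← div_eq_inv_mul, one_le_div (by positivity)]
    have := hr.1
    gcongr
  rw [Real.norm_eq_abs]
  calc |f r| ≤ 1 + 1 * f r ^ n := by linarith
    _ ≤ 1 + ((a ^ 2)⁻¹ * r ^ 2) * f r ^ n := by gcongr
    _ = _ := by ring

/-- Elements of the radial homogeneous Sobolev space are absolutely continuous functions of `|x|`,
and the radial part of the gradient controls the derivative. -/
lemma exists_isRadialProfile {P : FunctionGradientPairs} (hP : P ∈ radialHomSobolev) :
    ∃ f g : ℝ → ℝ, (∀ᵐ x, P.1 x = f ‖x‖) ∧ IsRadialProfile f g ∧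
      IntegrableOn (fun r => r ^ 2 * f r ^ 6) (Ioi 0) ∧
      4 * Real.pi * ∫ r in Ioi 0, r ^ 2 * g r ^ 2 ≤ ∫ x, ‖P.2 x‖ ^ 2 := by
  obtain ⟨hw, f, hfm, hf⟩ := hP
  obtain ⟨g, hgm, hg2, hgle, hgt⟩ := exists_radial_average P.2
  have h6 : IntegrableOn (fun r => r ^ 2 * f r ^ 6) (Ioi 0) := by
    rw [← integrable_norm_iff (h := fun r => f r ^ 6)]
    have h1 := (Lp.memLp P.1).integrable_norm_pow (p := 6) (by norm_num)
    refine h1.congr ?_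
    filter_upwards [hf] with x hx
    rw [hx, Real.norm_eq_abs, Even.pow_abs (by decide)]
  have hgi : ∀ a b, 0 < a → 0 < b → IntervalIntegrable g volume a b := by
    intro a b ha hb
    rw [intervalIntegrable_iff]
    exact (integrableOn_Icc_of_pow hgm two_ne_zero even_two hg2 (lt_min ha hb)).mono_set
      uIoc_subset_uIcc
  have hfl : LocallyIntegrableOn f (Ioi 0) := by
    rw [locallyIntegrableOn_iff isOpen_Ioi.isLocallyClosed]
    intro k hk hkc
    rcases k.eq_empty_or_nonempty with rfl | hne
    · simp
    · obtain ⟨a, ha, hamin⟩ := hkc.exists_isLeast hne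
      obtain ⟨b, hb, hbmax⟩ := hkc.exists_isGreatest hne
      exact (integrableOn_Icc_of_pow hfm (n := 6) (by norm_num) (by decide) h6 (hk ha)).mono_set
        (fun r hr => ⟨hamin hr, hbmax hr⟩ : k ⊆ Icc a b)
  have hpi : (4 * Real.pi) ≠ 0 := by positivity
  obtain ⟨c, hc⟩ := exists_primitive_of_weak_deriv hfl hgi (fun η hη hηc hηs => by
    obtain ⟨a, b, ha, hab, hs⟩ := exists_support_subset_Icc hηc hηs
    -- the test field is `ζ(|x|) x` with `ζ = η / r³`
    set ζ : ℝ → ℝ := fun r => η r / r ^ 3 with hζ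
    have hζs : ∀ r < a, ζ r = 0 := fun r hr => by
      simp [hζ, hs r (fun h => absurd h.1 (not_le.2 hr))]
    have hζsm : ContDiff ℝ (⊤ : ℕ∞) ζ := by
      rw [contDiff_iff_contDiffAt]
      intro r
      by_cases hr : r < a
      · have : ζ =ᶠ[𝓝 r] fun _ => 0 := by
          filter_upwards [gt_mem_nhds hr] with s hs using hζs s hs
        exact contDiffAt_const.congr_of_eventuallyEq this
      · have : r ≠ 0 := (ha.trans_le (not_lt.1 hr)).ne'
        exact hη.contDiffAt.div (contDiff_id.pow 3).contDiffAt (pow_ne_zero 3 this)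
    have hζc : HasCompactSupport ζ := by
      refine HasCompactSupport.of_support_subset_isCompact (K := Icc a b) isCompact_Icc ?_
      intro r hr
      by_contra h
      exact hr (by simp [hζ, hs r h])
    have hlu : LocallyIntegrable P.1 := (Lp.memLp P.1).locallyIntegrable (by norm_num)
    have hlG : LocallyIntegrable P.2 := (Lp.memLp P.2).locallyIntegrable (by norm_num)
    have h1 := integral_radial_test hlu hlG hw hζsm hζc ha hζs
    have hd : ∀ r, 0 < r → r ^ 2 * (deriv ζ r * r + 3 * ζ r) = deriv η r := by
      intro r hr
      have h2 : HasDerivAt ζ ((deriv η r * r ^ 3 - η r * (3 * r ^ 2)) / (r ^ 3) ^ 2) r :=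
        ((hη.differentiable (by simp) r).hasDerivAt).div
          (by simpa using hasDerivAt_pow 3 r) (pow_ne_zero 3 hr.ne')
      rw [h2.deriv, hζ]
      field_simp
      ring
    have h2 : ∫ x, P.1 x * (deriv ζ ‖x‖ * ‖x‖ + 3 * ζ ‖x‖) =
        4 * Real.pi * ∫ r in Ioi 0, f r * deriv η r := by
      have e : ∫ x, P.1 x * (deriv ζ ‖x‖ * ‖x‖ + 3 * ζ ‖x‖) =
          ∫ x : Space, f ‖x‖ * (deriv ζ ‖x‖ * ‖x‖ + 3 * ζ ‖x‖) := by
        apply integral_congr_ae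
        filter_upwards [hf] with x hx
        rw [hx]
      rw [e, integral_norm (fun r => f r * (deriv ζ r * r + 3 * ζ r))]
      congr 1
      apply setIntegral_congr_fun measurableSet_Ioi
      intro r hr
      simp only
      rw [← hd r hr]; ring
    have h3 := hgt (fun r => ζ r * r) (hζsm.continuous.mul continuous_id) hζc.mul_right
    have h4 : ∫ x : Space, ζ ‖x‖ * ‖x‖ * inner ℝ (P.2 x) (‖x‖⁻¹ • x) =
        ∫ x, ζ ‖x‖ * inner ℝ (P.2 x) x := by
      apply integral_congr_ae
      filter_upwards [show ∀ᵐ x : Space, x ≠ 0 by simp [ae_iff]] with x hx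
      have : ‖x‖ ≠ 0 := norm_ne_zero_iff.2 hx
      rw [real_inner_smul_right]
      field_simp
    have h5 : ∫ x : Space, g ‖x‖ * (ζ ‖x‖ * ‖x‖) =
        4 * Real.pi * ∫ r in Ioi 0, g r * η r := by
      rw [integral_norm (fun r => g r * (ζ r * r))]
      congr 1
      apply setIntegral_congr_fun measurableSet_Ioi
      intro r hr
      have hr : r ≠ 0 := (mem_Ioi.1 hr).ne'
      simp only [hζ]
      field_simp
    rw [h2, ← h4, ← h3, h5, ← mul_neg] at h1
    exact mul_left_cancel₀ hpi h1)
  have hfc := ae_norm_of_ae hc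
  refine ⟨fun r => c + ∫ s in (1 : ℝ)..r, g s, g, ?_, ⟨hgi, ?_, hg2⟩, ?_, hgle⟩
  · filter_upwards [hf, hfc] with x hx hx'
    rw [hx, hx']
  · intro a b ha hb
    rw [add_sub_add_left_eq_sub, intervalIntegral.integral_interval_sub_left (hgi 1 b one_pos hb)
      (hgi 1 a one_pos ha)]
  · refine h6.congr ((ae_restrict_iff' measurableSet_Ioi).2 ?_)
    filter_upwards [hc] with r hr hr0
    rw [hr hr0]

/-! ### Upper bound for the Morse index -/

/-- The quadratic form `∫ |∇u|² - ∫ q(|x|) u²` of `-Δ - q(|x|)`. -/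
noncomputable def radialForm (q : ℝ → ℝ) (p : FunctionGradientPairs) : ℝ :=
  (∫ x, ‖p.2 x‖ ^ 2) - ∫ x : Space, q ‖x‖ * p.1 x ^ 2

/-- The Morse index of `-Δ - q(|x|)` on radial functions. -/
noncomputable def radialIndex (q : ℝ → ℝ) : ℕ∞ :=
  ⨆ (W : Submodule ℝ FunctionGradientPairs) (_ : FiniteDimensional ℝ W)
    (_ : ∀ p ∈ W, p ∈ radialHomSobolev ∧ (p ≠ 0 → radialForm q p < 0)),
    (Module.finrank ℝ W : ℕ∞)

lemma coeFn_sum_smul {α E : Type*} [MeasurableSpace α] {μ : Measure α} [NormedAddCommGroup E]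
    [NormedSpace ℝ E] {r : ENNReal} {ι : Type*} [Fintype ι] (c : ι → ℝ) (F : ι → Lp E r μ) :
    ∀ᵐ x ∂μ, (∑ i, c i • F i : Lp E r μ) x = ∑ i, c i • F i x := by
  filter_upwards [Lp.coeFn_finsetSum Finset.univ fun i => c i • F i,
    ae_all_iff.2 fun i => Lp.coeFn_smul (c i) (F i)] with x h1 h2
  rw [h1, Finset.sum_apply]
  exact Finset.sum_congr rfl fun i _ => h2 i

lemma integrableOn_mul_sq {q f : ℝ → ℝ} {C T : ℝ} (hq : Continuous q) (hq0 : ∀ r, 0 ≤ q r)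
    (hqC : ∀ r, q r ≤ C) (hqT : ∀ r, T ≤ r → q r = 0) (hf : ContinuousOn f (Ioi 0))
    (hf6 : IntegrableOn (fun r => r ^ 2 * f r ^ 6) (Ioi 0)) :
    IntegrableOn (fun r => r ^ 2 * q r * f r ^ 2) (Ioi 0) := by
  have hC : 0 ≤ C := (hq0 0).trans (hqC 0)
  have h1 : IntegrableOn (fun r => C * ((Ioc 0 T).indicator (fun r => r ^ 2) r +
      r ^ 2 * f r ^ 6)) (Ioi 0) := by
    refine Integrable.const_mul (Integrable.add ?_ hf6) C
    refine (IntegrableOn.integrable_indicator ?_ measurableSet_Ioc).integrableOn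
    exact (continuous_pow 2).integrableOn_Ioc
  refine Integrable.mono' h1 (ContinuousOn.aestronglyMeasurable (by fun_prop) measurableSet_Ioi) ?_
  refine (ae_restrict_iff' measurableSet_Ioi).2 (Eventually.of_forall fun r hr => ?_)
  have hr : 0 < r := hr
  have hq0r := hq0 r
  have h6 : 0 ≤ f r ^ 6 := by positivity
  rw [Real.norm_eq_abs, abs_of_nonneg (by positivity)]
  by_cases hT : r ∈ Ioc 0 T
  · rw [indicator_of_mem hT]
    have h2 : f r ^ 2 ≤ 1 + f r ^ 6 := by
      rcases le_total (f r ^ 2) 1 with h | h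
      · linarith
      · have := le_self_pow₀ h (show 3 ≠ 0 by norm_num)
        rw [← pow_mul, show 2 * 3 = 6 from rfl] at this
        linarith
    calc r ^ 2 * q r * f r ^ 2 ≤ r ^ 2 * C * (1 + f r ^ 6) := by
          gcongr; exact hqC r
      _ = _ := by ring
  · rw [hqT r (le_of_lt (by by_contra h; exact hT ⟨hr, not_lt.1 h⟩))]
    rw [indicator_of_notMem hT]
    simp only [mul_zero, zero_mul, zero_add]
    positivity

lemma eqOn_of_ae_norm {f₁ f₂ : ℝ → ℝ} (h₁ : ContinuousOn f₁ (Ioi 0))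
    (h₂ : ContinuousOn f₂ (Ioi 0)) (h : ∀ᵐ x : Space, f₁ ‖x‖ = f₂ ‖x‖) : EqOn f₁ f₂ (Ioi 0) := by
  have hm : MapsTo (norm : Space → ℝ) {0}ᶜ (Ioi 0) := fun x hx => norm_pos_iff.2 hx
  have h3 := Measure.eqOn_open_of_ae_eq (μ := (volume : Measure Space)) (U := {0}ᶜ)
    (f := fun x => f₁ ‖x‖) (g := fun x => f₂ ‖x‖) (ae_restrict_of_ae h) isOpen_compl_singleton
    (h₁.comp continuous_norm.continuousOn hm) (h₂.comp continuous_norm.continuousOn hm)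
  intro r hr
  obtain ⟨x, hx⟩ := exists_norm_eq Space (le_of_lt hr)
  have := h3 (show x ∈ ({0}ᶜ : Set Space) from norm_pos_iff.1 (hx ▸ hr))
  simpa [hx] using this

lemma radialForm_ge {q : ℝ → ℝ} {p : FunctionGradientPairs} {f g : ℝ → ℝ}
    (hpf : ∀ᵐ x, p.1 x = f ‖x‖)
    (hle : 4 * Real.pi * ∫ r in Ioi 0, r ^ 2 * g r ^ 2 ≤ ∫ x, ‖p.2 x‖ ^ 2)
    (hg : IntegrableOn (fun r => r ^ 2 * g r ^ 2) (Ioi 0))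
    (hqf : IntegrableOn (fun r => r ^ 2 * q r * f r ^ 2) (Ioi 0)) :
    4 * Real.pi * ∫ r in Ioi 0, (r ^ 2 * g r ^ 2 - r ^ 2 * q r * f r ^ 2) ≤ radialForm q p := by
  have h1 : ∫ x : Space, q ‖x‖ * p.1 x ^ 2 =
      4 * Real.pi * ∫ r in Ioi 0, r ^ 2 * q r * f r ^ 2 := by
    simp_rw [mul_assoc (_ ^ 2)]
    rw [← integral_norm (fun r => q r * f r ^ 2)]
    apply integral_congr_ae
    filter_upwards [hpf] with x hx
    rw [hx]
  rw [radialForm, h1, integral_sub hg hqf]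
  linarith

/-- The Morse index is at most the number of sign changes: in a subspace of larger dimension, some
nonzero element satisfies the linear condition at each of the gaps. -/
theorem radialIndex_le {q u p : ℝ → ℝ} {C : ℝ} {t : ℕ → ℝ} {m : ℕ} (hq : Continuous q)
    (hq0 : ∀ r, 0 ≤ q r) (hqC : ∀ r, q r ≤ C) (hqT : ∀ r, t m ≤ r → q r = 0)
    (hreg : IsRegularSolution q u p) (ht : IsMesh C t) (hne : ∀ i ≤ m, u (t i) ≠ 0) :
    radialIndex q ≤ ((signChanges u p t m).card : ℕ∞) := by
  refine iSup_le fun W => iSup_le fun hfd => iSup_le fun hW => ?_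
  rw [Nat.cast_le]
  by_contra hcon
  push Not at hcon
  set S := signChanges u p t m with hS
  let b := Module.finBasis ℝ W
  have hrep := fun i => exists_isRadialProfile (hW (b i) (b i).2).1
  choose f g hfae hfg hf6 hfle using hrep
  let L : (Fin (Module.finrank ℝ W) → ℝ) →ₗ[ℝ] (S → ℝ) :=
    { toFun := fun c j => ∑ i, c i * gapFunctional u t m j (f i)
      map_add' := fun c d => by
        ext j; simp [add_mul, Finset.sum_add_distrib]
      map_smul' := fun a c => by
        ext j; simp [Finset.mul_sum, mul_assoc] }
  have hker : LinearMap.ker L ≠ ⊥ := by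
    apply LinearMap.ker_ne_bot_of_finrank_lt
    simpa using hcon
  obtain ⟨c, hc, hc0⟩ := Submodule.exists_mem_ne_zero_of_ne_bot hker
  have hcL : ∀ j : S, ∑ i, c i * gapFunctional u t m j (f i) = 0 := fun j =>
    congrFun (LinearMap.mem_ker.1 hc) j
  set w : W := ∑ i, c i • b i with hw
  have hw0 : (w : FunctionGradientPairs) ≠ 0 := by
    intro h
    apply hc0
    have h1 : w = 0 := Subtype.ext h
    exact funext (Fintype.linearIndependent_iff.1 b.linearIndependent c h1)
  have hneg := (hW w w.2).2 hw0
  obtain ⟨F, G, hFae, hFG, hF6, hFle⟩ := exists_isRadialProfile (hW w w.2).1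
  have hw1 : (w : FunctionGradientPairs).1 = ∑ i, c i • (b i : FunctionGradientPairs).1 := by
    simp [hw, Prod.fst_sum]
  have hcomb : EqOn F (fun r => ∑ i, c i * f i r) (Ioi 0) := by
    apply eqOn_of_ae_norm hFG.continuousOn
    · exact continuousOn_finsetSum _ fun i _ => continuousOn_const.mul (hfg i).continuousOn
    · have h1 := coeFn_sum_smul c (fun i => (b i : FunctionGradientPairs).1)
      rw [← hw1] at h1
      filter_upwards [hFae, h1, ae_all_iff.2 hfae] with x h2 h3 h4
      rw [← h2, h3]
      exact Finset.sum_congr rfl fun i _ => by rw [h4 i, smul_eq_mul]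
  have hgap : ∀ i ∈ S, gapFunctional u t m i F = 0 := by
    intro i hi
    rw [← hcL ⟨i, hi⟩]
    unfold gapFunctional
    simp only
    split_ifs with him
    · exact hcomb (ht.pos' m)
    · rw [hcomb (ht.pos' i), hcomb (ht.pos' (i + 1))]
      simp only [Finset.mul_sum, Finset.sum_mul, ← Finset.sum_sub_distrib]
      exact Finset.sum_congr rfl fun j _ => by ring
  have hqf := integrableOn_mul_sq hq hq0 hqC hqT hFG.continuousOn hF6
  have h1 := hFG.form_nonneg hq hq0 hqC hqT hreg ht hne hgap hF6 (hFG.integrableOn.sub hqf)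
  have h2 := radialForm_ge hFae hFle hFG.integrableOn hqf
  have h3 : 0 ≤ 4 * Real.pi * ∫ r in Ioi 0, (r ^ 2 * G r ^ 2 - r ^ 2 * q r * F r ^ 2) := by
    have := Real.pi_pos
    positivity
  linarith

/-! ### Trial functions -/

lemma integrableOn_of_decay {F : ℝ → ℝ} {B T : ℝ} (hT : 0 < T)
    (hF : AEStronglyMeasurable F (volume.restrict (Ioi 0)))
    (h1 : ∀ r, 0 < r → r ≤ T → |F r| ≤ B) (h2 : ∀ r, T < r → |F r| ≤ B * (r ^ 2)⁻¹) :
    IntegrableOn F (Ioi 0) := by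
  rw [← Ioc_union_Ioi_eq_Ioi hT.le]
  apply IntegrableOn.union
  · refine Integrable.mono' (g := fun _ => B) (integrableOn_const (by simp) (by simp))
      (hF.mono_set Ioc_subset_Ioi_self) ?_
    exact (ae_restrict_iff' measurableSet_Ioc).2 (Eventually.of_forall fun r hr => h1 r hr.1 hr.2)
  · have h3 : IntegrableOn (fun r : ℝ => B * (r ^ 2)⁻¹) (Ioi T) := by
      refine Integrable.const_mul ?_ B
      refine (integrableOn_Ioi_rpow_of_lt (show (-2 : ℝ) < -1 by norm_num) hT).congr_fun ?_
        measurableSet_Ioi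
      intro r hr
      have hr0 : 0 ≤ r := (hT.trans hr).le
      simp only [Real.rpow_neg hr0, Real.rpow_ofNat]
    refine Integrable.mono' h3 (hF.mono_set (Ioi_subset_Ioi hT.le)) ?_
    exact (ae_restrict_iff' measurableSet_Ioi).2 (Eventually.of_forall fun r hr => h2 r hr)

lemma norm_div_norm_smul (g : ℝ → ℝ) {x : Space} (hx : x ≠ 0) : ‖(g ‖x‖ / ‖x‖) • x‖ = |g ‖x‖| := by
  rw [norm_smul, norm_div, norm_norm, div_mul_cancel₀ _ (norm_ne_zero_iff.2 hx), Real.norm_eq_abs]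

/-- Radial trial functions `f(|x|)`: `f` is continuous and bounded on `[0, ∞)`, with bounded
derivative `g` outside a countable set, and `f` is a multiple of `1 / r` on `[T, ∞)`. -/
structure IsTrial (T : ℝ) (f g : ℝ → ℝ) : Prop where
  continuousOn : ContinuousOn f (Ici 0)
  hasDerivAt : ∃ D : Set ℝ, D.Countable ∧ ∀ r, 0 < r → r ∉ D → HasDerivAt f (g r) r
  measurable : Measurable g
  bounded : ∃ B, ∀ r, 0 ≤ r → |f r| ≤ B ∧ |g r| ≤ B
  tail : ∀ r, T ≤ r → r * f r = T * f T
  tail_deriv : ∀ r, T < r → f r + r * g r = 0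

namespace IsTrial

lemma sum {T : ℝ} {ι : Type*} [Fintype ι] {f g : ι → ℝ → ℝ} (h : ∀ i, IsTrial T (f i) (g i))
    (a : ι → ℝ) : IsTrial T (fun r => ∑ i, a i * f i r) (fun r => ∑ i, a i * g i r) where
  continuousOn := continuousOn_finsetSum _ fun i _ => continuousOn_const.mul (h i).continuousOn
  hasDerivAt := by
    choose D hD hder using fun i => (h i).hasDerivAt
    refine ⟨⋃ i, D i, countable_iUnion hD, fun r hr hrD => ?_⟩
    rw [mem_iUnion, not_exists] at hrD
    exact HasDerivAt.fun_sum fun i _ => (hder i r hr (hrD i)).const_mul (a i)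
  measurable := Finset.measurable_fun_sum _ fun i _ => ((h i).measurable.const_mul (a i))
  bounded := by
    choose B hB using fun i => (h i).bounded
    refine ⟨∑ i, |a i| * B i, fun r hr => ⟨?_, ?_⟩⟩
    · refine (Finset.abs_sum_le_sum_abs _ _).trans (Finset.sum_le_sum fun i _ => ?_)
      rw [abs_mul]
      gcongr
      exact (hB i r hr).1
    · refine (Finset.abs_sum_le_sum_abs _ _).trans (Finset.sum_le_sum fun i _ => ?_)
      rw [abs_mul]
      gcongr
      exact (hB i r hr).2
  tail := fun r hr => by
    rw [Finset.mul_sum, Finset.mul_sum]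
    exact Finset.sum_congr rfl fun i _ => by linear_combination a i * (h i).tail r hr
  tail_deriv := fun r hr => by
    rw [Finset.mul_sum, ← Finset.sum_add_distrib]
    exact Finset.sum_eq_zero fun i _ => by linear_combination a i * (h i).tail_deriv r hr

variable {T : ℝ} {f g : ℝ → ℝ} (h : IsTrial T f g)
include h

lemma intervalIntegrable_deriv {a b : ℝ} (ha : 0 ≤ a) (hb : 0 ≤ b) :
    IntervalIntegrable g volume a b := by
  obtain ⟨B, hB⟩ := h.bounded
  refine (intervalIntegrable_const (c := B)).mono_fun h.measurable.aestronglyMeasurable ?_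
  refine (ae_restrict_iff' measurableSet_uIoc).2 (Eventually.of_forall fun r hr => ?_)
  have : 0 ≤ r := (le_min ha hb).trans (uIoc_subset_uIcc hr).1
  exact ((hB r this).2).trans (le_abs_self B)

lemma exists_lipschitzWith : ∃ K, LipschitzWith K fun x : Space => f ‖x‖ := by
  obtain ⟨B, hB⟩ := h.bounded
  obtain ⟨D, hD, hder⟩ := h.hasDerivAt
  have key : ∀ a b, 0 ≤ a → a ≤ b → |f b - f a| ≤ B * (b - a) := by
    intro a b ha hab
    have h1 := integral_eq_of_hasDerivAt_off_countable_of_le f g hab hD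
      (h.continuousOn.mono fun r hr => ha.trans hr.1)
      (fun r hr => hder r (ha.trans_lt hr.1.1) hr.2) (h.intervalIntegrable_deriv ha (ha.trans hab))
    rw [← h1]
    have h2 := intervalIntegral.norm_integral_le_of_norm_le_const
      (a := a) (b := b) (f := g) (C := B)
      (fun r hr => by
        rw [uIoc_of_le hab] at hr
        exact (hB r (ha.trans hr.1.le)).2)
    rwa [Real.norm_eq_abs, abs_of_nonneg (sub_nonneg.2 hab)] at h2
  refine ⟨B.toNNReal, LipschitzWith.of_dist_le_mul fun x y => ?_⟩
  have hB0 : 0 ≤ B := (abs_nonneg _).trans (hB 0 le_rfl).1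
  rw [Real.coe_toNNReal B hB0, Real.dist_eq]
  have h3 : |f ‖x‖ - f ‖y‖| ≤ B * |‖x‖ - ‖y‖| := by
    rcases le_total ‖x‖ ‖y‖ with hxy | hxy
    · rw [abs_sub_comm, abs_sub_comm ‖x‖, abs_of_nonneg (sub_nonneg.2 hxy)]
      exact key _ _ (norm_nonneg _) hxy
    · rw [abs_of_nonneg (sub_nonneg.2 hxy)]
      exact key _ _ (norm_nonneg _) hxy
  refine h3.trans ?_
  gcongr
  rw [dist_eq_norm]
  exact abs_norm_sub_norm_le x y

lemma integrableOn_pow_six (hT : 0 < T) : IntegrableOn (fun r => r ^ 2 * f r ^ 6) (Ioi 0) := by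
  obtain ⟨B, hB⟩ := h.bounded
  have hB0 : 0 ≤ B := (abs_nonneg _).trans (hB 0 le_rfl).1
  have hf := h.continuousOn.mono Ioi_subset_Ici_self
  refine integrableOn_of_decay hT (B := T ^ 2 * B ^ 6 + B ^ 2 * (T * f T) ^ 4)
    (ContinuousOn.aestronglyMeasurable (by fun_prop) measurableSet_Ioi) ?_ ?_
  · intro r hr hrT
    rw [abs_mul, abs_pow, abs_pow, abs_of_pos hr]
    have h1 := (hB r hr.le).1
    calc r ^ 2 * |f r| ^ 6 ≤ T ^ 2 * B ^ 6 := by gcongr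
      _ ≤ _ := by
        have : 0 ≤ B ^ 2 * (T * f T) ^ 4 := by positivity
        linarith
  · intro r hrT
    have hr : 0 < r := hT.trans hrT
    rw [abs_of_nonneg (by positivity), ← h.tail r hrT.le]
    have h1 := (hB r hr.le).1
    have h2 : f r ^ 2 ≤ B ^ 2 := sq_le_sq' (abs_le.1 h1).1 (abs_le.1 h1).2
    calc r ^ 2 * f r ^ 6 = f r ^ 2 * (r * f r) ^ 4 * (r ^ 2)⁻¹ := by field_simp
      _ ≤ B ^ 2 * (r * f r) ^ 4 * (r ^ 2)⁻¹ := by gcongr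
      _ ≤ (T ^ 2 * B ^ 6 + B ^ 2 * (r * f r) ^ 4) * (r ^ 2)⁻¹ := by
        gcongr
        have : 0 ≤ T ^ 2 * B ^ 6 := by positivity
        linarith

lemma integrableOn_deriv_sq (hT : 0 < T) : IntegrableOn (fun r => r ^ 2 * g r ^ 2) (Ioi 0) := by
  obtain ⟨B, hB⟩ := h.bounded
  have hB0 : 0 ≤ B := (abs_nonneg _).trans (hB 0 le_rfl).1
  have hg := h.measurable
  refine integrableOn_of_decay hT (B := T ^ 2 * B ^ 2 + (T * f T) ^ 2)
    (Measurable.aestronglyMeasurable (by fun_prop)) ?_ ?_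
  · intro r hr hrT
    rw [abs_mul, abs_pow, abs_pow, abs_of_pos hr]
    have h1 := (hB r hr.le).2
    calc r ^ 2 * |g r| ^ 2 ≤ T ^ 2 * B ^ 2 := by gcongr
      _ ≤ _ := by
        have : 0 ≤ (T * f T) ^ 2 := by positivity
        linarith
  · intro r hrT
    have hr : 0 < r := hT.trans hrT
    rw [abs_of_nonneg (by positivity), ← h.tail r hrT.le]
    have h1 : r * g r = -f r := by linarith [h.tail_deriv r hrT]
    calc r ^ 2 * g r ^ 2 = (r * f r) ^ 2 * (r ^ 2)⁻¹ := by
          rw [← mul_pow, h1]; field_simp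
      _ ≤ (T ^ 2 * B ^ 2 + (r * f r) ^ 2) * (r ^ 2)⁻¹ := by
        gcongr
        have : 0 ≤ T ^ 2 * B ^ 2 := by positivity
        linarith

lemma continuous_comp_norm : Continuous fun x : Space => f ‖x‖ :=
  h.continuousOn.comp_continuous continuous_norm fun x => norm_nonneg x

/-- Trial functions define elements of `L⁶ × L²`. -/
lemma exists_pair (hT : 0 < T) : ∃ P : FunctionGradientPairs,
    (∀ᵐ x, P.1 x = f ‖x‖) ∧ ∀ᵐ x, P.2 x = (g ‖x‖ / ‖x‖) • x := by
  have hx0 : ∀ᵐ x : Space, x ≠ 0 := by simp [ae_iff]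
  have h1 : MemLp (fun x : Space => f ‖x‖) 6 := by
    rw [← integrable_norm_rpow_iff h.continuous_comp_norm.aestronglyMeasurable (by norm_num)
      (by norm_num)]
    have := integrable_norm_iff.2 (h.integrableOn_pow_six hT)
    refine this.congr (Eventually.of_forall fun x => ?_)
    simp only [ENNReal.toReal_ofNat, Real.rpow_ofNat, Real.norm_eq_abs]
    rw [Even.pow_abs (by decide)]
  have h2 : MemLp (fun x : Space => (g ‖x‖ / ‖x‖) • x) 2 := by
    have hg := h.measurable
    rw [← integrable_norm_rpow_iff (Measurable.aestronglyMeasurable (by fun_prop)) (by norm_num)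
      (by norm_num)]
    have := integrable_norm_iff.2 (h.integrableOn_deriv_sq hT)
    refine this.congr ?_
    filter_upwards [hx0] with x hx
    simp only [ENNReal.toReal_ofNat, Real.rpow_ofNat]
    rw [norm_div_norm_smul g hx, sq_abs]
  exact ⟨(h1.toLp, h2.toLp), h1.coeFn_toLp, h2.coeFn_toLp⟩

/-- Trial functions belong to the radial homogeneous Sobolev space: they are Lipschitz on `ℝ³`, so
their classical gradient, which exists almost everywhere, is their weak gradient. -/
lemma mem_radialHomSobolev {P : FunctionGradientPairs} (h1 : ∀ᵐ x, P.1 x = f ‖x‖)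
    (h2 : ∀ᵐ x, P.2 x = (g ‖x‖ / ‖x‖) • x) : P ∈ radialHomSobolev := by
  have hx0 : ∀ᵐ x : Space, x ≠ 0 := by simp [ae_iff]
  constructor
  · intro φ hφ hφc v
    obtain ⟨K, hK⟩ := h.exists_lipschitzWith
    obtain ⟨L, hL⟩ := ContDiff.lipschitzWith_of_hasCompactSupport hφc hφ (by simp)
    obtain ⟨D, hD, hder⟩ := h.hasDerivAt
    have h3 := LipschitzWith.integral_lineDeriv_mul_eq (μ := (volume : Measure Space)) hK hL hφc v
    have hDae : ∀ᵐ x : Space, ‖x‖ ∉ D := by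
      apply ae_norm_of_ae (P := fun r => r ∉ D)
      filter_upwards [hD.ae_notMem volume] with r hr _ using hr
    have h4 : ∫ x : Space, lineDeriv ℝ (fun x : Space => f ‖x‖) x v * φ x =
        ∫ x, φ x * inner ℝ (P.2 x) v := by
      apply integral_congr_ae
      filter_upwards [hDae, hx0, h2] with x hxD hx hP
      have hc : HasFDerivAt (fun x : Space => f ‖x‖) (g ‖x‖ • (‖x‖⁻¹ • innerSL ℝ x)) x :=
        (hder ‖x‖ (norm_pos_iff.2 hx) hxD).comp_hasFDerivAt x (hasFDerivAt_norm_of_ne_zero hx)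
      rw [(hc.hasLineDerivAt v).lineDeriv, hP, real_inner_smul_left]
      simp
      ring
    have h5 : ∫ x : Space, lineDeriv ℝ φ x (-v) * f ‖x‖ = -∫ x, P.1 x * fderiv ℝ φ x v := by
      rw [← integral_neg]
      apply integral_congr_ae
      filter_upwards [h1] with x hx
      rw [((hφ.differentiable (by simp)) x).lineDeriv_eq_fderiv, hx, map_neg]
      ring
    rw [h4, h5] at h3
    linarith
  · refine ⟨fun r => f (max r 0), ?_, ?_⟩
    · exact (h.continuousOn.comp_continuous (continuous_id.max continuous_const)
        fun r => mem_Ici.2 (le_max_right _ _)).measurable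
    · filter_upwards [h1] with x hx
      rw [hx, max_eq_left (norm_nonneg x)]

/-- The form in terms of `U = r f`, `U' = f + r g`: integrate `r² g² = U'² - (r f²)'`. -/
lemma radialForm_le {q : ℝ → ℝ} {C : ℝ} (hq : Continuous q) (hq0 : ∀ r, 0 ≤ q r)
    (hqC : ∀ r, q r ≤ C) (hT : 0 < T) (hqT : ∀ r, T ≤ r → q r = 0)
    {P : FunctionGradientPairs} (h1 : ∀ᵐ x, P.1 x = f ‖x‖)
    (h2 : ∀ᵐ x, P.2 x = (g ‖x‖ / ‖x‖) • x) :
    radialForm q P ≤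
      4 * Real.pi * ∫ r in (0 : ℝ)..T, ((f r + r * g r) ^ 2 - q r * (r * f r) ^ 2) := by
  have hx0 : ∀ᵐ x : Space, x ≠ 0 := by simp [ae_iff]
  have hf := h.continuousOn.mono Ioi_subset_Ici_self
  have i1 := h.integrableOn_deriv_sq hT
  have i2 := integrableOn_mul_sq hq hq0 hqC hqT hf (h.integrableOn_pow_six hT)
  have e1 : ∫ x, ‖P.2 x‖ ^ 2 = 4 * Real.pi * ∫ r in Ioi 0, r ^ 2 * g r ^ 2 := by
    rw [← integral_norm (fun r => g r ^ 2)]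
    apply integral_congr_ae
    filter_upwards [h2, hx0] with x hx hx0
    rw [hx, norm_div_norm_smul g hx0, sq_abs]
  have e2 : ∫ x : Space, q ‖x‖ * P.1 x ^ 2 =
      4 * Real.pi * ∫ r in Ioi 0, r ^ 2 * q r * f r ^ 2 := by
    simp_rw [mul_assoc (_ ^ 2)]
    rw [← integral_norm (fun r => q r * f r ^ 2)]
    apply integral_congr_ae
    filter_upwards [h1] with x hx
    rw [hx]
  have hpi := Real.pi_pos
  rw [radialForm, e1, e2, ← mul_sub, ← integral_sub i1 i2]
  gcongr
  have hlim := intervalIntegral_tendsto_integral_Ioi 0 (i1.sub i2) tendsto_id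
  refine le_of_tendsto hlim ?_
  filter_upwards [eventually_ge_atTop T] with X hX
  have hX0 : 0 ≤ X := hT.le.trans hX
  obtain ⟨D, hD, hder⟩ := h.hasDerivAt
  have hcU : ∀ {a b : ℝ}, 0 ≤ a → a ≤ b → ContinuousOn f (uIcc a b) := fun ha hab =>
    h.continuousOn.mono (by rw [uIcc_of_le hab]; exact fun r hr => ha.trans hr.1)
  have hgi : ∀ {a b : ℝ}, 0 ≤ a → a ≤ b →
      IntervalIntegrable (fun r => r ^ 2 * g r ^ 2) volume a b := by
    intro a b ha hab
    rw [intervalIntegrable_iff, uIoc_of_le hab]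
    exact i1.mono_set fun r hr => ha.trans_lt hr.1
  have j1 : IntervalIntegrable (fun r => f r * f r + r * (f r * g r + f r * g r)) volume 0 X := by
    have h3 := h.intervalIntegrable_deriv le_rfl hX0
    have h4 := hcU le_rfl hX0
    have h5 := h3.continuousOn_mul h4
    exact (h4.mul h4).intervalIntegrable.add ((h5.add h5).continuousOn_mul continuousOn_id)
  have j2 : ∀ {a b : ℝ}, 0 ≤ a → a ≤ b →
      IntervalIntegrable (fun r => (f r + r * g r) ^ 2 - q r * (r * f r) ^ 2) volume a b := by
    intro a b ha hab
    have h3 := h.intervalIntegrable_deriv ha (ha.trans hab)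
    have h4 := hcU ha hab
    have h5 := (h3.continuousOn_mul h4).continuousOn_mul (g := fun r : ℝ => 2 * r)
      (by fun_prop)
    refine IntervalIntegrable.sub ?_ (ContinuousOn.intervalIntegrable (by fun_prop))
    refine (((h4.pow 2).intervalIntegrable.add h5).add (hgi ha hab)).congr ?_
    intro r _
    simp only [Pi.pow_apply]
    ring
  have hparts : ∫ r in (0 : ℝ)..X, (f r * f r + r * (f r * g r + f r * g r)) = X * f X ^ 2 := by
    rw [integral_eq_of_hasDerivAt_off_countable_of_le (fun r => r * (f r * f r)) _ hX0 hD
      (by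
        have h4 := hcU le_rfl hX0
        rw [uIcc_of_le hX0] at h4
        fun_prop)
      (fun r hr => by
        have h6 := hder r hr.1.1 hr.2
        refine ((hasDerivAt_id r).mul (h6.mul h6)).congr_deriv ?_
        simp only [Pi.mul_apply, id_eq]
        ring) j1]
    ring
  have hsplit : ∫ r in (0 : ℝ)..X, (r ^ 2 * g r ^ 2 - r ^ 2 * q r * f r ^ 2) =
      (∫ r in (0 : ℝ)..X, ((f r + r * g r) ^ 2 - q r * (r * f r) ^ 2)) - X * f X ^ 2 := by
    rw [← hparts, ← intervalIntegral.integral_sub (j2 le_rfl hX0) j1]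
    congr 1
    ext r
    ring
  have htail : ∫ r in T..X, ((f r + r * g r) ^ 2 - q r * (r * f r) ^ 2) = 0 := by
    rw [intervalIntegral.integral_congr_ae (g := fun _ => 0)]
    · simp
    · refine Eventually.of_forall fun r hr => ?_
      rw [uIoc_of_le hX] at hr
      rw [h.tail_deriv r hr.1, hqT r hr.1.le]
      simp
  change ∫ r in (0 : ℝ)..X, (r ^ 2 * g r ^ 2 - r ^ 2 * q r * f r ^ 2) ≤ _
  rw [hsplit, ← intervalIntegral.integral_add_adjacent_intervals (j2 le_rfl hT.le) (j2 hT.le hX),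
    htail]
  have : 0 ≤ X * f X ^ 2 := by positivity
  linarith

end IsTrial

/-! ### Lower bound for the Morse index -/

/-- The function which agrees with `u` up to `c` and then tends to zero linearly, at the rate
`κ |u(c)|`, until it reaches zero. For `κ = 0` it stays constant beyond `c`. -/
noncomputable def truncation (u : ℝ → ℝ) (c κ r : ℝ) : ℝ :=
  u (min r c) * max 0 (1 - κ * (max r c - c))

/-- The derivative of `truncation u c κ`, where `p = u'`, outside the two corners. -/
noncomputable def truncationDeriv (u p : ℝ → ℝ) (c κ r : ℝ) : ℝ :=
  if r < c then p r else if κ * (r - c) < 1 then -(κ * u c) else 0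

lemma truncation_of_le {u : ℝ → ℝ} {c κ r : ℝ} (h : r ≤ c) : truncation u c κ r = u r := by
  simp [truncation, h]

lemma truncation_of_ge {u : ℝ → ℝ} {c κ r : ℝ} (h : c ≤ r) :
    truncation u c κ r = u c * max 0 (1 - κ * (r - c)) := by
  simp [truncation, h]

lemma truncation_eq_zero {u : ℝ → ℝ} {c κ r : ℝ} (h : c ≤ r) (h1 : 1 ≤ κ * (r - c)) :
    truncation u c κ r = 0 := by
  rw [truncation_of_ge h, max_eq_left (by linarith), mul_zero]

lemma truncationDeriv_eq_zero {u p : ℝ → ℝ} {c κ r : ℝ} (h : c ≤ r)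
    (h1 : 1 ≤ κ * (r - c) ∨ κ = 0) : truncationDeriv u p c κ r = 0 := by
  rw [truncationDeriv, if_neg (not_lt.2 h)]
  rcases h1 with h1 | h1
  · rw [if_neg (not_lt.2 h1)]
  · simp [h1]

/-- The exceptional set for the derivative of a truncation. -/
lemma countable_truncation_set (c κ : ℝ) : {r : ℝ | r = c ∨ κ * (r - c) = 1}.Countable := by
  refine Set.Countable.union (countable_singleton c) ?_
  refine Set.Subsingleton.countable fun x hx y hy => ?_
  have hx : κ * (x - c) = 1 := hx
  have hy : κ * (y - c) = 1 := hy
  have hκ : κ ≠ 0 := fun h => by simp [h] at hx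
  have := mul_left_cancel₀ hκ (hx.trans hy.symm)
  linarith

namespace IsRegularSolution
variable {q u p : ℝ → ℝ} (h : IsRegularSolution q u p)
include h

lemma hasDerivAt_truncation {c κ r : ℝ} (hr : 0 < r) (hrc : ¬(r = c ∨ κ * (r - c) = 1)) :
    HasDerivAt (truncation u c κ) (truncationDeriv u p c κ r) r := by
  push Not at hrc
  rcases lt_or_gt_of_ne hrc.1 with h1 | h1
  · rw [truncationDeriv, if_pos h1]
    refine (h.hasDerivAt_u r hr.le).congr_of_eventuallyEq ?_
    filter_upwards [gt_mem_nhds h1] with s hs using truncation_of_le (le_of_lt hs)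
  · rw [truncationDeriv, if_neg (not_lt.2 h1.le)]
    rcases lt_or_gt_of_ne hrc.2 with h2 | h2
    · rw [if_pos h2]
      have h3 : HasDerivAt (fun s => u c * (1 - κ * (s - c))) (-(κ * u c)) r := by
        refine (((((hasDerivAt_id r).sub_const c).const_mul κ).const_sub 1).const_mul
          (u c)).congr_deriv ?_
        ring
      refine h3.congr_of_eventuallyEq ?_
      have h4 : ∀ᶠ s in 𝓝 r, κ * (s - c) < 1 :=
        ContinuousAt.eventually_lt (by fun_prop) continuousAt_const h2
      filter_upwards [lt_mem_nhds h1, h4] with s hs hs'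
      rw [truncation_of_ge (le_of_lt hs), max_eq_right (by linarith)]
    · rw [if_neg (not_lt.2 h2.le)]
      refine (hasDerivAt_const r (0 : ℝ)).congr_of_eventuallyEq ?_
      have h4 : ∀ᶠ s in 𝓝 r, 1 < κ * (s - c) :=
        ContinuousAt.eventually_lt continuousAt_const (by fun_prop) h2
      filter_upwards [lt_mem_nhds h1, h4] with s hs hs'
      exact truncation_eq_zero (le_of_lt hs) (le_of_lt hs')

lemma continuousOn_truncation {c κ : ℝ} (hc : 0 ≤ c) :
    ContinuousOn (truncation u c κ) (Ici 0) := by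
  have h1 : ContinuousOn (fun r => u (min r c)) (Ici 0) :=
    h.continuousOn_u.comp (by fun_prop) (fun r hr => le_min hr hc)
  have h2 : Continuous fun r : ℝ => max 0 (1 - κ * (max r c - c)) := by fun_prop
  exact h1.mul h2.continuousOn

lemma measurable_truncationDeriv {c κ : ℝ} :
    Measurable (fun r => truncationDeriv u p c κ (max r 0)) := by
  have hp : Measurable fun r => p (max r 0) :=
    (h.continuousOn_p.comp_continuous (continuous_id.max continuous_const)
      fun r => mem_Ici.2 (le_max_right _ _)).measurable
  refine Measurable.ite (measurableSet_lt (by fun_prop) (by fun_prop)) hp ?_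
  exact Measurable.ite (measurableSet_lt (by fun_prop) (by fun_prop)) (by fun_prop) (by fun_prop)

lemma abs_u_le {K T r : ℝ} (hK : ∀ r ∈ Icc 0 T, |p r| ≤ K) (hr : r ∈ Icc 0 T) :
    |u r| ≤ K * r := by
  have := (convex_Icc 0 T).norm_image_sub_le_of_norm_hasDerivWithin_le
    (fun x hx => (h.hasDerivAt_u x hx.1).hasDerivWithinAt) hK (left_mem_Icc.2 (hr.1.trans hr.2)) hr
  simpa [h.u_zero, abs_of_nonneg hr.1] using this

/-- `r u' - u = O(r³)`, so that the derivative `(r u' - u) / r²` of `u / r` is bounded. -/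
lemma abs_mul_sub_le {C K T r : ℝ} (hC : ∀ r, |q r| ≤ C) (hK : ∀ r ∈ Icc 0 T, |p r| ≤ K)
    (hr : r ∈ Icc 0 T) : |r * p r - u r| ≤ C * K * r ^ 2 * r := by
  have hC0 : 0 ≤ C := (abs_nonneg _).trans (hC 0)
  have hK0 : 0 ≤ K := (abs_nonneg _).trans (hK r hr)
  have hd : ∀ x ∈ Icc 0 r, HasDerivWithinAt (fun x => x * p x - u x) (-(x * (q x * u x)))
      (Icc 0 r) x := by
    intro x hx
    refine (((hasDerivAt_id x).mul (h.hasDerivAt_p x hx.1)).sub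
      (h.hasDerivAt_u x hx.1)).hasDerivWithinAt.congr_deriv ?_
    simp
  have := (convex_Icc 0 r).norm_image_sub_le_of_norm_hasDerivWithin_le hd
    (C := C * K * r ^ 2) (fun x hx => by
      have h1 := h.abs_u_le hK ⟨hx.1, hx.2.trans hr.2⟩
      rw [norm_neg, Real.norm_eq_abs, abs_mul, abs_mul, abs_of_nonneg hx.1]
      calc x * (|q x| * |u x|) ≤ r * (C * (K * r)) := by
            have := hx.1
            have := hx.2
            have := hr.1
            gcongr
            · exact hC x
            · exact h1.trans (by gcongr)
        _ = _ := by ring) (left_mem_Icc.2 hr.1) (right_mem_Icc.2 hr.1)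
  simpa [h.u_zero, abs_of_nonneg hr.1] using this

/-- The radial function `truncation u c κ r / r` is a trial function. -/
lemma exists_isTrial_truncation {C T c κ : ℝ} (hC : ∀ r, |q r| ≤ C) (hc : 0 < c) (hcT : c ≤ T)
    (hκ : 0 ≤ κ) (hT : 1 ≤ κ * (T - c) ∨ κ = 0) :
    ∃ f g, IsTrial T f g ∧ (∀ r, 0 ≤ r → r * f r = truncation u c κ r) ∧
      ∀ r, 0 < r → f r + r * g r = truncationDeriv u p c κ r := by
  set U := truncation u c κ with hU
  set G := truncationDeriv u p c κ with hG
  have hU0 : U 0 = 0 := by rw [hU, truncation_of_le hc.le, h.u_zero]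
  have hUd0 : HasDerivAt U 1 0 := by
    rw [← h.p_zero]
    refine (h.hasDerivAt_u 0 le_rfl).congr_of_eventuallyEq ?_
    filter_upwards [gt_mem_nhds hc] with s hs using truncation_of_le (le_of_lt hs)
  have hfr : ∀ r, r ≠ 0 → dslope U 0 r = U r / r := fun r hr => by
    rw [dslope_of_ne _ hr, slope_def_field, hU0, sub_zero, sub_zero]
  have hrf : ∀ r, r * dslope U 0 r = U r := by
    intro r
    rcases eq_or_ne r 0 with rfl | hr
    · rw [hU0, zero_mul]
    · rw [hfr r hr]; field_simp
  have hUc := h.continuousOn_truncation (κ := κ) hc.le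
  have hfc : ContinuousOn (dslope U 0) (Ici 0) := by
    intro r hr
    rcases eq_or_ne r 0 with rfl | hr0
    · exact (continuousAt_dslope_same.2 hUd0.differentiableAt).continuousWithinAt
    · exact (continuousWithinAt_dslope_of_ne hr0).2 (hUc r hr)
  set g : ℝ → ℝ := (Ioi 0).indicator fun r => (G (max r 0) - U (max r 0) / r) / r with hg
  have hgr : ∀ r, 0 < r → g r = (G r - U r / r) / r := fun r hr => by
    rw [hg, indicator_of_mem (show r ∈ Ioi (0 : ℝ) from hr), max_eq_left hr.le]
  have hfg : ∀ r, 0 < r → dslope U 0 r + r * g r = G r := fun r hr => by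
    rw [hfr r hr.ne', hgr r hr]
    field_simp
    ring
  refine ⟨dslope U 0, g, ⟨hfc, ?_, ?_, ?_, ?_, ?_⟩, fun r _ => hrf r, hfg⟩
  · refine ⟨_, countable_truncation_set c κ, fun r hr hrD => ?_⟩
    have h1 : HasDerivAt (fun r => U r / r) ((G r * r - U r * 1) / r ^ 2) r :=
      (h.hasDerivAt_truncation hr hrD).div (hasDerivAt_id r) hr.ne'
    have h2 : (G r * r - U r * 1) / r ^ 2 = g r := by rw [hgr r hr]; field_simp
    rw [h2] at h1
    refine h1.congr_of_eventuallyEq ?_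
    filter_upwards [lt_mem_nhds hr] with s hs using hfr s (ne_of_gt hs)
  · refine Measurable.indicator ?_ measurableSet_Ioi
    have hUm : Measurable fun r => U (max r 0) :=
      (hUc.comp_continuous (continuous_id.max continuous_const)
        fun r => mem_Ici.2 (le_max_right _ _)).measurable
    have hGm : Measurable fun r => G (max r 0) := h.measurable_truncationDeriv
    exact (hGm.sub (hUm.div measurable_id)).div measurable_id
  · obtain ⟨K, hK⟩ := isCompact_Icc.exists_bound_of_continuousOn
      (h.continuousOn_p.mono (Icc_subset_Ici_self : Icc 0 c ⊆ Ici 0))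
    have hC0 : 0 ≤ C := (abs_nonneg _).trans (hC 0)
    have hK1 : 1 ≤ K := by simpa [h.p_zero] using hK 0 ⟨le_rfl, hc.le⟩
    have hK0 : 0 ≤ K := zero_le_one.trans hK1
    have hUle : ∀ r, 0 ≤ r → |U r| ≤ K * r := by
      intro r hr
      rcases le_total r c with hrc | hrc
      · rw [hU, truncation_of_le hrc]; exact h.abs_u_le hK ⟨hr, hrc⟩
      · rw [hU, truncation_of_ge hrc, abs_mul]
        have h1 := h.abs_u_le hK ⟨hc.le, le_rfl⟩
        have h2 : |max 0 (1 - κ * (r - c))| ≤ 1 := by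
          rw [abs_of_nonneg (le_max_left _ _)]
          apply max_le zero_le_one
          have : 0 ≤ κ * (r - c) := mul_nonneg hκ (by linarith)
          linarith
        calc |u c| * |max 0 (1 - κ * (r - c))| ≤ (K * c) * 1 := by gcongr
          _ ≤ K * r := by rw [mul_one]; gcongr
    have hfle : ∀ r, 0 ≤ r → |dslope U 0 r| ≤ K := by
      intro r hr
      rcases hr.eq_or_lt with rfl | hr
      · rw [dslope_same, hUd0.deriv]; simpa using hK1
      · rw [hfr r hr.ne', abs_div, abs_of_pos hr, div_le_iff₀ hr]; exact hUle r hr.le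
    have hgle : ∀ r, 0 ≤ r → |g r| ≤ C * K * c + (κ * (K * c) + K) / c := by
      intro r hr
      have hp1 : 0 ≤ C * K * c := by positivity
      have hp2 : 0 ≤ (κ * (K * c) + K) / c := by positivity
      rcases hr.eq_or_lt with rfl | hr
      · rw [hg, indicator_of_notMem (by simp), abs_zero]; positivity
      · rcases lt_or_ge r c with hrc | hrc
        · have h1 : g r = (r * p r - u r) / r ^ 2 := by
            rw [hgr r hr, hG, hU, truncation_of_le hrc.le, truncationDeriv, if_pos hrc]
            field_simp
          have h2 := h.abs_mul_sub_le hC hK ⟨hr.le, hrc.le⟩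
          have h3 : |g r| ≤ C * K * r := by
            rw [h1, abs_div, abs_of_pos (by positivity : 0 < r ^ 2), div_le_iff₀ (by positivity)]
            linarith
          have h4 : C * K * r ≤ C * K * c := by gcongr
          linarith
        · have h1 : g r = (G r - dslope U 0 r) / r := by rw [hgr r hr, hfr r hr.ne']
          have h2 : |G r| ≤ κ * (K * c) := by
            have h3 := h.abs_u_le hK ⟨hc.le, le_rfl⟩
            rw [hG, truncationDeriv, if_neg (not_lt.2 hrc)]
            split_ifs
            · rw [abs_neg, abs_mul, abs_of_nonneg hκ]; gcongr
            · rw [abs_zero]; positivity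
          have h3 : |g r| ≤ (κ * (K * c) + K) / c := by
            rw [h1, abs_div, abs_of_pos hr]
            gcongr
            exact (abs_sub _ _).trans (add_le_add h2 (hfle r hr.le))
          linarith
    refine ⟨max K (C * K * c + (κ * (K * c) + K) / c), fun r hr =>
      ⟨(hfle r hr).trans (le_max_left _ _), (hgle r hr).trans (le_max_right _ _)⟩⟩
  · intro r hr
    rw [hrf, hrf, hU, truncation_of_ge (hcT.trans hr), truncation_of_ge hcT]
    rcases hT with hT | hT
    · have : κ * (T - c) ≤ κ * (r - c) := by gcongr
      rw [max_eq_left (by linarith), max_eq_left (by linarith)]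
    · simp [hT]
  · intro r hr
    rw [hfg r ((hc.trans_le hcT).trans hr), hG]
    apply truncationDeriv_eq_zero (hcT.trans hr.le)
    rcases hT with hT | hT
    · left
      have : κ * (T - c) ≤ κ * (r - c) := by gcongr
      linarith
    · exact Or.inr hT

lemma intervalIntegrable_truncation {q₀ : ℝ → ℝ} (hq : Continuous q₀) {c d κ l a b : ℝ} (ha : 0 ≤ a)
    (hab : a ≤ b) (hc : 0 ≤ c) (hd : 0 ≤ d) : IntervalIntegrable (fun r =>
      truncationDeriv u p c κ r * truncationDeriv u p d l r -
        q₀ r * truncation u c κ r * truncation u d l r) volume a b := by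
  have hsub : uIcc a b ⊆ Ici 0 := by rw [uIcc_of_le hab]; exact fun r hr => ha.trans hr.1
  have hUc := (h.continuousOn_truncation (κ := κ) hc).mono hsub
  have hUd := (h.continuousOn_truncation (κ := l) hd).mono hsub
  have hpb : ∀ c κ : ℝ, 0 ≤ c → ∃ B, ∀ r ∈ Icc 0 b, |truncationDeriv u p c κ r| ≤ B := by
    intro c κ _
    obtain ⟨K, hK⟩ := isCompact_Icc.exists_bound_of_continuousOn
      (h.continuousOn_p.mono (Icc_subset_Ici_self : Icc 0 b ⊆ Ici 0))
    refine ⟨max K |κ * u c|, fun r hr => ?_⟩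
    unfold truncationDeriv
    split_ifs
    · exact (hK r hr).trans (le_max_left _ _)
    · rw [abs_neg]; exact le_max_right _ _
    · rw [abs_zero]; exact (abs_nonneg _).trans (le_max_right _ _)
  refine IntervalIntegrable.sub ?_ (ContinuousOn.intervalIntegrable (by fun_prop))
  obtain ⟨B₁, hB₁⟩ := hpb c κ hc
  obtain ⟨B₂, hB₂⟩ := hpb d l hd
  have hm : IntervalIntegrable (fun r => truncationDeriv u p c κ (max r 0) *
      truncationDeriv u p d l (max r 0)) volume a b := by
    refine (intervalIntegrable_const (c := B₁ * B₂)).mono_fun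
      (h.measurable_truncationDeriv.mul h.measurable_truncationDeriv).aestronglyMeasurable ?_
    refine (ae_restrict_iff' measurableSet_uIoc).2 (Eventually.of_forall fun r hr => ?_)
    rw [uIoc_of_le hab] at hr
    have hr0 : 0 ≤ r := ha.trans hr.1.le
    have h1 := hB₁ r ⟨hr0, hr.2⟩
    have h2 := hB₂ r ⟨hr0, hr.2⟩
    simp only [max_eq_left hr0, norm_mul, Real.norm_eq_abs]
    exact mul_le_mul (h1.trans (le_abs_self _)) (h2.trans (le_abs_self _)) (abs_nonneg _)
      (abs_nonneg _)
  refine hm.congr fun r hr => ?_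
  have hr0 : 0 ≤ r := hsub (uIoc_subset_uIcc hr)
  simp only [max_eq_left hr0]

/-- Testing the equation with a truncation. -/
lemma integral_truncation_mul (hq : Continuous q) {c κ b : ℝ} (hc : 0 ≤ c) (hb : 0 ≤ b) :
    ∫ r in (0 : ℝ)..b, (truncationDeriv u p c κ r * p r - q r * truncation u c κ r * u r) =
      truncation u c κ b * p b := by
  have hint := h.intervalIntegrable_truncation hq (c := c) (κ := κ) (d := b + 1) (l := 0)
    le_rfl hb hc (by linarith)
  have hcongr : ∀ r, r ≤ b → truncationDeriv u p c κ r * truncationDeriv u p (b + 1) 0 r -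
        q r * truncation u c κ r * truncation u (b + 1) 0 r =
      truncationDeriv u p c κ r * p r - q r * truncation u c κ r * u r := by
    intro r hr
    rw [truncation_of_le (by linarith : r ≤ b + 1), truncationDeriv.eq_def u p (b + 1),
      if_pos (by linarith)]
  have hint' : IntervalIntegrable (fun r =>
      truncationDeriv u p c κ r * p r - q r * truncation u c κ r * u r) volume 0 b :=
    hint.congr fun r hr => hcongr r (by rw [uIoc_of_le hb] at hr; exact hr.2)
  rw [integral_eq_of_hasDerivAt_off_countable_of_le (fun r => truncation u c κ r * p r) _ hb
    (countable_truncation_set c κ)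
    (((h.continuousOn_truncation hc).mul h.continuousOn_p).mono Icc_subset_Ici_self)
    (fun r hr => by
      refine ((h.hasDerivAt_truncation hr.1.1 hr.2).mul
        (h.hasDerivAt_p r hr.1.1.le)).congr_deriv ?_
      ring) hint']
  simp [truncation_of_le hc, h.u_zero]

/-- Truncations at different gaps are orthogonal for the form: the second one agrees with the
solution `u` on the support of the first one. -/
lemma integral_truncation_truncation_eq_zero (hq : Continuous q) {c d κ l T : ℝ} (hc : 0 ≤ c)
    (hcd : c ≤ d) (hdT : d ≤ T) (h1 : 1 ≤ κ * (d - c)) (hκ : 0 ≤ κ) :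
    ∫ r in (0 : ℝ)..T, (truncationDeriv u p c κ r * truncationDeriv u p d l r -
      q r * truncation u c κ r * truncation u d l r) = 0 := by
  have hd : 0 ≤ d := hc.trans hcd
  rw [← intervalIntegral.integral_add_adjacent_intervals
    (h.intervalIntegrable_truncation hq le_rfl hd hc hd)
    (h.intervalIntegrable_truncation hq hd hdT hc hd)]
  have e1 : ∫ r in (0 : ℝ)..d, (truncationDeriv u p c κ r * truncationDeriv u p d l r -
      q r * truncation u c κ r * truncation u d l r) = 0 := by
    have h2 := h.integral_truncation_mul hq (κ := κ) hc hd
    rw [truncation_eq_zero hcd h1, zero_mul] at h2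
    refine Eq.trans ?_ h2
    apply intervalIntegral.integral_congr_ae
    filter_upwards [show ∀ᵐ x : ℝ, x ≠ d by simp [ae_iff]] with r hrd hr
    rw [uIoc_of_le hd] at hr
    rw [truncation_of_le hr.2, truncationDeriv.eq_def u p d,
      if_pos (lt_of_le_of_ne hr.2 hrd)]
  have e2 : ∫ r in d..T, (truncationDeriv u p c κ r * truncationDeriv u p d l r -
      q r * truncation u c κ r * truncation u d l r) = 0 := by
    rw [intervalIntegral.integral_congr_ae (g := fun _ => 0)]
    · simp
    · refine Eventually.of_forall fun r hr => ?_
      rw [uIoc_of_le hdT] at hr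
      have h3 : 1 ≤ κ * (r - c) := h1.trans (by gcongr; exact hr.1.le)
      rw [truncationDeriv_eq_zero (hcd.trans hr.1.le) (Or.inl h3),
        truncation_eq_zero (hcd.trans hr.1.le) h3]
      simp
  rw [e1, e2, add_zero]

/-- The form at a truncation: integrate by parts up to `c`; beyond `c` drop the potential and
integrate `U'² = -κ u(c) U'`. -/
lemma integral_truncation_self_le (hq : Continuous q) (hq0 : ∀ r, 0 ≤ q r) {c κ T : ℝ}
    (hc : 0 ≤ c) (hcT : c ≤ T) (hκ : 0 ≤ κ) :
    ∫ r in (0 : ℝ)..T, (truncationDeriv u p c κ r * truncationDeriv u p c κ r -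
      q r * truncation u c κ r * truncation u c κ r) ≤ u c * (p c + κ * u c) := by
  rw [← intervalIntegral.integral_add_adjacent_intervals
    (h.intervalIntegrable_truncation hq le_rfl hc hc hc)
    (h.intervalIntegrable_truncation hq hc hcT hc hc)]
  have e1 : ∫ r in (0 : ℝ)..c, (truncationDeriv u p c κ r * truncationDeriv u p c κ r -
      q r * truncation u c κ r * truncation u c κ r) = u c * p c := by
    have h2 := h.integral_truncation_mul hq (κ := κ) hc hc
    rw [truncation_of_le le_rfl] at h2
    refine Eq.trans ?_ h2
    apply intervalIntegral.integral_congr_ae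
    filter_upwards [show ∀ᵐ x : ℝ, x ≠ c by simp [ae_iff]] with r hrd hr
    rw [uIoc_of_le hc] at hr
    rw [truncation_of_le hr.2, truncationDeriv.eq_def u p c,
      if_pos (lt_of_le_of_ne hr.2 hrd)]
  -- on `[c, T]`, `U'² ≤ -κ u(c) U'`
  have i0 := h.intervalIntegrable_truncation continuous_const (q₀ := fun _ => 0) (κ := κ) (l := κ)
    hc hcT hc hc
  have hGsq : ∀ r, c < r → truncationDeriv u p c κ r * truncationDeriv u p c κ r =
      -(κ * u c) * truncationDeriv u p c κ r := by
    intro r hr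
    rw [truncationDeriv, if_neg (not_lt.2 hr.le)]
    split_ifs <;> ring
  have e2 : ∫ r in c..T, (truncationDeriv u p c κ r * truncationDeriv u p c κ r -
      q r * truncation u c κ r * truncation u c κ r) ≤
      ∫ r in c..T, -(κ * u c) * truncationDeriv u p c κ r := by
    have i1 : IntervalIntegrable (fun r => -(κ * u c) * truncationDeriv u p c κ r) volume c T := by
      refine i0.congr fun r hr => ?_
      rw [uIoc_of_le hcT] at hr
      simp only [zero_mul, sub_zero]
      exact hGsq r hr.1
    apply intervalIntegral.integral_mono_on_of_le_Ioo hcT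
      (h.intervalIntegrable_truncation hq hc hcT hc hc) i1
    intro r hr
    rw [hGsq r hr.1]
    have h3 : 0 ≤ q r * (truncation u c κ r * truncation u c κ r) :=
      mul_nonneg (hq0 r) (mul_self_nonneg _)
    linarith
  have e3 : κ * u c * (truncation u c κ T - truncation u c κ c) =
      ∫ r in c..T, κ * u c * truncationDeriv u p c κ r := by
    rw [intervalIntegral.integral_const_mul]
    rcases eq_or_ne (κ * u c) 0 with h0 | h0
    · rw [h0, zero_mul, zero_mul]
    congr 1
    have i1 : IntervalIntegrable (fun r => truncationDeriv u p c κ r) volume c T := by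
      have i2 := i0.const_mul (-(κ * u c))⁻¹
      refine i2.congr fun r hr => ?_
      rw [uIoc_of_le hcT] at hr
      simp only [zero_mul, sub_zero]
      rw [hGsq r hr.1, ← mul_assoc, inv_mul_cancel₀ (neg_ne_zero.2 h0), one_mul]
    rw [integral_eq_of_hasDerivAt_off_countable_of_le (truncation u c κ) _ hcT
      (countable_truncation_set c κ)
      ((h.continuousOn_truncation hc).mono fun r hr => hc.trans hr.1)
      (fun r hr => h.hasDerivAt_truncation (hc.trans_lt hr.1.1) hr.2) i1]
  simp only [neg_mul, intervalIntegral.integral_neg] at e2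
  rw [← e3, truncation_of_ge hcT, truncation_of_ge le_rfl] at e2
  have h4 : 0 ≤ κ * (u c * u c) * max 0 (1 - κ * (T - c)) := by
    have := mul_self_nonneg (u c)
    positivity
  simp only [sub_self, mul_zero, sub_zero, max_eq_right zero_le_one, mul_one] at e2
  rw [e1]
  linarith

end IsRegularSolution

/-- Where `u` changes sign, the form at a suitable truncation is negative: `(u(r) / (b - r))²`
decreases to zero at a zero of `u`, hence has a negative derivative somewhere. -/
lemma IsRegularSolution.exists_mul_neg {q u p : ℝ → ℝ} (h : IsRegularSolution q u p) {a b : ℝ}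
    (ha : 0 ≤ a) (hab : a < b) (hu : u a * u b < 0) :
    ∃ c ∈ Ioo a b, u c * (p c + (b - c)⁻¹ * u c) < 0 := by
  obtain ⟨r₁, hr₁, hur₁⟩ : ∃ r ∈ Ioo a b, u r = 0 := by
    have hc : ContinuousOn u (Icc a b) := h.continuousOn_u.mono fun r hr => ha.trans hr.1
    rcases mul_neg_iff.1 hu with ⟨h1, h2⟩ | ⟨h1, h2⟩
    · exact intermediate_value_Ioo' hab.le hc ⟨h2, h1⟩
    · exact intermediate_value_Ioo hab.le hc ⟨h1, h2⟩
  have hd : ∀ r ∈ Icc a r₁, HasDerivAt (fun r => (u r / (b - r)) ^ 2)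
      (2 * (u r * (p r + (b - r)⁻¹ * u r)) / (b - r) ^ 2) r := by
    intro r hr
    have hbr : b - r ≠ 0 := by linarith [hr.2, hr₁.2]
    refine (((h.hasDerivAt_u r (ha.trans hr.1)).div ((hasDerivAt_id r).const_sub b)
      hbr).pow 2).congr_deriv ?_
    simp
    field_simp
  obtain ⟨c, hc, hc'⟩ := exists_hasDerivAt_eq_slope _ _ hr₁.1
    (fun r hr => (hd r hr).continuousAt.continuousWithinAt)
    (fun r hr => hd r (Ioo_subset_Icc_self hr))
  refine ⟨c, ⟨hc.1, hc.2.trans hr₁.2⟩, ?_⟩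
  have hbc : 0 < b - c := by linarith [hc.2, hr₁.2]
  have hua : u a ≠ 0 := fun h0 => by simp [h0] at hu
  have h1 : 2 * (u c * (p c + (b - c)⁻¹ * u c)) / (b - c) ^ 2 < 0 := by
    rw [hc', hur₁, zero_div, zero_pow two_ne_zero, zero_sub]
    apply div_neg_of_neg_of_pos _ (sub_pos.2 hr₁.1)
    have hba : b - a ≠ 0 := (sub_pos.2 hab).ne'
    exact neg_neg_of_pos (by positivity)
  rw [div_neg_iff] at h1
  rcases h1 with ⟨-, h1⟩ | ⟨h1, -⟩
  · exact absurd h1 (not_lt.2 (sq_nonneg _))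
  · linarith

/-- A family on whose nontrivial linear combinations the form is negative spans a subspace of full
dimension. -/
lemma card_le_radialIndex {q : ℝ → ℝ} {ι : Type*} [Fintype ι] (P : ι → FunctionGradientPairs)
    (hmem : ∀ a : ι → ℝ, ∑ i, a i • P i ∈ radialHomSobolev)
    (hneg : ∀ a : ι → ℝ, a ≠ 0 → radialForm q (∑ i, a i • P i) < 0) :
    (Fintype.card ι : ℕ∞) ≤ radialIndex q := by
  have h0 : radialForm q 0 = 0 := by simp [radialForm]
  have hli : LinearIndependent ℝ P := by
    rw [Fintype.linearIndependent_iff]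
    intro a ha
    by_contra hcon
    have := hneg a fun h => hcon fun i => by rw [h]; rfl
    rw [ha, h0] at this
    exact lt_irrefl _ this
  rw [← finrank_span_eq_card hli]
  have hfin : FiniteDimensional ℝ (Submodule.span ℝ (range P)) :=
    FiniteDimensional.span_of_finite ℝ (finite_range P)
  refine le_iSup_of_le (Submodule.span ℝ (range P)) (le_iSup_of_le hfin
    (le_iSup_of_le (fun p hp => ?_) le_rfl))
  obtain ⟨a, rfl⟩ := (Submodule.mem_span_range_iff_exists_fun ℝ).1 hp
  refine ⟨hmem a, fun hne => hneg a fun h => hne ?_⟩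
  simp [h]

lemma integral_sum_sq_sub {ι : Type*} [Fintype ι] {T : ℝ} {q : ℝ → ℝ} (G U : ι → ℝ → ℝ) (a : ι → ℝ)
    (hint : ∀ i j, IntervalIntegrable (fun r => G i r * G j r - q r * U i r * U j r) volume 0 T)
    (hoff : ∀ i j, i ≠ j → ∫ r in (0 : ℝ)..T, (G i r * G j r - q r * U i r * U j r) = 0) :
    ∫ r in (0 : ℝ)..T, ((∑ i, a i * G i r) ^ 2 - q r * (∑ i, a i * U i r) ^ 2) =
      ∑ i, a i ^ 2 * ∫ r in (0 : ℝ)..T, (G i r * G i r - q r * U i r * U i r) := by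
  have h1 : ∀ r, (∑ i, a i * G i r) ^ 2 - q r * (∑ i, a i * U i r) ^ 2 =
      ∑ i, ∑ j, a i * a j * (G i r * G j r - q r * U i r * U j r) := by
    intro r
    rw [sq, sq, Finset.sum_mul_sum, Finset.sum_mul_sum, Finset.mul_sum, ← Finset.sum_sub_distrib]
    refine Finset.sum_congr rfl fun i _ => ?_
    rw [Finset.mul_sum, ← Finset.sum_sub_distrib]
    exact Finset.sum_congr rfl fun j _ => by ring
  simp_rw [h1]
  have hint2 : ∀ i, IntervalIntegrable (fun r => ∑ j, a i * a j *
      (G i r * G j r - q r * U i r * U j r)) volume 0 T := fun i => by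
    have := IntervalIntegrable.sum Finset.univ fun j _ => (hint i j).const_mul (a i * a j)
    refine this.congr fun r _ => ?_
    simp [Finset.sum_apply]
  rw [intervalIntegral.integral_finsetSum fun i _ => hint2 i]
  refine Finset.sum_congr rfl fun i _ => ?_
  rw [intervalIntegral.integral_finsetSum fun j _ => (hint i j).const_mul _]
  simp_rw [intervalIntegral.integral_const_mul]
  rw [Finset.sum_eq_single i (fun j _ hj => by rw [hoff i j hj.symm, mul_zero]) (by simp)]
  ring

/-- The truncations of `u` at its sign changes are orthogonal for the form, which is negative at
each of them. -/
theorem le_radialIndex {q u p : ℝ → ℝ} {C : ℝ} {t : ℕ → ℝ} {m : ℕ} (hq : Continuous q)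
    (hq0 : ∀ r, 0 ≤ q r) (hqC : ∀ r, q r ≤ C) (hqT : ∀ r, t m ≤ r → q r = 0)
    (hreg : IsRegularSolution q u p) (ht : IsMesh C t) :
    ((signChanges u p t m).card : ℕ∞) ≤ radialIndex q := by
  set S := signChanges u p t m with hS
  set T := t m with hTdef
  have hT : 0 < T := ht.pos' m
  have hSm : ∀ i ∈ S, i ≤ m := fun i hi => by
    have := (Finset.mem_filter.1 hi).1
    rw [Finset.mem_range] at this
    omega
  -- in a gap `(t i, t (i + 1))`, cut at `c` so as to reach zero at `t (i + 1)`; in the last gap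
  -- continue by a constant
  have hex : ∀ i : S, ∃ c κ : ℝ, t i ≤ c ∧ c ≤ T ∧ 0 ≤ κ ∧
      ((i : ℕ) < m → c ≤ t (i + 1) ∧ 1 ≤ κ * (t (i + 1) - c)) ∧ ((i : ℕ) = m → κ = 0) ∧
      u c * (p c + κ * u c) < 0 := by
    rintro ⟨i, hi⟩
    rcases (hSm i hi).eq_or_lt with rfl | him
    · refine ⟨t i, 0, le_rfl, le_rfl, le_rfl, fun h => absurd h (lt_irrefl _), fun _ => rfl, ?_⟩
      have := last_mem_signChanges.1 hi
      linarith
    · obtain ⟨c, hc, hneg⟩ := hreg.exists_mul_neg (ht.pos' i).le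
        (ht.strictMono (Nat.lt_succ_self i)) ((mem_signChanges_of_lt him).1 hi)
      have hc2 : 0 < t (i + 1) - c := sub_pos.2 hc.2
      refine ⟨c, (t (i + 1) - c)⁻¹, hc.1.le, hc.2.le.trans (ht.strictMono.monotone him),
        (inv_pos.2 hc2).le, fun _ => ⟨hc.2.le, (inv_mul_cancel₀ hc2.ne').ge⟩,
        fun h => absurd h him.ne, hneg⟩
  choose c κ hc hcT hκ hlt hlast hneg using hex
  have hc0 : ∀ i, 0 < c i := fun i => (ht.pos' i).trans_le (hc i)
  have habs : ∀ r, |q r| ≤ C := fun r => by rw [abs_of_nonneg (hq0 r)]; exact hqC r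
  have htrial : ∀ i, ∃ f g, IsTrial T f g ∧
      (∀ r, 0 ≤ r → r * f r = truncation u (c i) (κ i) r) ∧
      ∀ r, 0 < r → f r + r * g r = truncationDeriv u p (c i) (κ i) r := by
    intro i
    refine hreg.exists_isTrial_truncation habs (hc0 i) (hcT i) (hκ i) ?_
    rcases (hSm i i.2).eq_or_lt with him | him
    · exact Or.inr (hlast i him)
    · left
      have h1 : t (i + 1) ≤ T := ht.strictMono.monotone him
      have h2 := hκ i
      exact (hlt i him).2.trans (by gcongr)
  choose f g hfg hf hg using htrial
  choose Q hQ1 hQ2 using fun i => (hfg i).exists_pair hT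
  have hsum := fun a : S → ℝ => IsTrial.sum hfg a
  have hs1 : ∀ a : S → ℝ, ∀ᵐ x, (∑ i, a i • Q i).1 x = ∑ i, a i * f i ‖x‖ := by
    intro a
    have h1 := coeFn_sum_smul a (fun i => (Q i).1)
    have h2 : (∑ i, a i • Q i).1 = ∑ i, a i • (Q i).1 := by simp [Prod.fst_sum]
    rw [h2]
    filter_upwards [h1, ae_all_iff.2 hQ1] with x h3 h4
    rw [h3]
    exact Finset.sum_congr rfl fun i _ => by rw [h4 i, smul_eq_mul]
  have hs2 : ∀ a : S → ℝ, ∀ᵐ x, (∑ i, a i • Q i).2 x = ((∑ i, a i * g i ‖x‖) / ‖x‖) • x := by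
    intro a
    have h1 := coeFn_sum_smul a (fun i => (Q i).2)
    have h2 : (∑ i, a i • Q i).2 = ∑ i, a i • (Q i).2 := by simp [Prod.snd_sum]
    rw [h2]
    filter_upwards [h1, ae_all_iff.2 hQ2] with x h3 h4
    rw [h3, Finset.sum_div, Finset.sum_smul]
    exact Finset.sum_congr rfl fun i _ => by rw [h4 i, smul_smul, mul_div_assoc]
  have hlt' : ∀ i j : S, (i : ℕ) < j → c i ≤ c j ∧ 1 ≤ κ i * (c j - c i) := by
    intro i j hij
    have h1 := hlt i (hij.trans_le (hSm j j.2))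
    have h2 : t (i + 1) ≤ c j := (ht.strictMono.monotone hij).trans (hc j)
    have h3 := hκ i
    exact ⟨h1.1.trans h2, h1.2.trans (by gcongr)⟩
  rw [← Fintype.card_coe S]
  refine card_le_radialIndex Q (fun a => (hsum a).mem_radialHomSobolev (hs1 a) (hs2 a))
    fun a ha => ?_
  refine ((hsum a).radialForm_le hq hq0 hqC hT hqT (hs1 a) (hs2 a)).trans_lt ?_
  have hcongr : ∫ r in (0 : ℝ)..T, ((∑ i, a i * f i r + r * ∑ i, a i * g i r) ^ 2 -
      q r * (r * ∑ i, a i * f i r) ^ 2) = ∫ r in (0 : ℝ)..T,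
      ((∑ i, a i * truncationDeriv u p (c i) (κ i) r) ^ 2 -
        q r * (∑ i, a i * truncation u (c i) (κ i) r) ^ 2) := by
    refine intervalIntegral.integral_congr_ae (Eventually.of_forall fun r hr => ?_)
    rw [uIoc_of_le hT.le] at hr
    have e1 : ∑ i, a i * f i r + r * ∑ i, a i * g i r =
        ∑ i, a i * truncationDeriv u p (c i) (κ i) r := by
      rw [Finset.mul_sum, ← Finset.sum_add_distrib]
      exact Finset.sum_congr rfl fun i _ => by rw [← hg i r hr.1]; ring
    have e2 : r * ∑ i, a i * f i r = ∑ i, a i * truncation u (c i) (κ i) r := by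
      rw [Finset.mul_sum]
      exact Finset.sum_congr rfl fun i _ => by rw [← hf i r hr.1.le]; ring
    rw [e1, e2]
  rw [hcongr, integral_sum_sq_sub]
  · have hle := fun i => hreg.integral_truncation_self_le hq hq0 (hc0 i).le (hcT i) (hκ i)
    obtain ⟨k, hk⟩ := Function.ne_iff.1 ha
    refine mul_neg_of_pos_of_neg (by positivity)
      (Finset.sum_neg' (fun i _ => ?_) ⟨k, Finset.mem_univ k, ?_⟩)
    · exact mul_nonpos_of_nonneg_of_nonpos (sq_nonneg _) ((hle i).trans (hneg i).le)
    · exact mul_neg_of_pos_of_neg (sq_pos_of_ne_zero hk) ((hle k).trans_lt (hneg k))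
  · exact fun i j => hreg.intervalIntegrable_truncation hq le_rfl hT.le (hc0 i).le (hc0 j).le
  · intro i j hij
    rcases lt_or_gt_of_ne (fun h => hij (Subtype.ext h) : (i : ℕ) ≠ j) with hij | hij
    · exact hreg.integral_truncation_truncation_eq_zero hq (hc0 i).le (hlt' i j hij).1 (hcT j)
        (hlt' i j hij).2 (hκ i)
    · refine Eq.trans ?_ (hreg.integral_truncation_truncation_eq_zero (l := κ i) hq (hc0 j).le
        (hlt' j i hij).1 (hcT i) (hlt' j i hij).2 (hκ j))
      congr 1
      ext r
      ring

/-- Sturm oscillation: the Morse index on radial functions is the number of sign changes of the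
regular solution along a fine mesh and beyond its last node. -/
theorem radialIndex_eq {q u p : ℝ → ℝ} {C : ℝ} {t : ℕ → ℝ} {m : ℕ} (hq : Continuous q)
    (hq0 : ∀ r, 0 ≤ q r) (hqC : ∀ r, q r ≤ C) (hqT : ∀ r, t m ≤ r → q r = 0)
    (hreg : IsRegularSolution q u p) (ht : IsMesh C t) (hne : ∀ i ≤ m, u (t i) ≠ 0) :
    radialIndex q = ((signChanges u p t m).card : ℕ∞) :=
  le_antisymm (radialIndex_le hq hq0 hqC hqT hreg ht hne) (le_radialIndex hq hq0 hqC hqT hreg ht)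

/-! ### The enthalpy and its inverse -/

lemma Fplus_nonneg (P : ℝ → ℝ) (s : ℝ) : 0 ≤ Fplus P s := by
  unfold Fplus
  split_ifs with hs
  · exact hs.choose_spec.1.le
  · exact le_rfl

namespace IsPressureLaw
variable {P : ℝ → ℝ} {γ₀ K : ℝ} (h : IsPressureLaw P γ₀ K)
include h

lemma continuousOn_deriv : ContinuousOn (deriv P) (Ioi 0) :=
  h.contDiffOn.continuousOn_deriv_of_isOpen isOpen_Ioi le_rfl

/-- `P'(t) / t = O(t^{γ₀ - 2})`, which is integrable at `0` since `γ₀ > 1`. -/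
lemma exists_deriv_le : ∃ δ > 0, ∀ t ∈ Ioc 0 δ, deriv P t ≤ 2 * K * t ^ (γ₀ - 1) := by
  have hK := h.const_pos
  have h1 : ∀ᶠ s in 𝓝[>] (0 : ℝ), s ^ (1 - γ₀) * deriv P s ∈ Iio (2 * K) :=
    h.tendsto_zero (Iio_mem_nhds (by linarith))
  obtain ⟨δ, hδ, hs⟩ := mem_nhdsGT_iff_exists_Ioc_subset.1 h1
  refine ⟨δ, hδ, fun t ht => ?_⟩
  have h2 : t ^ (1 - γ₀) * deriv P t < 2 * K := hs ht
  have h4 : t ^ (γ₀ - 1) * t ^ (1 - γ₀) = 1 := by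
    rw [← Real.rpow_add ht.1]; simp
  have h5 : deriv P t = t ^ (γ₀ - 1) * (t ^ (1 - γ₀) * deriv P t) := by
    rw [← mul_assoc, h4, one_mul]
  have h6 : 0 < t ^ (γ₀ - 1) := Real.rpow_pos_of_pos ht.1 _
  rw [h5, mul_comm (2 * K)]
  gcongr

lemma continuousOn_deriv_div : ContinuousOn (fun t => deriv P t / t) (Ioi 0) :=
  h.continuousOn_deriv.div continuousOn_id fun _ ht => ne_of_gt ht

lemma intervalIntegrable_deriv_div {a b : ℝ} (ha : 0 ≤ a) (hb : 0 ≤ b) :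
    IntervalIntegrable (fun t => deriv P t / t) volume a b := by
  obtain ⟨δ, hδ, hbd⟩ := h.exists_deriv_le
  have h1 : IntervalIntegrable (fun t => deriv P t / t) volume 0 δ := by
    have h2 : IntervalIntegrable (fun t : ℝ => 2 * K * t ^ (γ₀ - 2)) volume 0 δ :=
      (intervalIntegral.intervalIntegrable_rpow' (by linarith [h.lower])).const_mul _
    refine h2.mono_fun ?_ ?_
    · rw [uIoc_of_le hδ.le]
      exact (h.continuousOn_deriv_div.mono Ioc_subset_Ioi_self).aestronglyMeasurable
        measurableSet_Ioc
    · refine (ae_restrict_iff' measurableSet_uIoc).2 (Eventually.of_forall fun t ht => ?_)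
      rw [uIoc_of_le hδ.le] at ht
      have h3 := hbd t ht
      have h4 := h.deriv_pos t ht.1
      refine le_trans ?_ (le_abs_self _)
      simp only [Real.norm_eq_abs]
      rw [abs_of_pos (div_pos h4 ht.1), div_le_iff₀ ht.1, mul_assoc]
      have h5 : t ^ (γ₀ - 2) * t = t ^ (γ₀ - 1) := by
        rw [← Real.rpow_add_one ht.1.ne']; congr 1; ring
      rwa [h5]
  have h2 : ∀ c, 0 ≤ c → IntervalIntegrable (fun t => deriv P t / t) volume 0 c := by
    intro c hc
    rcases hc.eq_or_lt with rfl | hc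
    · exact IntervalIntegrable.refl
    refine h1.trans (ContinuousOn.intervalIntegrable (h.continuousOn_deriv_div.mono fun x hx => ?_))
    exact (lt_min hδ hc).trans_le hx.1
  exact (h2 a ha).symm.trans (h2 b hb)

lemma hasStrictDerivAt_enthalpyDeriv {ρ : ℝ} (hρ : 0 < ρ) :
    HasStrictDerivAt (enthalpyDeriv P) (deriv P ρ / ρ) ρ := by
  refine intervalIntegral.integral_hasStrictDerivAt_right
    (h.intervalIntegrable_deriv_div le_rfl hρ.le) ?_ ?_
  · exact h.continuousOn_deriv_div.stronglyMeasurableAtFilter isOpen_Ioi ρ hρ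
  · exact h.continuousOn_deriv_div.continuousAt (Ioi_mem_nhds hρ)

omit h in
lemma enthalpyDeriv_zero : enthalpyDeriv P 0 = 0 := by simp [enthalpyDeriv]

lemma continuousOn_enthalpyDeriv : ContinuousOn (enthalpyDeriv P) (Ici 0) := by
  intro ρ hρ
  have hρ : 0 ≤ ρ := hρ
  have h1 := intervalIntegral.continuousOn_primitive_interval'
    (h.intervalIntegrable_deriv_div le_rfl (by linarith : 0 ≤ ρ + 1)) left_mem_uIcc
  rw [uIcc_of_le (by linarith)] at h1
  refine (h1 ρ ⟨hρ, by linarith⟩).mono_of_mem_nhdsWithin ?_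
  filter_upwards [self_mem_nhdsWithin, mem_nhdsWithin_of_mem_nhds
    (Iic_mem_nhds (by linarith : ρ < ρ + 1))] with x hx hx' using ⟨hx, hx'⟩

lemma strictMonoOn_enthalpyDeriv : StrictMonoOn (enthalpyDeriv P) (Ici 0) := by
  refine strictMonoOn_of_deriv_pos (convex_Ici 0) h.continuousOn_enthalpyDeriv fun x hx => ?_
  rw [interior_Ici] at hx
  rw [(h.hasStrictDerivAt_enthalpyDeriv hx).hasDerivAt.deriv]
  exact div_pos (h.deriv_pos x hx) hx

lemma enthalpyDeriv_pos {ρ : ℝ} (hρ : 0 < ρ) : 0 < enthalpyDeriv P ρ := by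
  have := h.strictMonoOn_enthalpyDeriv (mem_Ici.2 le_rfl) (mem_Ici.2 hρ.le) hρ
  rwa [enthalpyDeriv_zero] at this

lemma Fplus_enthalpyDeriv {ρ : ℝ} (hρ : 0 < ρ) : Fplus P (enthalpyDeriv P ρ) = ρ := by
  have hex : ∃ ρ' : ℝ, 0 < ρ' ∧ enthalpyDeriv P ρ' = enthalpyDeriv P ρ := ⟨ρ, hρ, rfl⟩
  rw [Fplus, dif_pos hex]
  exact h.strictMonoOn_enthalpyDeriv.injOn hex.choose_spec.1.le hρ.le hex.choose_spec.2

lemma Fplus_of_nonpos {s : ℝ} (hs : s ≤ 0) : Fplus P s = 0 := by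
  rw [Fplus, dif_neg]
  rintro ⟨ρ, hρ, rfl⟩
  exact absurd (h.enthalpyDeriv_pos hρ) (not_lt.2 hs)

lemma exists_enthalpyDeriv_eq {s μ : ℝ} (hμ : 0 < μ) (hs : 0 < s) (hsμ : s < enthalpyDeriv P μ) :
    ∃ ρ, 0 < ρ ∧ ρ < μ ∧ enthalpyDeriv P ρ = s := by
  obtain ⟨ρ, hρ, rfl⟩ := intermediate_value_Ioo hμ.le
    (h.continuousOn_enthalpyDeriv.mono Icc_subset_Ici_self)
    (show s ∈ Ioo (enthalpyDeriv P 0) (enthalpyDeriv P μ) by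
      rw [enthalpyDeriv_zero]; exact ⟨hs, hsμ⟩)
  exact ⟨ρ, hρ.1, hρ.2, rfl⟩

lemma hasStrictDerivAt_Fplus {ρ : ℝ} (hρ : 0 < ρ) :
    HasStrictDerivAt (Fplus P) (ρ / deriv P ρ) (enthalpyDeriv P ρ) := by
  have h1 := h.hasStrictDerivAt_enthalpyDeriv hρ
  have h2 : deriv P ρ / ρ ≠ 0 := (div_pos (h.deriv_pos ρ hρ) hρ).ne'
  have := h1.to_local_left_inverse h2 (g := Fplus P) (by
    filter_upwards [lt_mem_nhds hρ] with x hx using h.Fplus_enthalpyDeriv hx)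
  rwa [inv_div] at this

lemma tendsto_Fplus_zero : Tendsto (Fplus P) (𝓝[>] 0) (𝓝 0) := by
  rw [Metric.tendsto_nhdsWithin_nhds]
  intro ε hε
  refine ⟨enthalpyDeriv P ε, h.enthalpyDeriv_pos hε, fun s hs hsd => ?_⟩
  have hs : 0 < s := hs
  rw [Real.dist_eq, sub_zero, abs_of_pos hs] at hsd
  obtain ⟨ρ, hρ, hρε, rfl⟩ := h.exists_enthalpyDeriv_eq hε hs hsd
  rwa [h.Fplus_enthalpyDeriv hρ, Real.dist_eq, sub_zero, abs_of_pos hρ]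

/-- `F₊'(Φ'(ρ)) = ρ / P'(ρ) ~ ρ^{2 - γ₀} / K` tends to zero because `γ₀ < 2`; this makes `F₊` of
class `C¹` across `s = 0`. -/
lemma tendsto_div_deriv_zero : Tendsto (fun ρ => ρ / deriv P ρ) (𝓝[>] 0) (𝓝 0) := by
  have h1 : Tendsto (fun s : ℝ => s ^ (2 - γ₀)) (𝓝[>] 0) (𝓝 0) := by
    have : ContinuousAt (fun s : ℝ => s ^ (2 - γ₀)) 0 :=
      continuousAt_id.rpow_const (Or.inr (by linarith [h.upper]))
    have h2 := this.tendsto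
    simp only [Real.zero_rpow (by linarith [h.upper] : 2 - γ₀ ≠ 0)] at h2
    exact h2.mono_left nhdsWithin_le_nhds
  have h2 := h1.div h.tendsto_zero h.const_pos.ne'
  rw [zero_div] at h2
  refine h2.congr' ?_
  filter_upwards [self_mem_nhdsWithin] with s hs
  have hs : 0 < s := hs
  have h3 : s ^ (2 - γ₀) = s * s ^ (1 - γ₀) := by
    nth_rewrite 2 [← Real.rpow_one s]
    rw [← Real.rpow_add hs]; congr 1; ring
  have h4 : s ^ (1 - γ₀) ≠ 0 := (Real.rpow_pos_of_pos hs _).ne'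
  have h5 := (h.deriv_pos s hs).ne'
  simp only [Pi.div_apply]
  rw [h3]
  field_simp

lemma eventually_Fplus_pos : ∀ᶠ s in 𝓝[>] (0 : ℝ),
    0 < Fplus P s ∧ HasDerivAt (Fplus P) (Fplus P s / deriv P (Fplus P s)) s := by
  filter_upwards [Ioo_mem_nhdsGT (h.enthalpyDeriv_pos one_pos)] with s hs
  obtain ⟨ρ, hρ, -, rfl⟩ := h.exists_enthalpyDeriv_eq one_pos hs.1 hs.2
  rw [h.Fplus_enthalpyDeriv hρ]
  exact ⟨hρ, (h.hasStrictDerivAt_Fplus hρ).hasDerivAt⟩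

lemma tendsto_deriv_Fplus_zero : Tendsto (deriv (Fplus P)) (𝓝[>] 0) (𝓝 0) := by
  have h1 : Tendsto (Fplus P) (𝓝[>] 0) (𝓝[>] 0) :=
    tendsto_nhdsWithin_iff.2 ⟨h.tendsto_Fplus_zero, h.eventually_Fplus_pos.mono fun _ hs => hs.1⟩
  refine (h.tendsto_div_deriv_zero.comp h1).congr' ?_
  filter_upwards [h.eventually_Fplus_pos] with s hs
  exact hs.2.deriv.symm

lemma hasDerivAt_Fplus_zero : HasDerivAt (Fplus P) 0 0 := by
  have hF0 := h.Fplus_of_nonpos le_rfl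
  have h1 : HasDerivWithinAt (Fplus P) 0 (Iic 0) 0 :=
    (hasDerivWithinAt_const 0 (Iic 0) (0 : ℝ)).congr (fun s hs => h.Fplus_of_nonpos hs) hF0
  have h2 : HasDerivWithinAt (Fplus P) 0 (Ici 0) 0 := by
    obtain ⟨s, hs, hd⟩ := mem_nhdsGT_iff_exists_Ioc_subset.1 h.eventually_Fplus_pos
    refine hasDerivWithinAt_Ici_of_tendsto_deriv (s := Ioc 0 s)
      (fun x hx => (hd hx).2.differentiableAt.differentiableWithinAt) ?_
      (Ioc_mem_nhdsGT hs) h.tendsto_deriv_Fplus_zero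
    rw [ContinuousWithinAt, hF0]
    exact h.tendsto_Fplus_zero.mono_left (nhdsWithin_mono _ Ioc_subset_Ioi_self)
  simpa using h1.union h2

lemma hasDerivAt_Fplus_of_nonpos {s : ℝ} (hs : s ≤ 0) : HasDerivAt (Fplus P) 0 s := by
  rcases hs.eq_or_lt with rfl | hs
  · exact h.hasDerivAt_Fplus_zero
  · refine (hasDerivAt_const s (0 : ℝ)).congr_of_eventuallyEq ?_
    filter_upwards [gt_mem_nhds hs] with x hx using h.Fplus_of_nonpos (le_of_lt hx)

lemma deriv_Fplus_of_nonpos {s : ℝ} (hs : s ≤ 0) : deriv (Fplus P) s = 0 :=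
  (h.hasDerivAt_Fplus_of_nonpos hs).deriv

lemma differentiableAt_Fplus {μ s : ℝ} (hμ : 0 < μ) (hs : s < enthalpyDeriv P μ) :
    DifferentiableAt ℝ (Fplus P) s := by
  rcases le_or_gt s 0 with hs0 | hs0
  · exact (h.hasDerivAt_Fplus_of_nonpos hs0).differentiableAt
  · obtain ⟨ρ, hρ, -, rfl⟩ := h.exists_enthalpyDeriv_eq hμ hs0 hs
    exact (h.hasStrictDerivAt_Fplus hρ).hasDerivAt.differentiableAt

lemma deriv_Fplus_nonneg {μ s : ℝ} (hμ : 0 < μ) (hs : s < enthalpyDeriv P μ) :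
    0 ≤ deriv (Fplus P) s := by
  rcases le_or_gt s 0 with hs0 | hs0
  · rw [h.deriv_Fplus_of_nonpos hs0]
  · obtain ⟨ρ, hρ, -, rfl⟩ := h.exists_enthalpyDeriv_eq hμ hs0 hs
    rw [(h.hasStrictDerivAt_Fplus hρ).hasDerivAt.deriv]
    exact (div_pos hρ (h.deriv_pos ρ hρ)).le

lemma continuousAt_deriv_Fplus {μ s : ℝ} (hμ : 0 < μ) (hs : s < enthalpyDeriv P μ) :
    ContinuousAt (deriv (Fplus P)) s := by
  rcases lt_trichotomy s 0 with hs0 | rfl | hs0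
  · refine (continuousAt_const (y := (0 : ℝ))).congr ?_
    filter_upwards [gt_mem_nhds hs0] with x hx using (h.deriv_Fplus_of_nonpos (le_of_lt hx)).symm
  · rw [continuousAt_iff_continuous_left'_right']
    have h0 := h.deriv_Fplus_of_nonpos (le_refl 0)
    constructor
    · refine (continuousWithinAt_const (b := (0 : ℝ))).congr
        (fun x hx => h.deriv_Fplus_of_nonpos (le_of_lt hx)) h0
    · rw [ContinuousWithinAt, h0]
      exact h.tendsto_deriv_Fplus_zero
  · obtain ⟨ρ, hρ, -, rfl⟩ := h.exists_enthalpyDeriv_eq hμ hs0 hs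
    have h1 : ContinuousAt (fun s => Fplus P s / deriv P (Fplus P s)) (enthalpyDeriv P ρ) := by
      have h2 := (h.hasStrictDerivAt_Fplus hρ).hasDerivAt.continuousAt
      have h3 : ContinuousAt (deriv P) (Fplus P (enthalpyDeriv P ρ)) := by
        rw [h.Fplus_enthalpyDeriv hρ]
        exact h.continuousOn_deriv.continuousAt (Ioi_mem_nhds hρ)
      refine h2.div (ContinuousAt.comp (f := Fplus P) h3 h2) ?_
      rw [h.Fplus_enthalpyDeriv hρ]
      exact (h.deriv_pos ρ hρ).ne'
    refine h1.congr ?_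
    filter_upwards [Ioo_mem_nhds hs0 hs] with x hx
    obtain ⟨σ, hσ, -, rfl⟩ := h.exists_enthalpyDeriv_eq hμ hx.1 hx.2
    rw [h.Fplus_enthalpyDeriv hσ, (h.hasStrictDerivAt_Fplus hσ).hasDerivAt.deriv]

/-- On half-lines below `s_max`, `F₊'` agrees with a bounded uniformly continuous function. -/
lemma exists_deriv_Fplus_eq {μ b : ℝ} (hμ : 0 < μ) (hb : b < enthalpyDeriv P μ) :
    ∃ D : ℝ → ℝ, UniformContinuous D ∧ (∃ C, 0 ≤ C ∧ ∀ s, 0 ≤ D s ∧ D s ≤ C) ∧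
      (∀ s ≤ 0, D s = 0) ∧ ∀ s ≤ b, HasDerivAt (Fplus P) (D s) s := by
  wlog hb0 : 0 ≤ b generalizing b
  · obtain ⟨D, h1, h2, h3, h4⟩ := this (h.enthalpyDeriv_pos hμ) le_rfl
    exact ⟨D, h1, h2, h3, fun s hs => h4 s (hs.trans (not_le.1 hb0).le)⟩
  have hc : ContinuousOn (deriv (Fplus P)) (Icc 0 b) := fun s hs =>
    (h.continuousAt_deriv_Fplus hμ (hs.2.trans_lt hb)).continuousWithinAt
  have hmem : ∀ s : ℝ, (projIcc 0 b hb0 s : ℝ) ∈ Icc 0 b := fun s => Subtype.mem _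
  obtain ⟨C, hC⟩ := isCompact_Icc.exists_bound_of_continuousOn hc
  have hD : UniformContinuous (fun s : Icc (0 : ℝ) b => deriv (Fplus P) s) :=
    CompactSpace.uniformContinuous_of_continuous hc.domRestrict
  refine ⟨fun s => deriv (Fplus P) (projIcc 0 b hb0 s), hD.comp
    (LipschitzWith.projIcc hb0).uniformContinuous,
    ⟨C, (norm_nonneg _).trans (hC 0 ⟨le_rfl, hb0⟩), fun s =>
      ⟨h.deriv_Fplus_nonneg hμ ((hmem s).2.trans_lt hb),
        (le_abs_self _).trans (hC _ (hmem s))⟩⟩, fun s hs => ?_, fun s hs => ?_⟩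
  · simp only [projIcc_of_le_left hb0 hs]
    exact h.deriv_Fplus_of_nonpos le_rfl
  · have : deriv (Fplus P) (projIcc 0 b hb0 s) = deriv (Fplus P) s := by
      rcases le_total s 0 with hs0 | hs0
      · rw [projIcc_of_le_left hb0 hs0, h.deriv_Fplus_of_nonpos hs0, h.deriv_Fplus_of_nonpos le_rfl]
      · rw [projIcc_of_mem hb0 ⟨hs0, hs⟩]
    simp only [this]
    exact (h.differentiableAt_Fplus hμ (hs.trans_lt hb)).hasDerivAt

end IsPressureLaw

/-! ### Star profiles -/

lemma HasStar.isStarProfile {P : ℝ → ℝ} {μ : ℝ} (hs : HasStar P μ) :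
    IsStarProfile P μ (profile P μ) (radius P μ) := by
  rw [profile, dif_pos hs, radius, dif_pos hs]
  exact hs.choose_spec.choose_spec

lemma integral_sq_mul_Fplus_nonneg (P y : ℝ → ℝ) {r : ℝ} (hr : 0 ≤ r) :
    0 ≤ ∫ s in (0 : ℝ)..r, s ^ 2 * Fplus P (y s) :=
  intervalIntegral.integral_nonneg hr fun s _ => mul_nonneg (sq_nonneg s) (Fplus_nonneg P _)

namespace IsStarProfile
variable {P : ℝ → ℝ} {γ₀ K μ R : ℝ} {y : ℝ → ℝ} (hy : IsStarProfile P μ y R)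
  (h : IsPressureLaw P γ₀ K) (hμ : 0 < μ)
include hy

lemma continuousOn : ContinuousOn y (Ici 0) := by
  intro r hr
  rcases (mem_Ici.1 hr).eq_or_lt with rfl | hr
  · exact hy.cont
  · exact (hy.ode r hr).continuousAt.continuousWithinAt

lemma antitoneOn : AntitoneOn y (Ici 0) := by
  refine antitoneOn_of_deriv_nonpos (convex_Ici 0) hy.continuousOn ?_ ?_
  · intro x hx
    rw [interior_Ici] at hx
    exact (hy.ode x hx).differentiableAt.differentiableWithinAt
  · intro x hx
    rw [interior_Ici] at hx
    have hx : 0 < x := hx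
    rw [(hy.ode x hx).deriv, neg_mul]
    have := integral_sq_mul_Fplus_nonneg P y hx.le
    have := Real.pi_pos
    exact neg_nonpos_of_nonneg (by positivity)

lemma le_enthalpyDeriv {r : ℝ} (hr : 0 ≤ r) : y r ≤ enthalpyDeriv P μ := by
  rw [← hy.init]
  exact hy.antitoneOn (mem_Ici.2 le_rfl) hr hr

include h hμ

lemma lt_enthalpyDeriv_add_one {r : ℝ} (hr : 0 ≤ r) : y r < enthalpyDeriv P (μ + 1) :=
  (hy.le_enthalpyDeriv hr).trans_lt (h.strictMonoOn_enthalpyDeriv hμ.le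
    (mem_Ici.2 (by linarith)) (by linarith))

lemma continuousOn_Fplus : ContinuousOn (fun r => Fplus P (y r)) (Ici 0) := fun r hr =>
  ContinuousAt.comp_continuousWithinAt (g := Fplus P)
    (h.differentiableAt_Fplus (by linarith : 0 < μ + 1)
      (hy.lt_enthalpyDeriv_add_one h hμ hr)).continuousAt (hy.continuousOn r hr)

lemma integral_pos {r : ℝ} (hr : 0 < r) : 0 < ∫ s in (0 : ℝ)..r, s ^ 2 * Fplus P (y s) := by
  have hc := hy.continuousOn_Fplus h hμ
  have h0 : ∀ᶠ s in 𝓝[>] (0 : ℝ), 0 < Fplus P (y s) := by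
    have h1 := (hc 0 (mem_Ici.2 le_rfl)).mono_left (nhdsWithin_mono 0 Ioi_subset_Ici_self)
    refine h1 (Ioi_mem_nhds ?_)
    change 0 < Fplus P (y 0)
    rwa [hy.init, h.Fplus_enthalpyDeriv hμ]
  obtain ⟨s, hs, hs'⟩ := (h0.and (Ioo_mem_nhdsGT hr)).exists
  refine intervalIntegral.integral_pos hr ((continuousOn_id.pow 2).mul
    (hc.mono Icc_subset_Ici_self)) (fun s _ => mul_nonneg (sq_nonneg s) (Fplus_nonneg P _))
    ⟨s, ⟨hs'.1.le, hs'.2.le⟩, ?_⟩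
  exact mul_pos (pow_pos hs'.1 2) hs

lemma strictAntiOn : StrictAntiOn y (Ici 0) := by
  refine strictAntiOn_of_deriv_neg (convex_Ici 0) hy.continuousOn fun x hx => ?_
  rw [interior_Ici] at hx
  have hx : 0 < x := hx
  rw [(hy.ode x hx).deriv, neg_mul]
  have := hy.integral_pos h hμ hx
  have := Real.pi_pos
  exact neg_neg_of_pos (by positivity)

lemma nonpos_iff {r : ℝ} (hr : 0 ≤ r) : y r ≤ 0 ↔ R ≤ r := by
  rw [← hy.vanish, (hy.strictAntiOn h hμ).le_iff_ge hr hy.radius_pos.le]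

lemma Fplus_eq_zero {r : ℝ} (hr : R ≤ r) : Fplus P (y r) = 0 :=
  h.Fplus_of_nonpos ((hy.nonpos_iff h hμ (hy.radius_pos.le.trans hr)).2 hr)

lemma integral_eq {r : ℝ} (hr : R ≤ r) : ∫ s in (0 : ℝ)..r, s ^ 2 * Fplus P (y s) =
    ∫ s in (0 : ℝ)..R, s ^ 2 * Fplus P (y s) := by
  have hR := hy.radius_pos
  have hc : ContinuousOn (fun s => s ^ 2 * Fplus P (y s)) (Ici 0) :=
    (continuousOn_id.pow 2).mul (hy.continuousOn_Fplus h hμ)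
  rw [← intervalIntegral.integral_add_adjacent_intervals (b := R)
    (ContinuousOn.intervalIntegrable (hc.mono ?_)) (ContinuousOn.intervalIntegrable (hc.mono ?_))]
  · rw [intervalIntegral.integral_congr (g := fun _ => 0) (a := R), intervalIntegral.integral_zero,
      add_zero]
    intro s hs
    rw [uIcc_of_le hr] at hs
    simp only [hy.Fplus_eq_zero h hμ hs.1, mul_zero]
  · rw [uIcc_of_le hR.le]; exact Icc_subset_Ici_self
  · rw [uIcc_of_le hr]; exact fun s hs => hR.le.trans hs.1

/-- Outside the star the profile is harmonic. -/
lemma eq_of_radius_le {r : ℝ} (hr : R ≤ r) :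
    y r = 4 * Real.pi * (∫ s in (0 : ℝ)..R, s ^ 2 * Fplus P (y s)) * (1 / r - 1 / R) := by
  have hR := hy.radius_pos
  set m := ∫ s in (0 : ℝ)..R, s ^ 2 * Fplus P (y s) with hm
  have hd : ∀ x ∈ Icc R r, HasDerivAt (fun x => y x - 4 * Real.pi * m * x⁻¹) 0 x := by
    intro x hx
    have hx0 : 0 < x := hR.trans_le hx.1
    have h1 := hy.ode x hx0
    rw [hy.integral_eq h hμ hx.1, ← hm] at h1
    refine (h1.sub ((hasDerivAt_inv hx0.ne').const_mul (4 * Real.pi * m))).congr_deriv ?_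
    field_simp
    ring
  have h2 := constant_of_has_deriv_right_zero
    (fun x hx => (hd x hx).continuousAt.continuousWithinAt)
    (fun x hx => (hd x (Ico_subset_Icc_self hx)).hasDerivWithinAt) r (right_mem_Icc.2 hr)
  simp only [hy.vanish] at h2
  rw [one_div, one_div]
  linarith

end IsStarProfile

section
variable {P : ℝ → ℝ} {γ₀ K μ : ℝ} (hs : HasStar P μ) (h : IsPressureLaw P γ₀ K) (hμ : 0 < μ)
include hs h hμ

lemma density_eq {r : ℝ} : density P μ r = Fplus P (profile P μ r) := by
  rw [density]
  split_ifs with hr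
  · rfl
  · exact (hs.isStarProfile.Fplus_eq_zero h hμ (not_lt.1 hr)).symm

lemma mass_eq_integral : mass P μ =
    4 * Real.pi * ∫ s in (0 : ℝ)..radius P μ, s ^ 2 * Fplus P (profile P μ s) := by
  have hR := hs.isStarProfile.radius_pos
  rw [mass, integral_norm]
  congr 1
  simp_rw [density_eq hs h hμ]
  rw [intervalIntegral.integral_of_le hR.le]
  refine (setIntegral_eq_of_subset_of_forall_sdiff_eq_zero measurableSet_Ioi Ioc_subset_Ioi_self
    fun r hr => ?_)
  have h1 : radius P μ ≤ r := by
    by_contra hcon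
    exact hr.2 ⟨hr.1, (not_le.1 hcon).le⟩
  rw [hs.isStarProfile.Fplus_eq_zero h hμ h1, mul_zero]

lemma profile_eq_of_radius_le {r : ℝ} (hr : radius P μ ≤ r) :
    profile P μ r = mass P μ / r - massRadiusRatio P μ := by
  rw [hs.isStarProfile.eq_of_radius_le h hμ hr, massRadiusRatio, mass_eq_integral hs h hμ]
  ring

/-- The mass is read off from the values of the profile at two radii outside the star, which are
kept fixed when `μ` varies. -/
lemma mass_eq {T : ℝ} (hT : radius P μ ≤ T) :
    mass P μ = 2 * T * (profile P μ T - profile P μ (2 * T)) := by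
  have hR := hs.isStarProfile.radius_pos
  rw [profile_eq_of_radius_le hs h hμ hT,
    profile_eq_of_radius_le hs h hμ (hT.trans (by linarith) : radius P μ ≤ 2 * T)]
  have : T ≠ 0 := by linarith
  field_simp
  ring

lemma massRadiusRatio_eq {T : ℝ} (hT : radius P μ ≤ T) :
    massRadiusRatio P μ = profile P μ T - 2 * profile P μ (2 * T) := by
  have hR := hs.isStarProfile.radius_pos
  rw [profile_eq_of_radius_le hs h hμ hT,
    profile_eq_of_radius_le hs h hμ (hT.trans (by linarith) : radius P μ ≤ 2 * T)]
  have : T ≠ 0 := by linarith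
  field_simp
  ring

/-- `-V_μ = M / R + y_μ`: both sides have the same derivative and vanish at infinity. -/
lemma potential_eq {r : ℝ} (hr : 0 < r) :
    potential P μ r = -(massRadiusRatio P μ + profile P μ r) := by
  have hy := hs.isStarProfile
  have hlim : Tendsto (fun r => -profile P μ r) atTop (𝓝 (massRadiusRatio P μ)) := by
    have h1 : Tendsto (fun r : ℝ => massRadiusRatio P μ - mass P μ / r) atTop
        (𝓝 (massRadiusRatio P μ - 0)) :=
      tendsto_const_nhds.sub (tendsto_const_nhds.div_atTop tendsto_id)
    rw [sub_zero] at h1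
    refine h1.congr' ?_
    filter_upwards [eventually_ge_atTop (radius P μ)] with s hs'
    rw [profile_eq_of_radius_le hs h hμ hs']
    ring
  have h2 : ∀ s, 0 < s → HasDerivAt (fun r => -profile P μ r)
      (4 * Real.pi / s ^ 2 * ∫ t in (0 : ℝ)..s, t ^ 2 * density P μ t) s := by
    intro s hs0
    simp_rw [density_eq hs h hμ]
    exact (hy.ode s hs0).neg.congr_deriv (by ring)
  rw [potential, integral_Ioi_of_hasDerivAt_of_nonneg'
    (fun s hs' => h2 s (hr.trans_le hs')) ?_ hlim]
  · ring
  · intro s hs'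
    have hs0 : 0 < s := hr.trans hs'
    simp_rw [density_eq hs h hμ]
    have := integral_sq_mul_Fplus_nonneg P (profile P μ) hs0.le
    have := Real.pi_pos
    positivity

lemma potential_radius_sub {r : ℝ} (hr : 0 < r) :
    potential P μ (radius P μ) - potential P μ r = profile P μ r := by
  have hy := hs.isStarProfile
  rw [potential_eq hs h hμ hr, potential_eq hs h hμ hy.radius_pos, hy.vanish]
  ring

end

/-- The function `r ↦ 4π F₊'(y_μ(r))`, extended evenly. -/
noncomputable def starPotential (P : ℝ → ℝ) (μ r : ℝ) : ℝ :=
  4 * Real.pi * deriv (Fplus P) (profile P μ |r|)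

section
variable {P : ℝ → ℝ} {γ₀ K μ : ℝ} (hs : HasStar P μ) (h : IsPressureLaw P γ₀ K) (hμ : 0 < μ)
include hs h hμ

lemma formD_eq (p : FunctionGradientPairs) : formD P μ p = radialForm (starPotential P μ) p := by
  rw [formD, radialForm, ← integral_const_mul]
  congr 1
  have hx0 : ∀ᵐ x : Space, x ≠ 0 := by simp [ae_iff]
  refine integral_congr_ae ?_
  filter_upwards [hx0] with x hx
  rw [potential_radius_sub hs h hμ (norm_pos_iff.2 hx), starPotential, abs_norm]
  ring

lemma morseIndex_eq_radialIndex : morseIndex P μ = radialIndex (starPotential P μ) := by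
  unfold morseIndex radialIndex
  simp_rw [formD_eq hs h hμ]

lemma continuous_starPotential : Continuous (starPotential P μ) := by
  have hy := hs.isStarProfile
  refine continuous_const.mul (continuous_iff_continuousAt.2 fun r => ?_)
  have h1 : Continuous fun r => profile P μ |r| :=
    hy.continuousOn.comp_continuous continuous_abs fun r => abs_nonneg r
  exact ContinuousAt.comp (f := fun r => profile P μ |r|) (h.continuousAt_deriv_Fplus
    (by linarith : 0 < μ + 1) (hy.lt_enthalpyDeriv_add_one h hμ (abs_nonneg r))) h1.continuousAt

lemma starPotential_nonneg (r : ℝ) : 0 ≤ starPotential P μ r := by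
  have := h.deriv_Fplus_nonneg (by linarith : 0 < μ + 1)
    (hs.isStarProfile.lt_enthalpyDeriv_add_one h hμ (abs_nonneg r))
  have := Real.pi_pos
  unfold starPotential
  positivity

lemma starPotential_eq_zero {r : ℝ} (hr : radius P μ ≤ r) : starPotential P μ r = 0 := by
  have hr0 : 0 ≤ r := hs.isStarProfile.radius_pos.le.trans hr
  rw [starPotential, abs_of_nonneg hr0, h.deriv_Fplus_of_nonpos
    ((hs.isStarProfile.nonpos_iff h hμ hr0).2 hr), mul_zero]

end

/-! ### Dependence of the profiles on the center density -/

lemma abs_sub_le_of_hasDerivAt {F D : ℝ → ℝ} {b C : ℝ} (hD : ∀ s ≤ b, HasDerivAt F (D s) s)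
    (hC : ∀ s, |D s| ≤ C) {x y : ℝ} (hx : x ≤ b) (hy : y ≤ b) : |F x - F y| ≤ C * |x - y| :=
  (convex_Iic b).norm_image_sub_le_of_norm_hasDerivWithin_le
    (fun s hs => (hD s hs).hasDerivWithinAt) (fun s _ => hC s) hy hx

lemma exists_abs_sub_sub_le {F D : ℝ → ℝ} {b : ℝ} (hD : ∀ s ≤ b, HasDerivAt F (D s) s)
    (hu : UniformContinuous D) {η : ℝ} (hη : 0 < η) : ∃ δ > 0, ∀ x ≤ b, ∀ y ≤ b, |x - y| < δ →
      |D x - D y| ≤ η ∧ |F x - F y - D y * (x - y)| ≤ η * |x - y| := by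
  obtain ⟨δ, hδ, h⟩ := Metric.uniformContinuous_iff.1 hu η hη
  refine ⟨δ, hδ, fun x hx y hy hxy => ⟨(h hxy).le, ?_⟩⟩
  have h1 := (convex_uIcc y x).norm_image_sub_le_of_norm_hasDerivWithin_le
    (f := fun s => F s - D y * s) (f' := fun s => D s - D y) (C := η)
    (fun s hs => (((hD s (hs.2.trans (max_le hy hx))).sub
      ((hasDerivAt_id s).const_mul (D y))).congr_deriv (by simp)).hasDerivWithinAt)
    (fun s hs => by
      refine (h ?_).le
      rw [Real.dist_eq]
      exact (abs_sub_left_of_mem_uIcc hs).trans_lt hxy)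
    left_mem_uIcc right_mem_uIcc
  simp only [Real.norm_eq_abs] at h1
  convert h1 using 2
  ring

namespace IsRegularSolution
variable {q u p : ℝ → ℝ} (h : IsRegularSolution q u p)
include h

lemma dslope_eq {r : ℝ} (hr : r ≠ 0) : dslope u 0 r = u r / r := by
  rw [dslope_of_ne _ hr, slope_def_field, h.u_zero, sub_zero, sub_zero]

lemma dslope_zero : dslope u 0 0 = 1 := by
  rw [dslope_same, (h.hasDerivAt_u 0 le_rfl).deriv, h.p_zero]

lemma mul_dslope (r : ℝ) : r * dslope u 0 r = u r := by
  rcases eq_or_ne r 0 with rfl | hr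
  · rw [h.u_zero, zero_mul]
  · rw [h.dslope_eq hr]; field_simp

lemma continuousOn_dslope : ContinuousOn (dslope u 0) (Ici 0) := by
  intro r hr
  rcases eq_or_ne r 0 with rfl | hr0
  · exact (continuousAt_dslope_same.2
      (h.hasDerivAt_u 0 le_rfl).differentiableAt).continuousWithinAt
  · exact (continuousWithinAt_dslope_of_ne hr0).2 (h.continuousOn_u r hr)

/-- `u(r) / r` solves the radial equation `Δv + q v = 0` in `ℝ³`. -/
lemma hasDerivAt_dslope (hq : Continuous q) {r : ℝ} (hr : 0 < r) : HasDerivAt (dslope u 0)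
    (-(1 / r ^ 2) * ∫ s in (0 : ℝ)..r, s ^ 2 * (q s * dslope u 0 s)) r := by
  have hu : ContinuousOn u (uIcc 0 r) := h.continuousOn_u.mono (by
    rw [uIcc_of_le hr.le]; exact Icc_subset_Ici_self)
  have h1 : ∫ s in (0 : ℝ)..r, s ^ 2 * (q s * dslope u 0 s) = u r - r * p r := by
    have h2 : ∀ s ∈ uIcc 0 r, HasDerivAt (fun x => u x - x * p x) (s * (q s * u s)) s := by
      intro s hs
      rw [uIcc_of_le hr.le] at hs
      refine ((h.hasDerivAt_u s hs.1).sub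
        ((hasDerivAt_id s).mul (h.hasDerivAt_p s hs.1))).congr_deriv ?_
      simp
    have h3 := intervalIntegral.integral_eq_sub_of_hasDerivAt h2
      (ContinuousOn.intervalIntegrable (by fun_prop))
    simp only [h.u_zero, zero_mul, sub_zero] at h3
    rw [← h3]
    refine intervalIntegral.integral_congr fun s _ => ?_
    rw [← h.mul_dslope s]
    ring
  rw [h1]
  refine (((h.hasDerivAt_u r hr.le).div (hasDerivAt_id r)
    hr.ne').congr_deriv ?_).congr_of_eventuallyEq ?_
  · simp only [id]
    field_simp
    ring
  · filter_upwards [lt_mem_nhds hr] with s hs using h.dslope_eq (ne_of_gt hs)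

end IsRegularSolution

lemma IsStarProfile.hasDerivAt {P : ℝ → ℝ} {μ R : ℝ} {y : ℝ → ℝ} (hy : IsStarProfile P μ y R)
    {r : ℝ} (hr : 0 < r) : HasDerivAt y
      (-(1 / r ^ 2) * ∫ s in (0 : ℝ)..r, s ^ 2 * (4 * Real.pi * Fplus P (y s))) r := by
  refine (hy.ode r hr).congr_deriv ?_
  have : ∀ s, s ^ 2 * (4 * Real.pi * Fplus P (y s)) = 4 * Real.pi * (s ^ 2 * Fplus P (y s)) :=
    fun s => by ring
  simp_rw [this]
  rw [intervalIntegral.integral_const_mul]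
  ring

lemma hasDerivAt_sub_of_radial {y z f g : ℝ → ℝ} {r : ℝ} (hr : 0 ≤ r)
    (hf : ContinuousOn f (Ici 0)) (hg : ContinuousOn g (Ici 0))
    (hy : HasDerivAt y (-(1 / r ^ 2) * ∫ s in (0 : ℝ)..r, s ^ 2 * f s) r)
    (hz : HasDerivAt z (-(1 / r ^ 2) * ∫ s in (0 : ℝ)..r, s ^ 2 * g s) r) :
    HasDerivAt (fun r => y r - z r) (-(1 / r ^ 2) * ∫ s in (0 : ℝ)..r, s ^ 2 * (f s - g s)) r := by
  refine (hy.sub hz).congr_deriv ?_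
  have hsub : uIcc 0 r ⊆ Ici 0 := by rw [uIcc_of_le hr]; exact Icc_subset_Ici_self
  have hf' := hf.mono hsub
  have hg' := hg.mono hsub
  simp_rw [mul_sub]
  rw [intervalIntegral.integral_sub (ContinuousOn.intervalIntegrable (by fun_prop))
    (ContinuousOn.intervalIntegrable (by fun_prop))]
  ring

section
variable {P D : ℝ → ℝ} {γ₀ K μ₁ C : ℝ} (h : IsPressureLaw P γ₀ K)
  (hstar : ∀ μ ∈ Ioc 0 μ₁, HasStar P μ) (hC : ∀ s, |D s| ≤ C)
  (hD : ∀ s ≤ enthalpyDeriv P μ₁, HasDerivAt (Fplus P) (D s) s)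
include h hstar

lemma profile_le {μ r : ℝ} (hμ : μ ∈ Ioc 0 μ₁) (hr : 0 ≤ r) : profile P μ r ≤ enthalpyDeriv P μ₁ :=
  ((hstar μ hμ).isStarProfile.le_enthalpyDeriv hr).trans
    (h.strictMonoOn_enthalpyDeriv.monotoneOn (mem_Ici.2 hμ.1.le)
      (mem_Ici.2 (hμ.1.le.trans hμ.2)) hμ.2)

include hD

lemma starPotential_eq {μ r : ℝ} (hμ : μ ∈ Ioc 0 μ₁) (hr : 0 ≤ r) :
    starPotential P μ r = 4 * Real.pi * D (profile P μ r) := by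
  rw [starPotential, abs_of_nonneg hr, (hD _ (profile_le h hstar hμ hr)).deriv]

include hC

lemma exists_abs_profile_sub_le {T : ℝ} (hT : 0 ≤ T) :
    ∃ L, 0 < L ∧ ∀ μ ∈ Ioc 0 μ₁, ∀ ν ∈ Ioc 0 μ₁, ∀ r ∈ Icc 0 T,
      |profile P μ r - profile P ν r| ≤ L * |enthalpyDeriv P μ - enthalpyDeriv P ν| := by
  have hC0 : 0 ≤ C := (abs_nonneg _).trans (hC 0)
  have hpi := Real.pi_pos
  refine ⟨2 * Real.exp ((2 * (4 * Real.pi * C) * T + 1) * T), by positivity,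
    fun μ hμ ν hν r hr => ?_⟩
  have hy := (hstar μ hμ).isStarProfile
  have hz := (hstar ν hν).isStarProfile
  have hFy := hy.continuousOn_Fplus h hμ.1
  have hFz := hz.continuousOn_Fplus h hν.1
  have := abs_le_of_radial_deriv (w := fun r => profile P μ r - profile P ν r)
    (κ := 4 * Real.pi * C) (ε := 0) (by positivity) le_rfl hT
    ((hy.continuousOn.sub hz.continuousOn).mono Icc_subset_Ici_self) le_rfl
    (fun r hr => hasDerivAt_sub_of_radial hr.1.le (by fun_prop) (by fun_prop) (hy.hasDerivAt hr.1)
      (hz.hasDerivAt hr.1)) (fun s hs => ?_) hr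
  · simp only [hy.init, hz.init, mul_zero, add_zero] at this
    exact this
  · rw [← mul_sub, abs_mul, abs_of_pos (by positivity : 0 < 4 * Real.pi), add_zero, mul_assoc _ C]
    have := abs_sub_le_of_hasDerivAt hD hC (profile_le h hstar hμ hs.1.le)
      (profile_le h hstar hν hs.1.le)
    gcongr

/-- The derivative of the profile with respect to the central value `β = Φ'(μ)` is the solution
`u(r) / r` of the linearized equation. -/
lemma hasDerivAt_profile (hunif : UniformContinuous D) {a : ℝ} (ha : a ∈ Ioo 0 μ₁) {u p : ℝ → ℝ}
    (hu : IsRegularSolution (starPotential P a) u p) {r : ℝ} (hr : 0 < r) :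
    HasDerivAt (fun μ => profile P μ r) (u r / r * (deriv P a / a)) a := by
  have ha' : a ∈ Ioc 0 μ₁ := Ioo_subset_Ioc_self ha
  have hC0 : 0 ≤ C := (abs_nonneg _).trans (hC 0)
  have hpi := Real.pi_pos
  obtain ⟨L, hL0, hL⟩ := exists_abs_profile_sub_le h hstar hC hD hr.le
  set v := dslope u 0 with hv
  set β₀ := enthalpyDeriv P a with hβ₀
  have hz := (hstar a ha').isStarProfile
  have hFz := hz.continuousOn_Fplus h ha.1
  have hq := continuous_starPotential (hstar a ha') h ha.1
  have key : HasDerivAt (fun β => profile P (Fplus P β) r) (v r) β₀ := by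
    rw [hasDerivAt_iff_isLittleO, Asymptotics.isLittleO_iff]
    intro c hc
    -- the Grönwall constant which multiplies the linearization error
    set M := 2 * Real.exp ((2 * (4 * Real.pi * C + 1) * r + 1) * r) *
      ((4 * Real.pi * C + 1) * r ^ 2 * (4 * Real.pi * L)) with hM
    have hM0 : 0 < M := by positivity
    obtain ⟨δ, hδ, hη⟩ := exists_abs_sub_sub_le hD hunif (div_pos hc hM0)
    have hnear : ∀ᶠ β in 𝓝 β₀, β ∈ Ioo 0 (enthalpyDeriv P μ₁) ∧ L * |β - β₀| < δ := by
      refine Eventually.and (Ioo_mem_nhds (h.enthalpyDeriv_pos ha.1) (h.strictMonoOn_enthalpyDeriv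
        (mem_Ici.2 ha.1.le) (mem_Ici.2 (ha.1.trans ha.2).le) ha.2)) ?_
      refine ContinuousAt.eventually_lt (by fun_prop) continuousAt_const ?_
      simpa using hδ
    filter_upwards [hnear] with β hβ
    obtain ⟨μ, hμ0, hμ1, hμβ⟩ := h.exists_enthalpyDeriv_eq (ha.1.trans ha.2) hβ.1.1 hβ.1.2
    have hμ : μ ∈ Ioc 0 μ₁ := ⟨hμ0, hμ1.le⟩
    have e1 : Fplus P β = μ := by rw [← hμβ, h.Fplus_enthalpyDeriv hμ0]
    have e2 : Fplus P β₀ = a := h.Fplus_enthalpyDeriv ha.1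
    have hy := (hstar μ hμ).isStarProfile
    have hFy := hy.continuousOn_Fplus h hμ0
    have hvc := hu.continuousOn_dslope
    have hw : ∀ s ∈ Ioc 0 r, HasDerivAt
        (fun s => profile P μ s - profile P a s - (β - β₀) * v s) _ s := fun s hs =>
      hasDerivAt_sub_of_radial (f := fun s => 4 * Real.pi * Fplus P (profile P μ s) -
          4 * Real.pi * Fplus P (profile P a s))
        (g := fun s => (β - β₀) * (starPotential P a s * v s)) hs.1.le
        (by fun_prop) (by fun_prop)
        (hasDerivAt_sub_of_radial hs.1.le (by fun_prop) (by fun_prop) (hy.hasDerivAt hs.1)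
          (hz.hasDerivAt hs.1))
        (((hu.hasDerivAt_dslope hq hs.1).const_mul (β - β₀)).congr_deriv (by
          simp_rw [mul_left_comm _ (β - β₀)]
          rw [intervalIntegral.integral_const_mul]
          ring))
    have hest := abs_le_of_radial_deriv
      (w := fun s => profile P μ s - profile P a s - (β - β₀) * v s)
      (κ := 4 * Real.pi * C + 1) (δ := 0) (ε := 4 * Real.pi * (c / M * (L * |β - β₀|)))
      (by positivity) (by positivity) hr.le
      (((hy.continuousOn.sub hz.continuousOn).sub (by fun_prop)).mono Icc_subset_Ici_self)
      (by simp only [hy.init, hz.init, hv, hu.dslope_zero, hμβ]; simp [hβ₀]) hw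
      (fun s hs => ?_) ⟨hr.le, le_rfl⟩
    · rw [e1, e2]
      simp only [Real.norm_eq_abs, smul_eq_mul]
      refine hest.trans (le_of_eq ?_)
      have : c = c / M * M := by field_simp
      nth_rewrite 2 [this]
      rw [hM]
      ring
    · have hs' : s ∈ Icc 0 r := Ioc_subset_Icc_self hs
      have hyb := profile_le h hstar hμ hs.1.le
      have hzb := profile_le h hstar ha' hs.1.le
      have h1 := hL μ hμ a ha' s hs'
      rw [hμβ] at h1
      obtain ⟨-, h2⟩ := hη _ hyb _ hzb (h1.trans_lt hβ.2)
      have h3 : |Fplus P (profile P μ s) - Fplus P (profile P a s) -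
          D (profile P a s) * (profile P μ s - profile P a s)| ≤ c / M * (L * |β - β₀|) :=
        h2.trans (by gcongr)
      -- the linearization error and the linear term in the remainder
      have h4 : 4 * Real.pi * Fplus P (profile P μ s) - 4 * Real.pi * Fplus P (profile P a s) -
          (β - β₀) * (starPotential P a s * v s) =
          4 * Real.pi * (Fplus P (profile P μ s) - Fplus P (profile P a s) -
            D (profile P a s) * (profile P μ s - profile P a s)) +
          4 * Real.pi * (D (profile P a s) *
            (profile P μ s - profile P a s - (β - β₀) * v s)) := by
        rw [starPotential_eq h hstar hD ha' hs.1.le]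
        ring
      rw [h4]
      refine (abs_add_le _ _).trans ?_
      rw [abs_mul, abs_mul (4 * Real.pi), abs_mul (D _),
        abs_of_pos (by positivity : 0 < 4 * Real.pi)]
      set w := |profile P μ s - profile P a s - (β - β₀) * v s|
      have h5 : |D (profile P a s)| * w ≤ C * w := by
        gcongr
        exact hC _
      have hw0 : 0 ≤ w := abs_nonneg _
      have h6 : 4 * Real.pi * |Fplus P (profile P μ s) - Fplus P (profile P a s) -
          D (profile P a s) * (profile P μ s - profile P a s)| ≤
          4 * Real.pi * (c / M * (L * |β - β₀|)) := by gcongr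
      have h7 : 4 * Real.pi * (|D (profile P a s)| * w) ≤ 4 * Real.pi * (C * w) := by gcongr
      have h8 : 0 ≤ 4 * Real.pi * C * (4 * Real.pi * (c / M * (L * |β - β₀|))) := by positivity
      linarith
  rw [← hu.dslope_eq hr.ne']
  have hcomp := HasDerivAt.comp a key (h.hasStrictDerivAt_enthalpyDeriv ha.1).hasDerivAt
  refine hcomp.congr_of_eventuallyEq ?_
  filter_upwards [lt_mem_nhds ha.1] with μ hμ
  simp only [Function.comp]
  rw [h.Fplus_enthalpyDeriv hμ]

/-- The regular solutions depend continuously on the center density. -/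
lemma tendsto_regularSolution (hunif : UniformContinuous D) {a : ℝ} (ha : a ∈ Ioo 0 μ₁)
    {u p : ℝ → ℝ → ℝ} (hu : ∀ μ ∈ Ioc 0 μ₁, IsRegularSolution (starPotential P μ) (u μ) (p μ))
    {r : ℝ} (hr : 0 < r) : Tendsto (fun μ => u μ r) (𝓝 a) (𝓝 (u a r)) := by
  have ha' : a ∈ Ioc 0 μ₁ := Ioo_subset_Ioc_self ha
  have hC0 : 0 ≤ C := (abs_nonneg _).trans (hC 0)
  have hpi := Real.pi_pos
  obtain ⟨L, hL0, hL⟩ := exists_abs_profile_sub_le h hstar hC hD hr.le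
  have hqa := continuous_starPotential (hstar a ha') h ha.1
  have hva := (hu a ha').continuousOn_dslope
  obtain ⟨B, hB⟩ := isCompact_Icc.exists_bound_of_continuousOn
    (hva.mono (Icc_subset_Ici_self : Icc 0 r ⊆ Ici 0))
  have hB0 : 0 ≤ B := (norm_nonneg _).trans (hB 0 ⟨le_rfl, hr.le⟩)
  have key : Tendsto (fun μ => dslope (u μ) 0 r) (𝓝 a) (𝓝 (dslope (u a) 0 r)) := by
    rw [Metric.tendsto_nhds]
    intro c hc
    set M := 2 * Real.exp ((2 * (4 * Real.pi * C + 1) * r + 1) * r) *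
      ((4 * Real.pi * C + 1) * r ^ 2 * (4 * Real.pi * (B + 1))) with hM
    have hM0 : 0 < M := by positivity
    obtain ⟨δ, hδ, hη⟩ := exists_abs_sub_sub_le hD hunif (div_pos (half_pos hc) hM0)
    have hnear : ∀ᶠ μ in 𝓝 a, μ ∈ Ioo 0 μ₁ ∧ L * |enthalpyDeriv P μ - enthalpyDeriv P a| < δ := by
      refine Eventually.and (Ioo_mem_nhds ha.1 ha.2) ?_
      have := (h.hasStrictDerivAt_enthalpyDeriv ha.1).hasDerivAt.continuousAt
      refine ContinuousAt.eventually_lt (by fun_prop) continuousAt_const ?_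
      simpa using hδ
    filter_upwards [hnear] with μ hμβ
    have hμ : μ ∈ Ioc 0 μ₁ := Ioo_subset_Ioc_self hμβ.1
    have hqm := continuous_starPotential (hstar μ hμ) h hμ.1
    have hvm := (hu μ hμ).continuousOn_dslope
    have hest := abs_le_of_radial_deriv
      (w := fun s => dslope (u μ) 0 s - dslope (u a) 0 s)
      (κ := 4 * Real.pi * C + 1) (δ := 0) (ε := 4 * Real.pi * (c / 2 / M * (B + 1)))
      (by positivity) (by positivity) hr.le
      ((hvm.sub hva).mono Icc_subset_Ici_self)
      (by simp only [(hu μ hμ).dslope_zero, (hu a ha').dslope_zero]; simp)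
      (fun s hs => hasDerivAt_sub_of_radial (f := fun s => starPotential P μ s * dslope (u μ) 0 s)
        (g := fun s => starPotential P a s * dslope (u a) 0 s) hs.1.le
        (by fun_prop) (by fun_prop) ((hu μ hμ).hasDerivAt_dslope hqm hs.1)
        ((hu a ha').hasDerivAt_dslope hqa hs.1)) (fun s hs => ?_) ⟨hr.le, le_rfl⟩
    · rw [Real.dist_eq]
      refine hest.trans_lt ?_
      have h1 : c / 2 = c / 2 / M * M := by field_simp
      have h2 : ∀ e, 2 * Real.exp ((2 * (4 * Real.pi * C + 1) * r + 1) * r) *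
          (0 + (4 * Real.pi * C + 1) * r ^ 2 * (4 * Real.pi * (e * (B + 1)))) = e * M := by
        intro e
        rw [hM]
        ring
      rw [h2, ← h1]
      exact half_lt_self hc
    · have hs' : s ∈ Icc 0 r := Ioc_subset_Icc_self hs
      obtain ⟨h2, -⟩ := hη _ (profile_le h hstar hμ hs.1.le) _ (profile_le h hstar ha' hs.1.le)
        ((hL μ hμ a ha' s hs').trans_lt hμβ.2)
      rw [starPotential_eq h hstar hD hμ hs.1.le, starPotential_eq h hstar hD ha' hs.1.le]
      have h4 : 4 * Real.pi * D (profile P μ s) * dslope (u μ) 0 s -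
          4 * Real.pi * D (profile P a s) * dslope (u a) 0 s =
          4 * Real.pi * (D (profile P μ s) * (dslope (u μ) 0 s - dslope (u a) 0 s)) +
          4 * Real.pi * ((D (profile P μ s) - D (profile P a s)) * dslope (u a) 0 s) := by ring
      rw [h4]
      refine (abs_add_le _ _).trans ?_
      rw [abs_mul, abs_mul (4 * Real.pi), abs_mul (D _), abs_mul (D _ - _),
        abs_of_pos (by positivity : 0 < 4 * Real.pi)]
      set w := |dslope (u μ) 0 s - dslope (u a) 0 s|
      have hw0 : 0 ≤ w := abs_nonneg _
      have h7 : 4 * Real.pi * (|D (profile P μ s)| * w) ≤ 4 * Real.pi * (C * w) := by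
        gcongr
        exact hC _
      have hBs : |dslope (u a) 0 s| ≤ B + 1 := (hB s hs').trans (by linarith)
      have h6 : 4 * Real.pi * (|D (profile P μ s) - D (profile P a s)| * |dslope (u a) 0 s|) ≤
          4 * Real.pi * (c / 2 / M * (B + 1)) := by gcongr
      have h8 : 0 ≤ 4 * Real.pi * C * (4 * Real.pi * (c / 2 / M * (B + 1))) := by positivity
      linarith
  refine ((tendsto_const_nhds (x := r)).mul key).congr' ?_ |>.trans (le_of_eq ?_)
  · filter_upwards [Ioo_mem_nhds ha.1 ha.2] with μ hμ using
      (hu μ (Ioo_subset_Ioc_self hμ)).mul_dslope r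
  · rw [(hu a ha').mul_dslope r]

end

/-! ### Mass, mass-radius ratio and the index -/

namespace IsRegularSolution
variable {q u p : ℝ → ℝ} (h : IsRegularSolution q u p)
include h

lemma eq_affine {T r : ℝ} (hT : 0 ≤ T) (hqT : ∀ r, T ≤ r → q r = 0) (hr : T ≤ r) :
    u r = u T + p T * (r - T) := by
  have hp : ∀ s ∈ Icc T r, p s = p T := constant_of_has_deriv_right_zero
    (fun s hs => (h.hasDerivAt_p s (hT.trans hs.1)).continuousAt.continuousWithinAt)
    (fun s hs => ((h.hasDerivAt_p s (hT.trans hs.1)).congr_deriv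
      (by rw [hqT s hs.1]; simp)).hasDerivWithinAt)
  have hd : ∀ s ∈ Icc T r, HasDerivAt (fun s => u s - p T * s) 0 s := fun s hs =>
    ((h.hasDerivAt_u s (hT.trans hs.1)).sub ((hasDerivAt_id s).const_mul (p T))).congr_deriv
      (by rw [hp s hs]; simp)
  have := constant_of_has_deriv_right_zero
    (fun s hs => (hd s hs).continuousAt.continuousWithinAt)
    (fun s hs => (hd s (Ico_subset_Icc_self hs)).hasDerivWithinAt) r (right_mem_Icc.2 hr)
  linarith

lemma exists_ne_zero {C a b : ℝ} (hC : ∀ r, |q r| ≤ C) (ha : 0 ≤ a) (hab : a < b) :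
    ∃ r ∈ Ioo a b, u r ≠ 0 := by
  by_contra! hcon
  obtain ⟨r, hr⟩ := nonempty_Ioo.2 hab
  have hr0 : 0 ≤ r := ha.trans hr.1.le
  have h1 : HasDerivAt u 0 r := (hasDerivAt_const r (0 : ℝ)).congr_of_eventuallyEq (by
    filter_upwards [Ioo_mem_nhds hr.1 hr.2] with s hs using hcon s hs)
  have h2 := (h.hasDerivAt_u r hr0).unique h1
  have := h.sq_add_sq_pos hC hr0
  rw [hcon r hr, h2] at this
  simp at this

/-- There are meshes which avoid the zeros of a regular solution and reach beyond a given radius: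
pick a node inside each interval `(iε, (i + 1)ε)`. -/
lemma exists_isMesh {C : ℝ} (hC : ∀ r, |q r| ≤ C) (T : ℝ) :
    ∃ t m, IsMesh C t ∧ (∀ i, u (t i) ≠ 0) ∧ T < t m := by
  have hC0 : 0 ≤ C := (abs_nonneg _).trans (hC 0)
  set ε := 1 / (4 * (C + 1)) with hε
  have hε0 : 0 < ε := by positivity
  have hshort : C * (2 * ε) ^ 2 ≤ 1 / 4 := by
    rw [hε]
    have : C * (2 * (1 / (4 * (C + 1)))) ^ 2 = C / (4 * (C + 1) ^ 2) := by field_simp; ring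
    rw [this, div_le_div_iff₀ (by positivity) (by norm_num)]
    nlinarith
  have hex : ∀ i : ℕ, ∃ r ∈ Ioo (i * ε) ((i + 1) * ε), u r ≠ 0 := fun i =>
    h.exists_ne_zero hC (by positivity) (by linarith)
  choose t ht hne using hex
  obtain ⟨m, hm⟩ := exists_nat_ge (T / ε)
  rw [div_le_iff₀ hε0] at hm
  refine ⟨t, m, ⟨?_, strictMono_nat_of_lt_succ fun i => ?_, ?_, fun i => ?_⟩, hne,
    hm.trans_lt (ht m).1⟩
  · simpa using (ht 0).1
  · have h1 := (ht i).2
    have h2 := (ht (i + 1)).1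
    push_cast at h2
    linarith
  · have h1 := (ht 0).1
    have h2 := (ht 0).2
    simp only [Nat.cast_zero, zero_mul, zero_add, one_mul] at h1 h2
    refine le_trans ?_ hshort
    gcongr
    linarith
  · have h1 := (ht i).1
    have h2 := (ht (i + 1)).2
    have h3 := (ht i).2
    have h4 := (ht (i + 1)).1
    push_cast at h2 h4
    refine le_trans ?_ hshort
    gcongr
    · linarith
    · linarith

end IsRegularSolution

open Classical in
lemma card_signChanges (u p : ℝ → ℝ) (t : ℕ → ℝ) (m : ℕ) :
    (signChanges u p t m).card =
      ((Finset.range m).filter fun i => u (t i) * u (t (i + 1)) < 0).card +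
        if u (t m) * p (t m) < 0 then 1 else 0 := by
  have h1 : ((Finset.range m).filter fun i =>
      if i = m then u (t m) * p (t m) < 0 else u (t i) * u (t (i + 1)) < 0) =
      (Finset.range m).filter fun i => u (t i) * u (t (i + 1)) < 0 := by
    refine Finset.filter_congr fun i hi => ?_
    rw [if_neg (Finset.mem_range.1 hi).ne]
  unfold signChanges
  rw [Finset.range_add_one, Finset.filter_insert, h1]
  simp only [if_true]
  split_ifs with h2
  · rw [Finset.card_insert_of_notMem (by simp)]
  · simp

lemma mul_neg_iff_of_mul_pos {a b c d : ℝ} (hab : 0 < a * b) (hcd : 0 < c * d) :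
    a * c < 0 ↔ b * d < 0 := by
  have h1 : (a * c) * (b * d) = (a * b) * (c * d) := by ring
  have h2 : 0 < (a * c) * (b * d) := by rw [h1]; positivity
  rcases pos_and_pos_or_neg_and_neg_of_mul_pos h2 with ⟨h3, h4⟩ | ⟨h3, h4⟩
  · exact iff_of_false (not_lt.2 h3.le) (not_lt.2 h4.le)
  · exact iff_of_true h3 h4

section
variable {P D : ℝ → ℝ} {γ₀ K μ₁ C : ℝ} (h : IsPressureLaw P γ₀ K)
  (hstar : ∀ μ ∈ Ioc 0 μ₁, HasStar P μ)
  (hC : ∀ s, |D s| ≤ C)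
  (hD : ∀ s ≤ enthalpyDeriv P μ₁, HasDerivAt (Fplus P) (D s) s) (hunif : UniformContinuous D)
include h hstar hC hD hunif

lemma eventually_radius_lt {a T : ℝ} (ha : a ∈ Ioo 0 μ₁) (hT : radius P a < T) :
    ∀ᶠ μ in 𝓝 a, μ ∈ Ioo 0 μ₁ ∧ radius P μ < T := by
  have hs := hstar a (Ioo_subset_Ioc_self ha)
  have hT0 : 0 < T := hs.isStarProfile.radius_pos.trans hT
  have hneg : ∀ μ ∈ Ioo 0 μ₁, radius P μ < T ↔ profile P μ T < 0 := fun μ hμ => by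
    have hy := (hstar μ (Ioo_subset_Ioc_self hμ)).isStarProfile
    rw [← hy.vanish, (hy.strictAntiOn h hμ.1).lt_iff_gt hT0.le hy.radius_pos.le]
  obtain ⟨u, p, hu⟩ := exists_isRegularSolution (C := 4 * Real.pi * C)
    (continuous_starPotential hs h ha.1) fun r => by
      have hpi := Real.pi_pos
      rw [starPotential, abs_mul, abs_of_pos (by positivity : 0 < 4 * Real.pi),
        (hD _ (profile_le h hstar (Ioo_subset_Ioc_self ha) (abs_nonneg r))).deriv]
      gcongr
      exact hC _
  have hc := (hasDerivAt_profile h hstar hC hD hunif ha hu hT0).continuousAt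
  filter_upwards [Ioo_mem_nhds ha.1 ha.2,
    hc.eventually_lt continuousAt_const ((hneg a ha).1 hT)] with μ h1 h2
  exact ⟨h1, (hneg μ h1).2 h2⟩

lemma hasDerivAt_mass {a T : ℝ} (ha : a ∈ Ioo 0 μ₁) (hT : radius P a < T) {u p : ℝ → ℝ}
    (hu : IsRegularSolution (starPotential P a) u p) :
    HasDerivAt (mass P) (deriv P a / a * (u T - T * p T)) a := by
  have hs := hstar a (Ioo_subset_Ioc_self ha)
  have hT0 : 0 < T := hs.isStarProfile.radius_pos.trans hT
  have h1 := hasDerivAt_profile h hstar hC hD hunif ha hu hT0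
  have h2 := hasDerivAt_profile h hstar hC hD hunif ha hu (by linarith : 0 < 2 * T)
  have h3 := hu.eq_affine hT0.le
    (fun r hr => starPotential_eq_zero hs h ha.1 (hT.le.trans hr)) (by linarith : T ≤ 2 * T)
  refine (((h1.sub h2).const_mul (2 * T)).congr_of_eventuallyEq ?_).congr_deriv ?_
  · filter_upwards [eventually_radius_lt h hstar hC hD hunif ha hT] with μ hμ
    exact mass_eq (hstar μ (Ioo_subset_Ioc_self hμ.1)) h hμ.1.1 hμ.2.le
  · rw [h3]
    field_simp
    ring

lemma hasDerivAt_massRadiusRatio {a T : ℝ} (ha : a ∈ Ioo 0 μ₁) (hT : radius P a < T)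
    {u p : ℝ → ℝ} (hu : IsRegularSolution (starPotential P a) u p) :
    HasDerivAt (massRadiusRatio P) (-(deriv P a / a * p T)) a := by
  have hs := hstar a (Ioo_subset_Ioc_self ha)
  have hT0 : 0 < T := hs.isStarProfile.radius_pos.trans hT
  have h1 := hasDerivAt_profile h hstar hC hD hunif ha hu hT0
  have h2 := hasDerivAt_profile h hstar hC hD hunif ha hu (by linarith : 0 < 2 * T)
  have h3 := hu.eq_affine hT0.le
    (fun r hr => starPotential_eq_zero hs h ha.1 (hT.le.trans hr)) (by linarith : T ≤ 2 * T)
  refine ((h1.sub (h2.const_mul 2)).congr_of_eventuallyEq ?_).congr_deriv ?_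
  · filter_upwards [eventually_radius_lt h hstar hC hD hunif ha hT] with μ hμ
    exact massRadiusRatio_eq (hstar μ (Ioo_subset_Ioc_self hμ.1)) h hμ.1.1 hμ.2.le
  · rw [h3]
    field_simp
    ring

end

open Classical in
/-- If `u(r) = A r + B` outside the star, then `M'` and `(M/R)'` are positive multiples of `B` and
`-A` (here `U = u(T)` and `B = U - T A`); where `B` has the sign of `u(T)`, the index says whether
`u` has a zero beyond `T`. -/
lemma turningIndex_eq {P : ℝ → ℝ} {μ g U A T : ℝ} (hg : 0 < g)
    (h1 : HasDerivAt (mass P) (g * (U - T * A)) μ)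
    (h2 : HasDerivAt (massRadiusRatio P) (-(g * A)) μ) (hU : 0 < U * (U - T * A)) :
    turningIndex P μ = if U * A < 0 then 1 else 0 := by
  rw [turningIndex, h1.deriv, h2.deriv]
  have hB : U - T * A ≠ 0 := fun h0 => by simp [h0] at hU
  have h3 : g * (U - T * A) * -(g * A) = -(g ^ 2 * ((U - T * A) * A)) := by ring
  congr 1
  rw [h3, or_iff_left (mul_ne_zero hg.ne' hB), neg_pos, eq_iff_iff]
  have h4 : (U - T * A) * A < 0 ↔ U * A < 0 := by
    rcases eq_or_ne A 0 with rfl | hA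
    · simp
    · exact mul_neg_iff_of_mul_pos (by rwa [mul_comm]) (mul_self_pos.2 hA)
  rw [← h4]
  have hg2 : 0 < g ^ 2 := by positivity
  exact ⟨fun h5 => neg_of_mul_neg_right h5 hg2.le, fun h5 => mul_neg_of_pos_of_neg hg2 h5⟩

lemma hasJumpAt_congr {f g : ℝ → ℤ} {x : ℝ} {c : ℤ} (h : ∀ᶠ t in 𝓝 x, f t = c + g t) (d : ℤ) :
    HasJumpAt f x d ↔ HasJumpAt g x d := by
  have hl : ∀ᶠ t in 𝓝[<] x, f t = c + g t := h.filter_mono nhdsWithin_le_nhds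
  have hr : ∀ᶠ t in 𝓝[>] x, f t = c + g t := h.filter_mono nhdsWithin_le_nhds
  constructor
  · rintro ⟨a, b, ha, hb, hab⟩
    refine ⟨a - c, b - c, ?_, ?_, by omega⟩
    · filter_upwards [ha, hl] with t h1 h2
      omega
    · filter_upwards [hb, hr] with t h1 h2
      omega
  · rintro ⟨a, b, ha, hb, hab⟩
    refine ⟨c + a, c + b, ?_, ?_, by omega⟩
    · filter_upwards [ha, hl] with t h1 h2
      omega
    · filter_upwards [hb, hr] with t h1 h2
      omega

/-- Near `μs` only the sign change beyond the last node of the mesh can appear or disappear, and it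
is counted by the turning index. -/
theorem eventually_morseIndex_eq {P : ℝ → ℝ} {γ₀ K : ℝ} (h : IsPressureLaw P γ₀ K)
    {μs : ℝ} (hpos : 0 < μs) (hmax : (μs : EReal) < muMax P)
    (hcrit : HasDerivAt (massRadiusRatio P) 0 μs) :
    ∃ n : ℕ, morseIndex P μs = n ∧ ∀ᶠ μ in 𝓝 μs,
      DifferentiableAt ℝ (mass P) μ ∧ DifferentiableAt ℝ (massRadiusRatio P) μ ∧
      morseIndex P μ = (n + turningIndex P μ : ℕ) := by
  classical
  have hpi := Real.pi_pos
  obtain ⟨_, ⟨μ₁, ⟨hμ₁, hstar⟩, rfl⟩, hlt⟩ := lt_sSup_iff.1 hmax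
  have hlt : μs < μ₁ := EReal.coe_lt_coe_iff.1 hlt
  have hs : μs ∈ Ioo 0 μ₁ := ⟨hpos, hlt⟩
  obtain ⟨D, hunif, ⟨C, -, hDC⟩, -, hD⟩ := h.exists_deriv_Fplus_eq (by linarith : 0 < μ₁ + 1)
    (h.strictMonoOn_enthalpyDeriv (mem_Ici.2 hμ₁.le) (mem_Ici.2 (by linarith)) (lt_add_one μ₁))
  have hC : ∀ s, |D s| ≤ C := fun s => by rw [abs_of_nonneg (hDC s).1]; exact (hDC s).2
  have hqC : ∀ μ ∈ Ioc 0 μ₁, ∀ r, starPotential P μ r ≤ 4 * Real.pi * C := fun μ hμ r => by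
    rw [starPotential, (hD _ (profile_le h hstar hμ (abs_nonneg r))).deriv]
    have := (hDC (profile P μ |r|)).2
    gcongr
  have hqabs : ∀ μ ∈ Ioc 0 μ₁, ∀ r, |starPotential P μ r| ≤ 4 * Real.pi * C := fun μ hμ r => by
    rw [abs_of_nonneg (starPotential_nonneg (hstar μ hμ) h hμ.1 r)]
    exact hqC μ hμ r
  have hex : ∀ μ, ∃ u p, μ ∈ Ioc 0 μ₁ → IsRegularSolution (starPotential P μ) u p := by
    intro μ
    by_cases hμ : μ ∈ Ioc 0 μ₁
    · obtain ⟨u, p, hu⟩ := exists_isRegularSolution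
        (continuous_starPotential (hstar μ hμ) h hμ.1) (hqabs μ hμ)
      exact ⟨u, p, fun _ => hu⟩
    · exact ⟨0, 0, fun h0 => absurd h0 hμ⟩
  choose u p hu using hex
  have hus := hu μs (Ioo_subset_Ioc_self hs)
  obtain ⟨t, m, ht, hne, hRT⟩ := hus.exists_isMesh (hqabs μs (Ioo_subset_Ioc_self hs))
    (radius P μs)
  set T := t m with hT
  have hT0 : 0 < T := ht.pos' m
  have hg : ∀ μ, 0 < μ → 0 < deriv P μ / μ := fun μ hμ => div_pos (h.deriv_pos μ hμ) hμ
  -- criticality says that the regular solution at `μs` is constant outside the star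
  have hps : p μs T = 0 := by
    have h1 := (hasDerivAt_massRadiusRatio h hstar hC hD hunif hs hRT hus).unique hcrit
    have h2 := (hg μs hpos).ne'
    simpa [h2] using h1
  have haff : ∀ μ ∈ Ioc 0 μ₁, radius P μ < T → 2 * u μ T - u μ (2 * T) = u μ T - T * p μ T := by
    intro μ hμ hR
    have := (hu μ hμ).eq_affine hT0.le
      (fun r hr => starPotential_eq_zero (hstar μ hμ) h hμ.1 (hR.le.trans hr))
      (by linarith : T ≤ 2 * T)
    rw [this]
    ring
  have hcont := fun r (hr : 0 < r) => tendsto_regularSolution h hstar hC hD hunif hs hu hr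
  -- the sign changes at the nodes up to `T` are the same for all `μ` near `μs`
  have hnodes : ∀ᶠ μ in 𝓝 μs, ∀ i ∈ Finset.range (m + 1), 0 < u μ (t i) * u μs (t i) := by
    rw [Filter.eventually_all_finset]
    intro i _
    have h1 := (hcont (t i) (ht.pos' i)).mul_const (u μs (t i))
    exact h1.eventually (lt_mem_nhds (mul_self_pos.2 (hne i)))
  -- `B = 2 u(T) - u(2T)` keeps the sign of `u(T)`, as `B = u(T)` at `μs`
  have hlast : ∀ᶠ μ in 𝓝 μs, 0 < (2 * u μ T - u μ (2 * T)) * u μs T := by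
    have h1 := (((hcont T hT0).const_mul 2).sub (hcont (2 * T) (by linarith))).mul_const (u μs T)
    refine h1.eventually (lt_mem_nhds ?_)
    rw [haff μs (Ioo_subset_Ioc_self hs) hRT, hps, mul_zero, sub_zero]
    exact mul_self_pos.2 (hne m)
  set n := ((Finset.range m).filter fun i => u μs (t i) * u μs (t (i + 1)) < 0).card with hn
  have hmain : ∀ᶠ μ in 𝓝 μs,
      DifferentiableAt ℝ (mass P) μ ∧ DifferentiableAt ℝ (massRadiusRatio P) μ ∧
      morseIndex P μ = (n + turningIndex P μ : ℕ) := by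
    filter_upwards [eventually_radius_lt h hstar hC hD hunif hs hRT, hnodes, hlast]
      with μ hμ hμn hμl
    have hμ' : μ ∈ Ioc 0 μ₁ := Ioo_subset_Ioc_self hμ.1
    have hm := hasDerivAt_mass h hstar hC hD hunif hμ.1 hμ.2 (hu μ hμ')
    have hr := hasDerivAt_massRadiusRatio h hstar hC hD hunif hμ.1 hμ.2 (hu μ hμ')
    refine ⟨hm.differentiableAt, hr.differentiableAt, ?_⟩
    have hμi : ∀ i ≤ m, 0 < u μ (t i) * u μs (t i) := fun i hi =>
      hμn i (Finset.mem_range.2 (Nat.lt_succ_of_le hi))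
    rw [haff μ hμ' hμ.2] at hμl
    have hsame : 0 < u μ T * (u μ T - T * p μ T) := by
      have h1 := mul_pos (hμi m le_rfl) hμl
      have h2 : 0 < u μs T ^ 2 := by have := hne m; positivity
      refine pos_of_mul_pos_left (b := u μs T ^ 2) ?_ h2.le
      refine h1.trans_le (le_of_eq ?_)
      ring
    rw [turningIndex_eq (hg μ hμ.1.1) hm hr hsame,
      morseIndex_eq_radialIndex (hstar μ hμ') h hμ.1.1,
      radialIndex_eq (continuous_starPotential (hstar μ hμ') h hμ.1.1)
        (starPotential_nonneg (hstar μ hμ') h hμ.1.1) (hqC μ hμ')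
        (fun r hr => starPotential_eq_zero (hstar μ hμ') h hμ.1.1 (hμ.2.le.trans hr))
        (hu μ hμ') ht (fun i hi h0 => by have := hμi i hi; simp [h0] at this),
      card_signChanges, hn, Finset.filter_congr fun i hi => mul_neg_iff_of_mul_pos
        (hμi i (Finset.mem_range.1 hi).le) (hμi (i + 1) (Finset.mem_range.1 hi))]
  refine ⟨n, ?_, hmain⟩
  have hts : turningIndex P μs = 0 := by
    rw [turningIndex_eq (hg μs hpos) (hasDerivAt_mass h hstar hC hD hunif hs hRT hus)
      (hasDerivAt_massRadiusRatio h hstar hC hD hunif hs hRT hus) ?_, hps, mul_zero,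
      if_neg (lt_irrefl _)]
    rw [hps, mul_zero, sub_zero]
    exact mul_self_pos.2 (hne m)
  have := hmain.self_of_nhds.2.2
  rwa [hts, add_zero] at this

end GaseousStar

theorem proposition3p1 (P : ℝ → ℝ) (γ₀ K : ℝ) (hP : GaseousStar.IsPressureLaw P γ₀ K)
    (μs : ℝ) (hpos : 0 < μs) (hmax : (μs : EReal) < GaseousStar.muMax P)
    (hcrit : HasDerivAt (GaseousStar.massRadiusRatio P) 0 μs) :
    GaseousStar.morseIndex P μs ≠ ⊤ ∧
    (∀ᶠ μ in 𝓝 μs,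
      DifferentiableAt ℝ (GaseousStar.mass P) μ ∧
      DifferentiableAt ℝ (GaseousStar.massRadiusRatio P) μ ∧
      GaseousStar.morseIndex P μ =
        GaseousStar.morseIndex P μs + (GaseousStar.turningIndex P μ : ℕ∞)) ∧
    ∀ d : ℤ,
      GaseousStar.HasJumpAt (fun μ => ((GaseousStar.morseIndex P μ).toNat : ℤ)) μs d ↔
        GaseousStar.HasJumpAt (fun μ => (GaseousStar.turningIndex P μ : ℤ)) μs d := by
  obtain ⟨n, hn, hev⟩ := GaseousStar.eventually_morseIndex_eq hP hpos hmax hcrit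
  refine ⟨by rw [hn]; exact ENat.natCast_ne_top n, ?_, fun d => ?_⟩
  · filter_upwards [hev] with μ hμ
    refine ⟨hμ.1, hμ.2.1, ?_⟩
    rw [hμ.2.2, hn, Nat.cast_add]
  · refine GaseousStar.hasJumpAt_congr (c := n) ?_ d
    filter_upwards [hev] with μ hμ
    rw [hμ.2.2, ENat.toNat_natCast, Nat.cast_add]
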